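/- **Theorem 4.1 (Moment bounds).** Let $(\mathbb X,\mathcal X)$ be a measurable space with a $\sigma$-finite measure $\mu$. Let $\mathsf N(\mathbb X)$ be the space of $\sigma$-finite counting measures on $\mathbb X$, i.e. of $\sigma$-finite measures that are (empty, finite or countably infinite) sums $\sum_i\delta_{x_i}$ of Dirac measures at not necessarily distinct points, with the $\sigma$-field generated by the evaluations $\xi\mapsto\xi(B)$, $B\in\mathcal X$. Let $\eta$ be a Poisson process on $\mathbb X$ with intensity measure $\mu$ on a probability space $(\Omega,\mathcal F,\mathbb P)$, i.e. a measurable map $\eta:\Omega\to\mathsf N(\mathbb X)$ such that $\eta(B)$ is Poisson distributed with mean $\mu(B)$ for every $B\in\mathcal X$ (with $\eta(B)=\infty$ a.s. if $\mu(B)=\infty$) and $\eta(B_1),\dots,\eta(B_n)$ are independent for pairwise disjoint $B_1,\dots,B_n\in\mathcal X$. Let $F$ be an integrable real random variable with $F=f(\eta)$ $\mathbb P$-almost surely for a measurable $f:\mathsf N(\mathbb X)\to\mathbb R$. Put $x_+=\max\{0,x\}$, $x_-=\min\{0,x\}$, $D_xF=f(\eta+\delta_x)-f(\eta)$, $F(\eta)=f(\eta)$,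 $F(\eta-\delta_x)=f(\eta-\delta_x)$ for a point $x$ of $\eta$, and $$V^+=\int_{\mathbb X}(D_xF)_-^2\,\mu(\mathrm dx)+\int_{\mathbb X}\big(F(\eta)-F(\eta-\delta_x)\big)_+^2\,\eta(\mathrm dx),$$ $$V^-=\int_{\mathbb X}(D_xF)_+^2\,\mu(\mathrm dx)+\int_{\mathbb X}\big(F(\eta)-F(\eta-\delta_x)\big)_-^2\,\eta(\mathrm dx),$$ $$V=\int_{\mathbb X}(D_xF)^2\,\mu(\mathrm dx)+\int_{\mathbb X}\big(F(\eta)-F(\eta-\delta_x)\big)^2\,\eta(\mathrm dx),$$ where the integrals against $\eta$ are the sums over the points of $\eta$, counted with multiplicity. For a real- or $[0,\infty]$-valued random variable $Y$ and $q>0$ let $\|Y\|_q=(\mathbb E|Y|^q)^{1/q}\in[0,\infty]$, and let $\kappa=\frac{\sqrt e}{2(\sqrt e-1)}$. Then, for every real $p\ge 2$, as relations in $[0,\infty]$, $$\|(F-\mathbb E F)_+\|_p\le\sqrt{2\kappa p\,\|V^+\|_{p/2}}=\sqrt{2\kappa p}\,\big\|\sqrt{V^+}\big\|_p,$$ $$\|(F-\mathbb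 E F)_-\|_p\le\sqrt{2\kappa p\,\|V^-\|_{p/2}}=\sqrt{2\kappa p}\,\big\|\sqrt{V^-}\big\|_p,$$ $$\|F-\mathbb E F\|_p\le\sqrt{8\kappa p\,\|V\|_{p/2}}=\sqrt{8\kappa p}\,\big\|\sqrt{V}\big\|_p.$$ -/

import Mathlib

open MeasureTheory ProbabilityTheory
open scoped ENNReal NNReal

/-- A counting measure is a countable sum of Dirac measures; the points `x i` need not be distinct,
and the index type may be empty, finite or infinite.  It belongs to the configuration space if it is
moreover σ-finite. -/
def IsCountingMeasure {X : Type*} [MeasurableSpace X] (ξ : Measure X) : Prop :=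
  SigmaFinite ξ ∧ ∃ (ι : Type) (_ : Countable ι) (x : ι → X),
    ξ = Measure.sum fun i => Measure.dirac (x i)

/-- The space `N(X)` of σ-finite counting measures on `X`.  Its σ-field is the one that it inherits
from `Measure X`, which is the σ-field generated by the evaluations `ξ ↦ ξ B`, `B` measurable. -/
abbrev CountingMeasure (X : Type*) [MeasurableSpace X] : Type _ :=
  {ξ : Measure X // IsCountingMeasure ξ}

namespace CountingMeasure

variable {X : Type*} [MeasurableSpace X]

theorem isCountingMeasure_add_dirac {ξ : Measure X} (h : IsCountingMeasure ξ) (x : X) :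
    IsCountingMeasure (ξ + Measure.dirac x) := by
  obtain ⟨hσ, ι, hι, y, rfl⟩ := h
  refine ⟨inferInstance, ι ⊕ Unit, inferInstance, Sum.elim y fun _ => x, ?_⟩
  ext B hB
  rw [Measure.add_apply, Measure.sum_apply _ hB, Measure.sum_apply _ hB,
    Summable.tsum_sum ENNReal.summable ENNReal.summable]
  simp

/-- The counting measure `ξ + δ_x`. -/
noncomputable def addPoint (ξ : CountingMeasure X) (x : X) : CountingMeasure X :=
  ⟨ξ.1 + Measure.dirac x, isCountingMeasure_add_dirac ξ.2 x⟩

open Classical in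
/-- The counting measure `ξ - δ_x`.  It is only used for points `x` of `ξ`, where it is a genuine
difference (`removePoint_add_dirac` below); if `ξ - δ_x` is not a σ-finite counting measure, the
value is `ξ` by convention. -/
noncomputable def removePoint (ξ : CountingMeasure X) (x : X) : CountingMeasure X :=
  if h : IsCountingMeasure (ξ.1 - Measure.dirac x) then ⟨ξ.1 - Measure.dirac x, h⟩ else ξ

/-- An index type for the points of `ξ`, counted with multiplicity. -/
def Index (ξ : CountingMeasure X) : Type := ξ.2.2.choose

/-- The points of `ξ`, listed with multiplicity: `ξ = ∑ i, δ_(point ξ i)`. -/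
noncomputable def point (ξ : CountingMeasure X) : ξ.Index → X :=
  ξ.2.2.choose_spec.choose_spec.choose

/-- The integral `∫ g(x) ξ(dx)` of a nonnegative function against a counting measure, that is the sum
of the values of `g` at the points of `ξ`, with multiplicity.  It is the Lebesgue integral whenever
`g` is measurable or the singletons of `X` are measurable, and for functions that see a
point only through its Dirac measure it does not depend on the choice of the list of points; see
`integral_eq_lintegral`, `integral_eq_lintegral'` and `integral_eq_tsum`. -/
noncomputable def integral (ξ : CountingMeasure X) (g : X → ℝ≥0∞) : ℝ≥0∞ :=
  ∑' i : ξ.Index, g (ξ.point i)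

theorem countable_index (ξ : CountingMeasure X) : Countable ξ.Index :=
  ξ.2.2.choose_spec.choose

theorem eq_sum_dirac (ξ : CountingMeasure X) :
    ξ.1 = Measure.sum fun i : ξ.Index => Measure.dirac (ξ.point i) :=
  ξ.2.2.choose_spec.choose_spec.choose_spec

theorem integral_eq_lintegral (ξ : CountingMeasure X) {g : X → ℝ≥0∞} (hg : Measurable g) :
    ξ.integral g = ∫⁻ x, g x ∂ξ.1 := by
  rw [eq_sum_dirac ξ, lintegral_sum_measure]
  exact tsum_congr fun i => (lintegral_dirac' _ hg).symm

theorem integral_eq_lintegral' [MeasurableSingletonClass X] (ξ : CountingMeasure X)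
    (g : X → ℝ≥0∞) : ξ.integral g = ∫⁻ x, g x ∂ξ.1 := by
  rw [eq_sum_dirac ξ, lintegral_sum_measure]
  exact tsum_congr fun i => (lintegral_dirac _ _).symm

theorem removePoint_addPoint (ξ : CountingMeasure X) (x : X) :
    (ξ.addPoint x).removePoint x = ξ := by
  have h : (ξ.addPoint x).1 - Measure.dirac x = ξ.1 := Measure.add_sub_cancel
  have h' : IsCountingMeasure ((ξ.addPoint x).1 - Measure.dirac x) := h ▸ ξ.2
  rw [removePoint, dif_pos h']
  exact Subtype.ext h

theorem exists_eq_addPoint {ι : Type} [Countable ι] (ξ : CountingMeasure X) (x : ι → X)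
    (hx : ξ.1 = Measure.sum fun i => Measure.dirac (x i)) (i : ι) :
    ∃ ζ : CountingMeasure X, ξ = ζ.addPoint (x i) := by
  classical
  have key : ξ.1 = (Measure.sum fun j : ({i}ᶜ : Set ι) => Measure.dirac (x j)) +
      Measure.dirac (x i) := by
    rw [hx, ← Measure.sum_add_sum_compl {i} fun i => Measure.dirac (x i), add_comm]
    congr 1
    ext B hB
    rw [Measure.sum_apply _ hB, tsum_fintype]
    simp
  have hσ := ξ.2.1
  have hle : (Measure.sum fun j : ({i}ᶜ : Set ι) => Measure.dirac (x j)) ≤ ξ.1 := by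
    rw [key]
    exact Measure.le_add_right le_rfl
  have hσ' := Measure.sigmaFinite_of_le ξ.1 hle
  exact ⟨⟨_, hσ', _, inferInstance, fun j : ({i}ᶜ : Set ι) => x j, rfl⟩, Subtype.ext key⟩

/-- At the points of `ξ` the removal of a point is the difference `ξ - δ_x`. -/
theorem removePoint_add_dirac (ξ : CountingMeasure X) (i : ξ.Index) :
    (ξ.removePoint (ξ.point i)).1 + Measure.dirac (ξ.point i) = ξ.1 := by
  have := countable_index ξ
  obtain ⟨ζ, hζ⟩ := exists_eq_addPoint (ι := ξ.Index) ξ ξ.point (eq_sum_dirac ξ) i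
  generalize ξ.point i = x at hζ
  subst hζ
  rw [removePoint_addPoint]
  rfl

/-- The multiplicity of a point in a list of points of `ξ` depends on `ξ` only. -/
theorem tsum_ite_dirac_eq {ι : Type} (ξ : CountingMeasure X) (x : ι → X)
    (hx : ξ.1 = Measure.sum fun i => Measure.dirac (x i)) (a : X)
    [∀ i, Decidable (Measure.dirac (x i) = Measure.dirac a)] :
    (∑' i, if Measure.dirac (x i) = Measure.dirac a then (1 : ℝ≥0∞) else 0) = ξ.1 {a} := by
  classical
  have hσ := ξ.2.1
  have happ : ∀ B, MeasurableSet B → ξ.1 B = ∑' i, B.indicator (1 : X → ℝ≥0∞) (x i) := by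
    intro B hB
    rw [hx, Measure.sum_apply _ hB]
    exact tsum_congr fun i => Measure.dirac_apply' _ hB
  apply le_antisymm
  · rw [← measure_toMeasurable, happ _ (measurableSet_toMeasurable _ _)]
    refine ENNReal.tsum_le_tsum fun i => ?_
    split_ifs with h
    · have hB := measurableSet_toMeasurable ξ.1 {a}
      have ha : a ∈ toMeasurable ξ.1 {a} := subset_toMeasurable _ _ rfl
      rw [← Measure.dirac_apply' _ hB, h, Measure.dirac_apply' _ hB]
      simp [ha]
    · exact zero_le
  · obtain ⟨n, hn⟩ := Set.mem_iUnion.1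
      ((iUnion_spanningSets ξ.1).symm ▸ Set.mem_univ a : a ∈ ⋃ i, spanningSets ξ.1 i)
    set B := spanningSets ξ.1 n
    have hB : MeasurableSet B := measurableSet_spanningSets _ _
    have hfin : {i | x i ∈ B}.Finite := by
      have h1 : (∑' i, B.indicator (1 : X → ℝ≥0∞) (x i)) ≠ ⊤ := by
        rw [← happ B hB]; exact (measure_spanningSets_lt_top _ _).ne
      have h2 := ENNReal.finite_const_le_of_tsum_ne_top h1 one_ne_zero
      refine h2.subset fun i hi => ?_
      have hi' : x i ∈ B := hi
      simp [hi']
    have hsep : ∀ i, ∃ A, MeasurableSet A ∧ a ∈ A ∧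
        (Measure.dirac (x i) ≠ Measure.dirac a → x i ∉ A) := by
      intro i
      by_cases h : Measure.dirac (x i) = Measure.dirac a
      · exact ⟨Set.univ, .univ, trivial, fun h' => (h' h).elim⟩
      · have : ∃ A, MeasurableSet A ∧ Measure.dirac (x i) A ≠ Measure.dirac a A := by
          by_contra! hcon
          exact h (Measure.ext hcon)
        obtain ⟨A, hA, hne⟩ := this
        rw [Measure.dirac_apply' _ hA, Measure.dirac_apply' _ hA] at hne
        by_cases haA : a ∈ A
        · exact ⟨A, hA, haA, fun _ hxA => hne (by simp [haA, hxA])⟩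
        · refine ⟨Aᶜ, hA.compl, haA, fun _ hxA => hne ?_⟩
          have hxA' : x i ∉ A := hxA
          simp [haA, hxA']
    choose A hA haA hxA using hsep
    have hC : MeasurableSet (B ∩ ⋂ i ∈ {i | x i ∈ B}, A i) :=
      hB.inter (hfin.measurableSet_biInter fun i _ => hA i)
    calc ξ.1 {a} ≤ ξ.1 (B ∩ ⋂ i ∈ {i | x i ∈ B}, A i) := by
          refine measure_mono (Set.singleton_subset_iff.2 ⟨hn, ?_⟩)
          simp [haA]
      _ = _ := happ _ hC
      _ ≤ _ := by
          refine ENNReal.tsum_le_tsum fun i => ?_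
          split_ifs with h
          · exact Set.indicator_le_self' (by simp) _
          · rw [Set.indicator_of_notMem]
            rintro ⟨h1, h2⟩
            exact hxA i h (Set.mem_iInter₂.1 h2 i h1)

theorem tsum_eq_tsum_dirac {ι : Type} (ξ : CountingMeasure X) (x : ι → X)
    (hx : ξ.1 = Measure.sum fun i => Measure.dirac (x i)) (g : Measure X → ℝ≥0∞) :
    ∑' i, g (Measure.dirac (x i)) =
      ∑' ν : Set.range (Measure.dirac : X → Measure X), ξ.1 {ν.2.choose} * g ν := by
  classical
  have h : ∀ ν : Set.range (Measure.dirac : X → Measure X), ξ.1 {ν.2.choose} * g ν =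
      ∑' i, if Measure.dirac (x i) = ν.1 then g ν else 0 := by
    intro ν
    rw [← tsum_ite_dirac_eq ξ x hx ν.2.choose, ← ENNReal.tsum_mul_right]
    refine tsum_congr fun i => ?_
    rw [ν.2.choose_spec]
    split_ifs <;> simp
  simp_rw [h]
  rw [ENNReal.tsum_comm]
  refine tsum_congr fun i => ?_
  rw [tsum_eq_single (⟨Measure.dirac (x i), x i, rfl⟩ : Set.range (Measure.dirac : X → Measure X))]
  · simp
  · intro ν hν
    rw [if_neg]
    exact fun h => hν (Subtype.ext h.symm)

/-- The integral of a function of `δ_x` may be computed with any list of the points of `ξ`. -/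
theorem integral_eq_tsum {ι : Type} (ξ : CountingMeasure X) (x : ι → X)
    (hx : ξ.1 = Measure.sum fun i => Measure.dirac (x i)) (g : Measure X → ℝ≥0∞) :
    ξ.integral (fun a => g (Measure.dirac a)) = ∑' i, g (Measure.dirac (x i)) := by
  rw [tsum_eq_tsum_dirac ξ x hx g]
  exact tsum_eq_tsum_dirac ξ ξ.point (eq_sum_dirac ξ) g

end CountingMeasure

/-- The Poisson distribution with mean `m ∈ [0,∞]`, as a law on `[0,∞]`; for `m = ∞` it is the unit
mass at `∞`. -/
noncomputable def poissonLaw (m : ℝ≥0∞) : Measure ℝ≥0∞ :=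
  if m = ∞ then Measure.dirac ∞ else (poissonMeasure m.toNNReal).map fun n : ℕ => (n : ℝ≥0∞)

/-- `η` is a Poisson process on `X` with intensity measure `μ`, defined on `(Ω, P)`. -/
structure IsPoissonProcess {Ω X : Type*} [MeasurableSpace Ω] [MeasurableSpace X]
    (η : Ω → CountingMeasure X) (μ : Measure X) (P : Measure Ω) : Prop where
  measurable : Measurable η
  map_eq : ∀ B : Set X, MeasurableSet B → P.map (fun ω => (η ω).1 B) = poissonLaw (μ B)
  indep : ∀ (n : ℕ) (B : Fin n → Set X), (∀ i, MeasurableSet (B i)) →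
    (∀ i j, i ≠ j → Disjoint (B i) (B j)) → iIndepFun (fun i ω => (η ω).1 (B i)) P

section Functionals

variable {X : Type*} [MeasurableSpace X]

/-- `D_x F = f(ξ + δ_x) - f(ξ)`. -/
noncomputable def addDiff (f : CountingMeasure X → ℝ) (ξ : CountingMeasure X) (x : X) : ℝ :=
  f (ξ.addPoint x) - f ξ

/-- `f(ξ) - f(ξ - δ_x)`. -/
noncomputable def removeDiff (f : CountingMeasure X → ℝ) (ξ : CountingMeasure X) (x : X) : ℝ :=
  f ξ - f (ξ.removePoint x)

/-- `V⁺ = ∫ (D_x F)_-² μ(dx) + ∫ (F(ξ) - F(ξ - δ_x))_+² ξ(dx)`, with values in `[0,∞]`. -/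
noncomputable def VPlus (μ : Measure X) (f : CountingMeasure X → ℝ) (ξ : CountingMeasure X) :
    ℝ≥0∞ :=
  (∫⁻ x, ENNReal.ofReal ((min 0 (addDiff f ξ x)) ^ 2) ∂μ) +
    ξ.integral fun x => ENNReal.ofReal ((max 0 (removeDiff f ξ x)) ^ 2)

/-- `V⁻ = ∫ (D_x F)_+² μ(dx) + ∫ (F(ξ) - F(ξ - δ_x))_-² ξ(dx)`, with values in `[0,∞]`. -/
noncomputable def VMinus (μ : Measure X) (f : CountingMeasure X → ℝ) (ξ : CountingMeasure X) :
    ℝ≥0∞ :=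
  (∫⁻ x, ENNReal.ofReal ((max 0 (addDiff f ξ x)) ^ 2) ∂μ) +
    ξ.integral fun x => ENNReal.ofReal ((min 0 (removeDiff f ξ x)) ^ 2)

/-- `V = ∫ (D_x F)² μ(dx) + ∫ (F(ξ) - F(ξ - δ_x))² ξ(dx)`, with values in `[0,∞]`. -/
noncomputable def VTotal (μ : Measure X) (f : CountingMeasure X → ℝ) (ξ : CountingMeasure X) :
    ℝ≥0∞ :=
  (∫⁻ x, ENNReal.ofReal ((addDiff f ξ x) ^ 2) ∂μ) +
    ξ.integral fun x => ENNReal.ofReal ((removeDiff f ξ x) ^ 2)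

end Functionals

/-- The constant `κ = √e / (2 (√e - 1))`. -/
noncomputable def kappa : ℝ :=
  Real.sqrt (Real.exp 1) / (2 * (Real.sqrt (Real.exp 1) - 1))

/-! The proof is the entropy method for moments, run on Poisson space. Write D_a(x, y) = y^a - x^a -
a x^(a-1) (y - x) for the Bregman divergence of the power a and Ent_a(G) = E G^a - (E G)^a, with 1 <
a ≤ 2. The functional inequality behind everything is Ent_a(G) ≤ E ∫ D_a(G(η), G(η + δ_x)) μ(dx) for
bounded nonnegative G (`IsPoissonLaw.ofReal_powEntropy_le`).

It rests on the joint convexity of D_a, which holds exactly because a ≤ 2 and which makes Ent_a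
subadditive over independent components (`powEntropy_prod_le`). For finite μ the process is a
superposition of n + 1 independent processes of intensity μ/(n + 1). Each of them has two or more
points only with probability O(n^(-2)), so as n → ∞ only the one-point increments survive
(`ofReal_powEntropy_poissonExp_le`). For σ-finite μ the process splits into independent parts inside
and outside a set of finite measure (`IsPoissonLaw.eq_map_add_restrict`). The outer part contributes
an error which vanishes by martingale convergence.

For moments, put Z = (F - m)_+, G = Z^(q-1) and a = q/(q-1), so that G^a = Z^q. An elementary bound
on D_a (`powBregman_rpow_le`) produces squared positive increments, and the Mecke formula
(`IsPoissonLaw.lintegral_integral`) turns the increments at added points where F grows into the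
integral over points of η that enters V⁺. The outcome is E Z^q ≤ (E Z^(q-1))^(q/(q-1)) + q E[V⁺
Z^(q-2)]. Hölder's inequality and induction over unit steps of q finish the bounded case
(`integral_rpow_le_of_powEntropy_le`). The constant κ is the one that closes this induction, since
1/(2κ) = 1 - e^(-1/2) and (1 - 1/q)^(q/2) ≤ e^(-1/2).

Truncation decreases V⁺, so Fatou's lemma removes boundedness. The lower tail is the upper tail of
-F, and the two-sided bound is the triangle inequality. -/

open Filter Topology

/-! ### Joint convexity of the Bregman divergence of a power -/

section Analysis

/-- The Bregman divergence of `x ↦ x ^ a`. -/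
noncomputable def powBregman (a x y : ℝ) : ℝ := y ^ a - x ^ a - a * x ^ (a - 1) * (y - x)

/-- For x > 0 this is Bernoulli's inequality at y/x, rescaled by x^a. -/
theorem powBregman_nonneg {a x y : ℝ} (ha : 1 < a) (hx : 0 ≤ x) (hy : 0 ≤ y) :
    0 ≤ powBregman a x y := by
  rcases hx.eq_or_lt with rfl | hx
  · simp only [powBregman]
    rw [Real.zero_rpow (by linarith), Real.zero_rpow (by linarith)]
    have := Real.rpow_nonneg hy a
    linarith
  · have h := one_add_mul_self_le_rpow_one_add (s := y / x - 1)
      (by have := div_nonneg hy hx.le; linarith) ha.le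
    have hxa : 0 < x ^ a := Real.rpow_pos_of_pos hx a
    rw [show 1 + (y / x - 1) = y / x by ring, Real.div_rpow hy hx.le, le_div_iff₀ hxa] at h
    simp only [powBregman]
    rw [Real.rpow_sub_one hx.ne']
    have h2 : (1 + a * (y / x - 1)) * x ^ a = x ^ a + a * (x ^ a / x) * (y - x) := by
      field_simp
    linarith

/-- The right side is the symmetrized divergence D(x, y) + D(y, x), and the second summand is
nonnegative. -/
theorem powBregman_le {a x y : ℝ} (ha : 1 < a) (hx : 0 ≤ x) (hy : 0 ≤ y) :
    powBregman a x y ≤ a * ((y - x) * (y ^ (a - 1) - x ^ (a - 1))) := by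
  have := powBregman_nonneg ha hy hx
  simp only [powBregman] at *
  nlinarith

theorem powBregman_self (a x : ℝ) : powBregman a x x = 0 := by simp [powBregman]

theorem powBregman_le_abs {a x y C : ℝ} (ha : 1 < a) (hx : x ∈ Set.Icc 0 C)
    (hy : y ∈ Set.Icc 0 C) : powBregman a x y ≤ a * C ^ (a - 1) * |y - x| := by
  refine (powBregman_le ha hx.1 hy.1).trans ?_
  rw [mul_assoc]
  refine mul_le_mul_of_nonneg_left ?_ (by linarith)
  have h1 := Real.rpow_nonneg hx.1 (a - 1)
  have h2 := Real.rpow_nonneg hy.1 (a - 1)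
  have h3 := Real.rpow_le_rpow hx.1 hx.2 (z := a - 1) (by linarith)
  have h4 := Real.rpow_le_rpow hy.1 hy.2 (z := a - 1) (by linarith)
  calc (y - x) * (y ^ (a - 1) - x ^ (a - 1)) ≤ |(y - x) * (y ^ (a - 1) - x ^ (a - 1))| :=
        le_abs_self _
    _ = |y ^ (a - 1) - x ^ (a - 1)| * |y - x| := by rw [abs_mul, mul_comm]
    _ ≤ C ^ (a - 1) * |y - x| := by
        refine mul_le_mul_of_nonneg_right ?_ (abs_nonneg _)
        rw [abs_le]; constructor <;> linarith

/-- The quadratic form is the Hessian of D_a at (u, v) divided by a (a - 1). Its determinant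
condition becomes, with t = v/u, the inequality 1 ≤ (a - 1) t^(a-2) + (2 - a) t^(a-1). This is
weighted AM-GM, because the exponents of the geometric mean cancel. The weight 2 - a is nonnegative
only for a ≤ 2. -/
theorem powBregman_hessian_nonneg {a u v : ℝ} (ha : 1 < a) (ha2 : a ≤ 2) (hu : 0 < u) (hv : 0 < v)
    (p r : ℝ) :
    0 ≤ ((a - 1) * u ^ (a - 2) + (2 - a) * (u ^ (a - 2) / u) * v) * p ^ 2
      - 2 * u ^ (a - 2) * (p * r) + v ^ (a - 2) * r ^ 2 := by
  have ht : 0 < v / u := div_pos hv hu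
  have h := Real.geom_mean_le_arith_mean2_weighted (w₁ := a - 1) (w₂ := 2 - a)
    (p₁ := (v / u) ^ (a - 2)) (p₂ := (v / u) ^ (a - 1)) (by linarith) (by linarith)
    (by positivity) (by positivity) (by ring)
  rw [← Real.rpow_mul ht.le, ← Real.rpow_mul ht.le, ← Real.rpow_add ht,
    show (a - 2) * (a - 1) + (a - 1) * (2 - a) = 0 by ring, Real.rpow_zero,
    show a - 1 = (a - 2) + 1 by ring, Real.rpow_add_one ht.ne', Real.div_rpow hv.le hu.le] at h
  have hU : 0 < u ^ (a - 2) := Real.rpow_pos_of_pos hu _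
  have hV : 0 < v ^ (a - 2) := Real.rpow_pos_of_pos hv _
  set U := u ^ (a - 2)
  set V := v ^ (a - 2)
  set A := (a - 1) * U + (2 - a) * (U / u) * v with hA
  have key : U ^ 2 ≤ A * V := by
    have e : A * V = U ^ 2 * ((a - 2 + 1) * (V / U) + (2 - a) * (V / U * (v / u))) := by
      rw [hA]; field_simp; ring
    rw [e]
    nlinarith [sq_nonneg U]
  have h3 : 0 ≤ V * (A * p ^ 2 - 2 * U * (p * r) + V * r ^ 2) := by
    nlinarith [sq_nonneg (V * r - U * p), sq_nonneg p]
  exact nonneg_of_mul_nonneg_right h3 hV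

theorem powBregman_tangent_of_pos {a x y x₀ y₀ : ℝ} (ha : 1 < a) (ha2 : a ≤ 2) (hx : 0 < x)
    (hy : 0 < y) (hx₀ : 0 < x₀) (hy₀ : 0 < y₀) :
    powBregman a x₀ y₀ + a * (a - 1) * x₀ ^ (a - 2) * (x₀ - y₀) * (x - x₀)
      + a * (y₀ ^ (a - 1) - x₀ ^ (a - 1)) * (y - y₀) ≤ powBregman a x y := by
  let u : ℝ → ℝ := fun θ => x₀ + θ * (x - x₀)
  let v : ℝ → ℝ := fun θ => y₀ + θ * (y - y₀)
  -- `g θ` is the value at (x, y) of the tangent plane taken at the moving base point (u θ, v θ).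
  -- Its derivative is (1 - θ) times the Hessian form, so no second-order Taylor formula in two
  -- variables is needed.
  let g : ℝ → ℝ := fun θ => ((v θ) ^ a - (u θ) ^ a - a * (u θ) ^ (a - 1) * (v θ - u θ))
    + a * (a - 1) * (u θ) ^ (a - 2) * (u θ - v θ) * (x - u θ)
    + a * ((v θ) ^ (a - 1) - (u θ) ^ (a - 1)) * (y - v θ)
  have hu : ∀ θ ∈ Set.Icc (0 : ℝ) 1, 0 < u θ := by
    intro θ hθ
    have : u θ = (1 - θ) * x₀ + θ * x := by simp only [u]; ring
    rw [this]
    rcases hθ.1.eq_or_lt with rfl | h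
    · simpa using hx₀
    · have := mul_pos h hx
      have := mul_nonneg (sub_nonneg.2 hθ.2) hx₀.le
      linarith
  have hv : ∀ θ ∈ Set.Icc (0 : ℝ) 1, 0 < v θ := by
    intro θ hθ
    have : v θ = (1 - θ) * y₀ + θ * y := by simp only [v]; ring
    rw [this]
    rcases hθ.1.eq_or_lt with rfl | h
    · simpa using hy₀
    · have := mul_pos h hy
      have := mul_nonneg (sub_nonneg.2 hθ.2) hy₀.le
      linarith
  have hder : ∀ θ ∈ Set.Icc (0 : ℝ) 1, HasDerivAt g ((1 - θ) * (a * (a - 1)) *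
      (((a - 1) * (u θ) ^ (a - 2) + (2 - a) * ((u θ) ^ (a - 2) / u θ) * v θ) * (x - x₀) ^ 2
      - 2 * (u θ) ^ (a - 2) * ((x - x₀) * (y - y₀)) + (v θ) ^ (a - 2) * (y - y₀) ^ 2)) θ := by
    intro θ hθ
    have hup := hu θ hθ
    have hvp := hv θ hθ
    have du : HasDerivAt u (x - x₀) θ := by
      exact (((hasDerivAt_id θ).mul_const (x - x₀)).const_add x₀).congr_deriv (one_mul _)
    have dv : HasDerivAt v (y - y₀) θ := by
      exact (((hasDerivAt_id θ).mul_const (y - y₀)).const_add y₀).congr_deriv (one_mul _)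
    have dua := du.rpow_const (p := a) (Or.inl hup.ne')
    have dva := dv.rpow_const (p := a) (Or.inl hvp.ne')
    have du1 := du.rpow_const (p := a - 1) (Or.inl hup.ne')
    have dv1 := dv.rpow_const (p := a - 1) (Or.inl hvp.ne')
    have du2 := du.rpow_const (p := a - 2) (Or.inl hup.ne')
    have := (((dva.sub dua).sub ((du1.const_mul a).mul (dv.sub du))).add
      (((du2.const_mul (a * (a - 1))).mul (du.sub dv)).mul (du.const_sub x))).add
      (((dv1.sub du1).const_mul a).mul (dv.const_sub y))
    refine this.congr_deriv ?_
    rw [show a - 1 - 1 = a - 2 by ring, Real.rpow_sub_one hup.ne' (a - 2)]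
    have e1 : (u θ) ^ (a - 1) = (u θ) ^ (a - 2) * u θ := by
      rw [← Real.rpow_add_one hup.ne']; congr 1; ring
    have e2 : (v θ) ^ (a - 1) = (v θ) ^ (a - 2) * v θ := by
      rw [← Real.rpow_add_one hvp.ne']; congr 1; ring
    have e3 : x - u θ = (1 - θ) * (x - x₀) := by simp only [u]; ring
    have e4 : y - v θ = (1 - θ) * (y - y₀) := by simp only [v]; ring
    simp only [Pi.sub_apply, Pi.mul_apply, e1, e2]
    rw [e3, e4]
    generalize (u θ) ^ (a - 2) = U
    generalize (v θ) ^ (a - 2) = V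
    field_simp
    ring
  have hmono : MonotoneOn g (Set.Icc 0 1) := by
    refine monotoneOn_of_hasDerivWithinAt_nonneg (convex_Icc 0 1)
      (fun θ hθ => (hder θ hθ).continuousAt.continuousWithinAt)
      (fun θ hθ => (hder θ (interior_subset hθ)).hasDerivWithinAt) ?_
    intro θ hθ
    have hθ' := interior_subset hθ
    refine mul_nonneg (mul_nonneg (sub_nonneg.2 hθ'.2) ?_)
      (powBregman_hessian_nonneg ha ha2 (hu θ hθ') (hv θ hθ') _ _)
    nlinarith
  have h01 := hmono (Set.left_mem_Icc.2 zero_le_one) (Set.right_mem_Icc.2 zero_le_one) zero_le_one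
  simpa [g, u, v, powBregman] using h01

/-- Boundary points are reached by shifting x, y and y₀ by ε ↓ 0. The point x₀ has to stay positive
because of the factor x₀^(a-2). -/
theorem powBregman_tangent {a x y x₀ y₀ : ℝ} (ha : 1 < a) (ha2 : a ≤ 2) (hx : 0 ≤ x)
    (hy : 0 ≤ y) (hx₀ : 0 < x₀) (hy₀ : 0 ≤ y₀) :
    powBregman a x₀ y₀ + a * (a - 1) * x₀ ^ (a - 2) * (x₀ - y₀) * (x - x₀)
      + a * (y₀ ^ (a - 1) - x₀ ^ (a - 1)) * (y - y₀) ≤ powBregman a x y := by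
  have ha0 : 0 ≤ a := by linarith
  have ha1 : 0 ≤ a - 1 := by linarith
  have c0 := Real.continuous_rpow_const ha0
  have c1 := Real.continuous_rpow_const ha1
  have hL : Continuous fun ε : ℝ => powBregman a x₀ (y₀ + ε)
      + a * (a - 1) * x₀ ^ (a - 2) * (x₀ - (y₀ + ε)) * (x + ε - x₀)
      + a * ((y₀ + ε) ^ (a - 1) - x₀ ^ (a - 1)) * (y + ε - (y₀ + ε)) := by
    simp only [powBregman]
    have := c0.comp (continuous_const.add continuous_id : Continuous fun ε : ℝ => y₀ + ε)
    have := c1.comp (continuous_const.add continuous_id : Continuous fun ε : ℝ => y₀ + ε)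
    simp only [Function.comp_def] at *
    fun_prop
  have hR : Continuous fun ε : ℝ => powBregman a (x + ε) (y + ε) := by
    simp only [powBregman]
    have := c0.comp (continuous_const.add continuous_id : Continuous fun ε : ℝ => x + ε)
    have := c0.comp (continuous_const.add continuous_id : Continuous fun ε : ℝ => y + ε)
    have := c1.comp (continuous_const.add continuous_id : Continuous fun ε : ℝ => x + ε)
    simp only [Function.comp_def] at *
    fun_prop
  have tL := (hL.tendsto 0).mono_left (nhdsWithin_le_nhds (s := Set.Ioi 0))
  have tR := (hR.tendsto 0).mono_left (nhdsWithin_le_nhds (s := Set.Ioi 0))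
  simp only [add_zero] at tL tR
  refine le_of_tendsto_of_tendsto tL tR ?_
  filter_upwards [self_mem_nhdsWithin] with ε hε
  have hε : 0 < ε := hε
  exact powBregman_tangent_of_pos ha ha2 (by linarith) (by linarith) hx₀ (by linarith)

end Analysis

/-! ### Power entropy and its subadditivity -/

section Entropy

/-- The `Φ`-entropy of `Z` for `Φ x = x ^ a`. -/
noncomputable def powEntropy {Ω : Type*} [MeasurableSpace Ω] (a : ℝ) (P : Measure Ω) (Z : Ω → ℝ) :
    ℝ := ∫ ω, Z ω ^ a ∂P - (∫ ω, Z ω ∂P) ^ a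

variable {Ω : Type*} [MeasurableSpace Ω] {P : Measure Ω} [IsProbabilityMeasure P]

theorem integrable_of_mem_Icc {Z : Ω → ℝ} {A B : ℝ} (hZ : Measurable Z)
    (hb : ∀ ω, Z ω ∈ Set.Icc A B) : Integrable Z P := by
  refine Integrable.of_bound hZ.aestronglyMeasurable (max |A| |B|) (Eventually.of_forall fun ω => ?_)
  rw [Real.norm_eq_abs]
  exact abs_le_max_abs_abs (hb ω).1 (hb ω).2

theorem integral_mem_Icc {Z : Ω → ℝ} {A B : ℝ} (hZ : Measurable Z)
    (hb : ∀ ω, Z ω ∈ Set.Icc A B) : ∫ ω, Z ω ∂P ∈ Set.Icc A B := by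
  have h := integrable_of_mem_Icc (P := P) hZ hb
  constructor
  · simpa using integral_mono (integrable_const A) h fun ω => (hb ω).1
  · simpa using integral_mono h (integrable_const B) fun ω => (hb ω).2

theorem rpow_mem_Icc {z C a : ℝ} (ha : 0 ≤ a) (hz : z ∈ Set.Icc 0 C) :
    z ^ a ∈ Set.Icc 0 (C ^ a) :=
  ⟨Real.rpow_nonneg hz.1 a, Real.rpow_le_rpow hz.1 hz.2 ha⟩

theorem integral_powBregman_left {a c : ℝ} {Z : Ω → ℝ} (hi : Integrable Z P)
    (hia : Integrable (fun ω => Z ω ^ a) P) :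
    ∫ ω, powBregman a c (Z ω) ∂P
      = ∫ ω, Z ω ^ a ∂P - c ^ a - a * c ^ (a - 1) * (∫ ω, Z ω ∂P - c) := by
  have h1 : Integrable (fun ω => Z ω ^ a - c ^ a) P := hia.sub (integrable_const _)
  have h2 : Integrable (fun ω => Z ω - c) P := hi.sub (integrable_const _)
  simp only [powBregman]
  rw [integral_sub h1 (h2.const_mul _), integral_sub hia (integrable_const _), integral_const_mul,
    integral_sub hi (integrable_const _)]
  simp

/-- The difference of the two sides is D_a(c, E Z). The freedom in c is what later allows comparison
with the value at the configuration before points are added. -/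
theorem powEntropy_le_integral_powBregman {a C c : ℝ} (ha : 1 < a) (hc : 0 ≤ c) {Z : Ω → ℝ}
    (hZ : Measurable Z) (hb : ∀ ω, Z ω ∈ Set.Icc 0 C) :
    powEntropy a P Z ≤ ∫ ω, powBregman a c (Z ω) ∂P := by
  have hi := integrable_of_mem_Icc (P := P) hZ hb
  have hia := integrable_of_mem_Icc (P := P) (hZ.pow_const a)
    fun ω => rpow_mem_Icc (by linarith) (hb ω)
  have h := powBregman_nonneg ha hc (integral_mem_Icc (P := P) hZ hb).1
  rw [integral_powBregman_left hi hia]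
  simp only [powBregman, powEntropy] at *
  linarith

theorem powEntropy_nonneg {a C : ℝ} (ha : 1 < a) {Z : Ω → ℝ}
    (hZ : Measurable Z) (hb : ∀ ω, Z ω ∈ Set.Icc 0 C) : 0 ≤ powEntropy a P Z := by
  have hi := integrable_of_mem_Icc (P := P) hZ hb
  have hia := integrable_of_mem_Icc (P := P) (hZ.pow_const a)
    fun ω => rpow_mem_Icc (by linarith) (hb ω)
  have h : 0 ≤ ∫ ω, powBregman a (∫ ω, Z ω ∂P) (Z ω) ∂P :=
    integral_nonneg fun ω =>
      powBregman_nonneg ha (integral_mem_Icc (P := P) hZ hb).1 (hb ω).1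
  rw [integral_powBregman_left hi hia] at h
  simpa [powEntropy] using h

theorem measurable_powBregman {α : Type*} [MeasurableSpace α] (a : ℝ) {Z W : α → ℝ}
    (hW : Measurable W) (hZ : Measurable Z) : Measurable fun ω => powBregman a (W ω) (Z ω) := by
  simp only [powBregman]
  fun_prop

theorem powBregman_mem_Icc {a C x y : ℝ} (ha : 1 < a) (hx : x ∈ Set.Icc 0 C)
    (hy : y ∈ Set.Icc 0 C) : powBregman a x y ∈ Set.Icc 0 (a * C ^ (a - 1) * C) := by
  refine ⟨powBregman_nonneg ha hx.1 hy.1, (powBregman_le_abs ha hx hy).trans ?_⟩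
  have hC : 0 ≤ C := hx.1.trans hx.2
  refine mul_le_mul_of_nonneg_left ?_ (mul_nonneg (by linarith) (Real.rpow_nonneg hC _))
  rw [abs_le]
  constructor <;> linarith [hx.1, hx.2, hy.1, hy.2]

/-- Jensen's inequality for the jointly convex D_a: integrate the tangent plane at the means, whose
linear terms vanish. -/
theorem powBregman_integral_le {a C : ℝ} (ha : 1 < a) (ha2 : a ≤ 2) {W Z : Ω → ℝ}
    (hW : Measurable W) (hWb : ∀ ω, W ω ∈ Set.Icc 0 C)
    (hZ : Measurable Z) (hZb : ∀ ω, Z ω ∈ Set.Icc 0 C) (h0 : 0 < ∫ ω, W ω ∂P) :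
    powBregman a (∫ ω, W ω ∂P) (∫ ω, Z ω ∂P) ≤ ∫ ω, powBregman a (W ω) (Z ω) ∂P := by
  have hi := integrable_of_mem_Icc (P := P) hZ hZb
  have hiW := integrable_of_mem_Icc (P := P) hW hWb
  have hR := integrable_of_mem_Icc (P := P) (measurable_powBregman a hW hZ)
    fun ω => powBregman_mem_Icc ha (hWb ω) (hZb ω)
  have h := integral_mono (μ := P)
    (((integrable_const _).add ((hiW.sub (integrable_const _)).const_mul _)).add
      ((hi.sub (integrable_const _)).const_mul _)) hR fun ω =>
      powBregman_tangent (y₀ := ∫ ω, Z ω ∂P) ha ha2 (hWb ω).1 (hZb ω).1 h0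
        (integral_mem_Icc (P := P) hZ hZb).1
  refine le_trans (le_of_eq ?_) h
  simp only [Pi.add_apply, Pi.sub_apply]
  rw [integral_add, integral_add (integrable_const _), integral_const_mul, integral_const_mul,
    integral_sub hiW (integrable_const _), integral_sub hi (integrable_const _)]
  · simp
  · exact (hiW.sub (integrable_const _)).const_mul _
  · exact (integrable_const _).add ((hiW.sub (integrable_const _)).const_mul _)
  · exact (hi.sub (integrable_const _)).const_mul _

end Entropy

/-- Conditioning on the first coordinate splits the entropy into the mean of the inner entropies and
the entropy of the partial mean W. The latter is at most the mean of the entropies in the first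
coordinate: apply Jensen to the pair (W, Z(·, ω₂)) and integrate over ω₂. -/
theorem powEntropy_prod_le {Ω₁ Ω₂ : Type*} [MeasurableSpace Ω₁] [MeasurableSpace Ω₂]
    (P₁ : Measure Ω₁) (P₂ : Measure Ω₂) [IsProbabilityMeasure P₁] [IsProbabilityMeasure P₂]
    {a C : ℝ} (ha : 1 < a) (ha2 : a ≤ 2) {Z : Ω₁ × Ω₂ → ℝ} (hZ : Measurable Z)
    (hb : ∀ ω, Z ω ∈ Set.Icc 0 C) :
    powEntropy a (P₁.prod P₂) Z ≤ ∫ ω₁, powEntropy a P₂ (fun ω₂ => Z (ω₁, ω₂)) ∂P₁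
      + ∫ ω₂, powEntropy a P₁ (fun ω₁ => Z (ω₁, ω₂)) ∂P₂ := by
  have ha0 : 0 ≤ a := by linarith
  have hZ1 : ∀ ω₁, Measurable fun ω₂ => Z (ω₁, ω₂) := fun ω₁ => hZ.comp measurable_prodMk_left
  have hZ2 : ∀ ω₂, Measurable fun ω₁ => Z (ω₁, ω₂) := fun ω₂ => hZ.comp measurable_prodMk_right
  have hZa : Measurable fun ω => Z ω ^ a := hZ.pow_const a
  have hZab : ∀ ω, Z ω ^ a ∈ Set.Icc 0 (C ^ a) := fun ω => rpow_mem_Icc ha0 (hb ω)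
  set W : Ω₁ → ℝ := fun ω₁ => ∫ ω₂, Z (ω₁, ω₂) ∂P₂ with hWdef
  have hW : Measurable W := hZ.stronglyMeasurable.integral_prod_right'.measurable
  have hWb : ∀ ω₁, W ω₁ ∈ Set.Icc 0 C := fun ω₁ => integral_mem_Icc (hZ1 ω₁) fun ω₂ => hb _
  set z : Ω₂ → ℝ := fun ω₂ => ∫ ω₁, Z (ω₁, ω₂) ∂P₁ with hzdef
  have hz : Measurable z := hZ.stronglyMeasurable.integral_prod_left'.measurable
  have hzb : ∀ ω₂, z ω₂ ∈ Set.Icc 0 C := fun ω₂ => integral_mem_Icc (hZ2 ω₂) fun ω₂ => hb _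
  set A : Ω₁ → ℝ := fun ω₁ => ∫ ω₂, Z (ω₁, ω₂) ^ a ∂P₂ with hAdef
  have hA : Measurable A := hZa.stronglyMeasurable.integral_prod_right'.measurable
  have hAb : ∀ ω₁, A ω₁ ∈ Set.Icc 0 (C ^ a) := fun ω₁ =>
    integral_mem_Icc ((hZ1 ω₁).pow_const a) fun ω₂ => hZab _
  set B : Ω₂ → ℝ := fun ω₂ => ∫ ω₁, Z (ω₁, ω₂) ^ a ∂P₁ with hBdef
  have hB : Measurable B := hZa.stronglyMeasurable.integral_prod_left'.measurable
  have hBb : ∀ ω₂, B ω₂ ∈ Set.Icc 0 (C ^ a) := fun ω₂ =>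
    integral_mem_Icc ((hZ2 ω₂).pow_const a) fun ω₂ => hZab _
  have iZ : Integrable Z (P₁.prod P₂) := integrable_of_mem_Icc hZ hb
  have iZa : Integrable (fun ω => Z ω ^ a) (P₁.prod P₂) := integrable_of_mem_Icc hZa hZab
  have iW : Integrable W P₁ := integrable_of_mem_Icc hW hWb
  have iWa : Integrable (fun ω => W ω ^ a) P₁ :=
    integrable_of_mem_Icc (hW.pow_const a) fun ω => rpow_mem_Icc ha0 (hWb ω)
  have iz : Integrable z P₂ := integrable_of_mem_Icc hz hzb
  have iza : Integrable (fun ω => z ω ^ a) P₂ :=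
    integrable_of_mem_Icc (hz.pow_const a) fun ω => rpow_mem_Icc ha0 (hzb ω)
  have iA : Integrable A P₁ := integrable_of_mem_Icc hA hAb
  have iB : Integrable B P₂ := integrable_of_mem_Icc hB hBb
  have eW : ∫ ω, Z ω ∂(P₁.prod P₂) = ∫ ω₁, W ω₁ ∂P₁ := integral_prod _ iZ
  have ez : ∫ ω, Z ω ∂(P₁.prod P₂) = ∫ ω₂, z ω₂ ∂P₂ := integral_prod_symm _ iZ
  have eA : ∫ ω, Z ω ^ a ∂(P₁.prod P₂) = ∫ ω₁, A ω₁ ∂P₁ := integral_prod _ iZa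
  have eB : ∫ ω, Z ω ^ a ∂(P₁.prod P₂) = ∫ ω₂, B ω₂ ∂P₂ := integral_prod_symm _ iZa
  have e1 : ∫ ω₁, powEntropy a P₂ (fun ω₂ => Z (ω₁, ω₂)) ∂P₁
      = ∫ ω₁, A ω₁ ∂P₁ - ∫ ω₁, W ω₁ ^ a ∂P₁ := integral_sub iA iWa
  have e2 : ∫ ω₂, powEntropy a P₁ (fun ω₁ => Z (ω₁, ω₂)) ∂P₂
      = ∫ ω₂, B ω₂ ∂P₂ - ∫ ω₂, z ω₂ ^ a ∂P₂ := integral_sub iB iza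
  rw [e1, e2, powEntropy, eW, eA]
  suffices h : ∫ ω₁, W ω₁ ^ a ∂P₁ - (∫ ω₁, W ω₁ ∂P₁) ^ a ≤
      ∫ ω₂, B ω₂ ∂P₂ - ∫ ω₂, z ω₂ ^ a ∂P₂ by linarith
  rcases (integral_mem_Icc (P := P₁) hW hWb).1.eq_or_lt with h0 | h0
  -- The tangent plane is unavailable at mean 0, but then W vanishes almost surely and so does its
  -- entropy.
  · rw [← h0, Real.zero_rpow (by linarith), ← e2]
    have hW0 : W =ᵐ[P₁] 0 := (integral_eq_zero_iff_of_nonneg (fun ω => (hWb ω).1) iW).1 h0.symm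
    have : ∫ ω₁, W ω₁ ^ a ∂P₁ = 0 := by
      rw [integral_congr_ae (g := fun _ => (0 : ℝ)), integral_zero]
      filter_upwards [hW0] with ω hω
      rw [hω, Pi.zero_apply, Real.zero_rpow (by linarith)]
    rw [this, sub_zero]
    exact integral_nonneg fun ω₂ => powEntropy_nonneg ha (hZ2 ω₂) fun ω₁ => hb _
  · set w := ∫ ω₁, W ω₁ ∂P₁ with hw
    have key : ∀ ω₂, powBregman a w (z ω₂) ≤ ∫ ω₁, powBregman a (W ω₁) (Z (ω₁, ω₂)) ∂P₁ :=
      fun ω₂ => powBregman_integral_le ha ha2 hW hWb (hZ2 ω₂) (fun ω₁ => hb _) h0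
    have hWm : Measurable fun ω : Ω₁ × Ω₂ => W ω.1 := hW.comp measurable_fst
    have iΨ : Integrable (fun ω : Ω₁ × Ω₂ => powBregman a (W ω.1) (Z ω)) (P₁.prod P₂) :=
      integrable_of_mem_Icc (measurable_powBregman a hWm hZ)
        fun ω => powBregman_mem_Icc ha (hWb _) (hb _)
    have hwm := integral_mem_Icc (P := P₁) hW hWb
    have hint := integral_mono (μ := P₂)
      (integrable_of_mem_Icc (measurable_powBregman a measurable_const hz)
        fun ω => powBregman_mem_Icc ha hwm (hzb ω)) iΨ.integral_prod_right key
    rw [← integral_prod_symm _ iΨ] at hint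
    have iW1 : Integrable (fun ω : Ω₁ × Ω₂ => W ω.1) (P₁.prod P₂) :=
      integrable_of_mem_Icc hWm fun ω => hWb _
    have iWa' : Integrable (fun ω : Ω₁ × Ω₂ => W ω.1 ^ a) (P₁.prod P₂) :=
      integrable_of_mem_Icc (hWm.pow_const a) fun ω => rpow_mem_Icc ha0 (hWb _)
    -- Integrability is read off from the definition of D_a, all of whose other terms are already
    -- integrable.
    have icross : Integrable (fun ω : Ω₁ × Ω₂ => a * W ω.1 ^ (a - 1) * (Z ω - W ω.1))
        (P₁.prod P₂) := by
      have := (iZa.sub iWa').sub iΨ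
      refine this.congr (Eventually.of_forall fun ω => ?_)
      simp only [Pi.sub_apply, powBregman]
      ring
    -- W is the mean of Z over the second coordinate, so the inner integral of Z - W is zero.
    have hcross : ∫ ω, a * W ω.1 ^ (a - 1) * (Z ω - W ω.1) ∂(P₁.prod P₂) = 0 := by
      rw [integral_prod _ icross]
      have : ∀ ω₁, ∫ ω₂, a * W ω₁ ^ (a - 1) * (Z (ω₁, ω₂) - W ω₁) ∂P₂ = 0 := by
        intro ω₁
        rw [integral_const_mul, integral_sub (integrable_of_mem_Icc (hZ1 ω₁) fun _ => hb _)
          (integrable_const _)]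
        simp [hWdef]
      simp [this]
    have hr : ∫ ω, powBregman a (W ω.1) (Z ω) ∂(P₁.prod P₂)
        = ∫ ω₂, B ω₂ ∂P₂ - ∫ ω₁, W ω₁ ^ a ∂P₁ := by
      simp only [powBregman]
      have hs : Integrable (fun ω : Ω₁ × Ω₂ => Z ω ^ a - W ω.1 ^ a) (P₁.prod P₂) := iZa.sub iWa'
      rw [integral_sub hs icross, hcross, integral_sub iZa iWa', eB,
        integral_prod _ iWa']
      simp
    have hl : ∫ ω₂, powBregman a w (z ω₂) ∂P₂ = ∫ ω₂, z ω₂ ^ a ∂P₂ - w ^ a := by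
      rw [integral_powBregman_left iz iza, ← ez, eW]
      simp [hw]
    rw [hr, hl] at hint
    linarith

/-! ### Counting measures as a measurable additive monoid -/

namespace CountingMeasure

section Monoid

variable {X : Type*} [MeasurableSpace X]

theorem isCountingMeasure_zero : IsCountingMeasure (0 : Measure X) :=
  ⟨inferInstance, Empty, inferInstance, Empty.elim, by simp⟩

theorem isCountingMeasure_add {ξ ζ : Measure X} (h : IsCountingMeasure ξ)
    (h' : IsCountingMeasure ζ) : IsCountingMeasure (ξ + ζ) := by
  obtain ⟨hσ, ι, hι, y, rfl⟩ := h
  obtain ⟨hσ', ι', hι', y', rfl⟩ := h'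
  refine ⟨inferInstance, ι ⊕ ι', inferInstance, Sum.elim y y', ?_⟩
  ext B hB
  rw [Measure.add_apply, Measure.sum_apply _ hB, Measure.sum_apply _ hB, Measure.sum_apply _ hB,
    Summable.tsum_sum ENNReal.summable ENNReal.summable]
  simp

instance : Zero (CountingMeasure X) := ⟨⟨0, isCountingMeasure_zero⟩⟩

instance : Add (CountingMeasure X) := ⟨fun ξ ζ => ⟨ξ.1 + ζ.1, isCountingMeasure_add ξ.2 ζ.2⟩⟩

@[simp] theorem val_zero : (0 : CountingMeasure X).1 = 0 := rfl

@[simp] theorem val_add (ξ ζ : CountingMeasure X) : (ξ + ζ).1 = ξ.1 + ζ.1 := rfl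

instance : AddCommMonoid (CountingMeasure X) where
  add_assoc _ _ _ := Subtype.ext (add_assoc _ _ _)
  zero_add _ := Subtype.ext (zero_add _)
  add_zero _ := Subtype.ext (add_zero _)
  add_comm _ _ := Subtype.ext (add_comm _ _)
  nsmul := nsmulRec

/-- The counting measure `δ_x`. -/
noncomputable def single (x : X) : CountingMeasure X := addPoint 0 x

@[simp] theorem val_single (x : X) : (single x).1 = Measure.dirac x := zero_add _

theorem addPoint_eq (ξ : CountingMeasure X) (x : X) : ξ.addPoint x = ξ + single x :=
  Subtype.ext (by simp [addPoint])

theorem measurable_val : Measurable (Subtype.val : CountingMeasure X → Measure X) :=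
  measurable_subtype_coe

theorem measurable_apply {B : Set X} (hB : MeasurableSet B) :
    Measurable fun ξ : CountingMeasure X => ξ.1 B :=
  (Measure.measurable_coe hB).comp measurable_val

theorem measurable_of_apply {α : Type*} [MeasurableSpace α] {g : α → CountingMeasure X}
    (h : ∀ B, MeasurableSet B → Measurable fun a => (g a).1 B) : Measurable g :=
  (Measure.measurable_of_measurable_coe _ h).subtype_mk

instance : MeasurableAdd₂ (CountingMeasure X) where
  measurable_add := measurable_of_apply fun B hB => by
    simp only [val_add, Measure.add_apply]
    exact ((measurable_apply hB).comp measurable_fst).add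
      ((measurable_apply hB).comp measurable_snd)

@[fun_prop]
theorem measurable_single : Measurable (single : X → CountingMeasure X) :=
  measurable_of_apply fun B hB => by
    simp only [val_single]
    exact (Measure.measurable_coe hB).comp Measure.measurable_dirac

theorem isCountingMeasure_restrict {ξ : Measure X} (h : IsCountingMeasure ξ) {B : Set X}
    (hB : MeasurableSet B) : IsCountingMeasure (ξ.restrict B) := by
  classical
  obtain ⟨hσ, ι, hι, y, rfl⟩ := h
  refine ⟨inferInstance, {i // y i ∈ B}, inferInstance, fun i => y i, ?_⟩
  ext A hA
  rw [Measure.restrict_apply hA, Measure.sum_apply _ (hA.inter hB), Measure.sum_apply _ hA,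
    ← tsum_subtype_eq_of_support_subset (s := {i | y i ∈ B})]
  · refine tsum_congr fun i => ?_
    rw [Measure.dirac_apply' _ (hA.inter hB), Measure.dirac_apply' _ hA]
    have : y i ∈ B := i.2
    simp [Set.indicator, this]
  · intro i hi
    by_contra h
    have h' : y i ∉ B := h
    exact hi (by simp [Measure.dirac_apply' _ (hA.inter hB), h'])

open Classical in
/-- The restriction of a counting measure to a measurable set `B`. -/
noncomputable def restrict (ξ : CountingMeasure X) (B : Set X) : CountingMeasure X :=
  if hB : MeasurableSet B then ⟨ξ.1.restrict B, isCountingMeasure_restrict ξ.2 hB⟩ else ξ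

theorem val_restrict (ξ : CountingMeasure X) {B : Set X} (hB : MeasurableSet B) :
    (ξ.restrict B).1 = ξ.1.restrict B := by
  rw [restrict, dif_pos hB]

theorem restrict_apply (ξ : CountingMeasure X) {B A : Set X} (hB : MeasurableSet B)
    (hA : MeasurableSet A) : (ξ.restrict B).1 A = ξ.1 (A ∩ B) := by
  rw [val_restrict ξ hB, Measure.restrict_apply hA]

theorem measurable_restrict {B : Set X} (hB : MeasurableSet B) :
    Measurable fun ξ : CountingMeasure X => ξ.restrict B :=
  measurable_of_apply fun A hA => by
    simp only [restrict_apply _ hB hA]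
    exact measurable_apply (hA.inter hB)

end Monoid

/-! ### Poisson processes of finite intensity as convolution exponentials -/

section Exponential

variable {X : Type*} [MeasurableSpace X] (μ : Measure X)

/-- The image of `μ ^ n` under `(x₁, …, xₙ) ↦ δ_{x₁} + ⋯ + δ_{xₙ}`. -/
noncomputable def pointPower (μ : Measure X) : ℕ → Measure (CountingMeasure X)
  | 0 => Measure.dirac 0
  | n + 1 => (pointPower μ n) ∗ (μ.map single)

theorem lintegral_pointPower_zero {g : CountingMeasure X → ℝ≥0∞} (hg : Measurable g) :
    ∫⁻ ξ, g ξ ∂(pointPower μ 0) = g 0 := lintegral_dirac' _ hg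

/-- The weight of `pointPower μ n` in the law of the Poisson process with intensity `t • μ`. -/
noncomputable def poissonWeight (t : ℝ) (n : ℕ) : ℝ :=
  Real.exp (-(t * μ.real Set.univ)) * (t ^ n / n.factorial)

/-- The law of the Poisson process with intensity `t • μ`. -/
noncomputable def poissonExp (t : ℝ) : Measure (CountingMeasure X) :=
  Measure.sum fun n => ENNReal.ofReal (poissonWeight μ t n) • pointPower μ n

theorem poissonWeight_nonneg {t : ℝ} (ht : 0 ≤ t) (n : ℕ) : 0 ≤ poissonWeight μ t n :=
  mul_nonneg (Real.exp_pos _).le (by positivity)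

theorem lintegral_poissonExp (t : ℝ) (g : CountingMeasure X → ℝ≥0∞) :
    ∫⁻ ξ, g ξ ∂(poissonExp μ t) =
      ∑' n, ENNReal.ofReal (poissonWeight μ t n) * ∫⁻ ξ, g ξ ∂(pointPower μ n) := by
  rw [poissonExp, lintegral_sum_measure]
  exact tsum_congr fun n => lintegral_smul_measure _ _

theorem poissonExp_zero : poissonExp μ 0 = Measure.dirac 0 := by
  ext A hA
  rw [← lintegral_indicator_one hA, ← lintegral_indicator_one hA, lintegral_poissonExp,
    tsum_eq_single 0]
  · simp [poissonWeight, pointPower]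
  · intro n hn
    simp [poissonWeight, hn]

/-- The comparison is termwise, from t^n ≤ 1. It replaces the law at a time close to 1 by the law at
time 1 at the cost of a factor tending to 1. -/
theorem poissonExp_le {t : ℝ} (ht : 0 ≤ t) (ht1 : t ≤ 1) :
    poissonExp μ t ≤ ENNReal.ofReal (Real.exp ((1 - t) * μ.real Set.univ)) • poissonExp μ 1 := by
  refine Measure.le_iff.2 fun A hA => ?_
  rw [Measure.smul_apply, smul_eq_mul, ← lintegral_indicator_one hA, ← lintegral_indicator_one hA,
    lintegral_poissonExp, lintegral_poissonExp, ← ENNReal.tsum_mul_left]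
  refine ENNReal.tsum_le_tsum fun n => ?_
  rw [← mul_assoc, ← ENNReal.ofReal_mul (Real.exp_pos _).le]
  refine mul_le_mul_left (ENNReal.ofReal_le_ofReal ?_) _
  simp only [poissonWeight]
  rw [← mul_assoc, ← Real.exp_add,
    show (1 - t) * μ.real Set.univ + -(1 * μ.real Set.univ) = -(t * μ.real Set.univ) by ring]
  gcongr

theorem sum_poissonWeight {s t : ℝ} (hs : 0 ≤ s) (ht : 0 ≤ t) (n : ℕ) :
    ∑ q ∈ Finset.HasAntidiagonal.antidiagonal n, ENNReal.ofReal (poissonWeight μ s q.1) *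
      ENNReal.ofReal (poissonWeight μ t q.2) = ENNReal.ofReal (poissonWeight μ (s + t) n) := by
  simp only [← ENNReal.ofReal_mul (poissonWeight_nonneg μ hs _)]
  rw [← ENNReal.ofReal_sum_of_nonneg fun q _ =>
    mul_nonneg (poissonWeight_nonneg μ hs _) (poissonWeight_nonneg μ ht _)]
  congr 1
  simp only [poissonWeight]
  rw [add_mul, neg_add, Real.exp_add, (Commute.all s t).add_pow', Finset.sum_div, Finset.mul_sum]
  refine Finset.sum_congr rfl fun q hq => ?_
  rw [← Finset.HasAntidiagonal.mem_antidiagonal.1 hq, nsmul_eq_mul, Nat.choose_symm_add,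
    Nat.add_choose,
    Nat.cast_div (Nat.factorial_mul_factorial_dvd_factorial_add _ _) (by positivity)]
  push_cast
  have := Nat.factorial_pos (q.1 + q.2)
  field_simp

variable [IsFiniteMeasure μ]

instance isFiniteMeasure_pointPower (n : ℕ) : IsFiniteMeasure (pointPower μ n) := by
  induction n with
  | zero => exact inferInstanceAs (IsFiniteMeasure (Measure.dirac 0))
  | succ n ih => exact inferInstanceAs (IsFiniteMeasure ((pointPower μ n) ∗ (μ.map single)))

theorem lintegral_pointPower_succ (n : ℕ) {g : CountingMeasure X → ℝ≥0∞} (hg : Measurable g) :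
    ∫⁻ ξ, g ξ ∂(pointPower μ (n + 1)) = ∫⁻ ξ, ∫⁻ x, g (ξ + single x) ∂μ ∂(pointPower μ n) := by
  rw [pointPower, Measure.lintegral_conv hg]
  refine lintegral_congr fun ξ => ?_
  exact lintegral_map (hg.comp (measurable_const_add ξ)) measurable_single

theorem pointPower_univ (n : ℕ) : pointPower μ n Set.univ = μ Set.univ ^ n := by
  rw [← lintegral_one]
  induction n with
  | zero => rw [lintegral_one, pointPower]; simp
  | succ n ih =>
    rw [lintegral_pointPower_succ _ _ measurable_const]
    simp only [lintegral_const, one_mul] at ih ⊢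
    rw [ih, pow_succ, mul_comm]

theorem pointPower_conv (i j : ℕ) :
    (pointPower μ i) ∗ (pointPower μ j) = pointPower μ (i + j) := by
  induction j with
  | zero => rw [pointPower, Measure.conv_dirac_zero, add_zero]
  | succ j ih => rw [pointPower, ← Measure.conv_assoc, ih, ← add_assoc, pointPower]

theorem poissonWeight_mul_pow {t : ℝ} (ht : 0 ≤ t) (n : ℕ) :
    ENNReal.ofReal (poissonWeight μ t n) * μ Set.univ ^ n =
      ENNReal.ofReal (Real.exp (-(t * μ.real Set.univ)) *
        ((t * μ.real Set.univ) ^ n / n.factorial)) := by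
  rw [← ofReal_measureReal (μ := μ) (s := Set.univ), ← ENNReal.ofReal_pow measureReal_nonneg,
    ← ENNReal.ofReal_mul (poissonWeight_nonneg μ ht n), poissonWeight]
  congr 1
  ring

theorem tsum_exp_neg_mul_pow {u : ℝ} (hu : 0 ≤ u) :
    ∑' n : ℕ, ENNReal.ofReal (Real.exp (-u) * (u ^ n / n.factorial)) = 1 := by
  have h : HasSum (fun n : ℕ => Real.exp (-u) * (u ^ n / n.factorial)) 1 := by
    have := (NormedSpace.expSeries_div_hasSum_exp (𝔸 := ℝ) u).mul_left (Real.exp (-u))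
    rwa [← Real.exp_eq_exp_ℝ, ← Real.exp_add, neg_add_cancel, Real.exp_zero] at this
  rw [← ENNReal.ofReal_tsum_of_nonneg (fun n => by positivity) h.summable, h.tsum_eq,
    ENNReal.ofReal_one]

theorem isProbabilityMeasure_poissonExp {t : ℝ} (ht : 0 ≤ t) :
    IsProbabilityMeasure (poissonExp μ t) := by
  constructor
  rw [← lintegral_one, lintegral_poissonExp]
  simp only [lintegral_one, pointPower_univ, poissonWeight_mul_pow μ ht]
  exact tsum_exp_neg_mul_pow (mul_nonneg ht measureReal_nonneg)

/-- Superposition of independent processes: sort the double series by the total number of points and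
sum the weights with the binomial formula. -/
theorem poissonExp_conv {s t : ℝ} (hs : 0 ≤ s) (ht : 0 ≤ t) :
    (poissonExp μ s) ∗ (poissonExp μ t) = poissonExp μ (s + t) := by
  have := isProbabilityMeasure_poissonExp μ hs
  have := isProbabilityMeasure_poissonExp μ ht
  ext A hA
  have hm : Measurable (A.indicator (1 : CountingMeasure X → ℝ≥0∞)) :=
    measurable_one.indicator hA
  rw [← lintegral_indicator_one hA, ← lintegral_indicator_one hA, Measure.lintegral_conv hm,
    lintegral_poissonExp, lintegral_poissonExp]
  have h1 : ∀ i, ∫⁻ ξ, ∫⁻ ζ, A.indicator 1 (ξ + ζ) ∂(poissonExp μ t) ∂(pointPower μ i) =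
      ∑' j, ENNReal.ofReal (poissonWeight μ t j) *
        ∫⁻ ξ, A.indicator 1 ξ ∂(pointPower μ (i + j)) := by
    intro i
    simp only [lintegral_poissonExp]
    have hmj : ∀ j, Measurable fun ξ : CountingMeasure X =>
        ∫⁻ ζ, A.indicator (1 : CountingMeasure X → ℝ≥0∞) (ξ + ζ) ∂(pointPower μ j) := fun j =>
      (hm.comp measurable_add).lintegral_prod_right'
    rw [lintegral_tsum fun j => ((hmj j).const_mul _).aemeasurable]
    refine tsum_congr fun j => ?_
    rw [lintegral_const_mul _ (hmj j), ← pointPower_conv, Measure.lintegral_conv hm]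
  simp only [h1, ← ENNReal.tsum_mul_left]
  rw [← ENNReal.tsum_prod (f := fun i j => ENNReal.ofReal (poissonWeight μ s i) *
    (ENNReal.ofReal (poissonWeight μ t j) * ∫⁻ ξ, A.indicator 1 ξ ∂(pointPower μ (i + j)))),
    ← (Finset.HasAntidiagonal.sigmaAntidiagonalEquivProd (A := ℕ)).tsum_eq, ENNReal.tsum_sigma']
  refine tsum_congr fun n => ?_
  rw [tsum_fintype, ← sum_poissonWeight μ hs ht, Finset.sum_mul, ← Finset.sum_coe_sort (Finset.HasAntidiagonal.antidiagonal n)]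
  refine Finset.sum_congr rfl fun q _ => ?_
  have h : q.1.1 + q.1.2 = n := Finset.HasAntidiagonal.mem_antidiagonal.1 q.2
  simp only [Finset.HasAntidiagonal.sigmaAntidiagonalEquivProd_apply]
  rw [h, mul_assoc]

/-- Short-time expansion: the empty configuration contributes nothing, one point gives the main
term, and two or more points have probability at most (t μ(X))². -/
theorem lintegral_poissonExp_le {t : ℝ} (ht : 0 ≤ t) {g : CountingMeasure X → ℝ≥0∞}
    (hg : Measurable g) (hg0 : g 0 = 0) {K : ℝ≥0∞} (hK : ∀ ξ, g ξ ≤ K) :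
    ∫⁻ ξ, g ξ ∂(poissonExp μ t) ≤ ENNReal.ofReal t * ∫⁻ x, g (single x) ∂μ +
      K * ENNReal.ofReal ((t * μ.real Set.univ) ^ 2) := by
  set u := t * μ.real Set.univ with hu
  have hu0 : 0 ≤ u := mul_nonneg ht measureReal_nonneg
  have htail : ∑' n : ℕ, ENNReal.ofReal (Real.exp (-u) * (u ^ (n + 2) / (n + 2).factorial)) ≤
      ENNReal.ofReal (u ^ 2) := by
    have h1 := tsum_exp_neg_mul_pow hu0
    rw [← ENNReal.summable.sum_add_tsum_nat_add' (k := 2)] at h1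
    set T := ∑' n : ℕ, ENNReal.ofReal (Real.exp (-u) * (u ^ (n + 2) / (n + 2).factorial))
    simp only [Finset.sum_range_succ, Finset.range_zero, Finset.sum_empty, zero_add, pow_zero,
      Nat.factorial, pow_one, Nat.cast_one, div_one, mul_one] at h1
    rw [← ENNReal.ofReal_add (Real.exp_pos _).le (mul_nonneg (Real.exp_pos _).le hu0)] at h1
    have hT : T = 1 - ENNReal.ofReal (Real.exp (-u) + Real.exp (-u) * u) := by
      rw [← h1, ENNReal.add_sub_cancel_left ENNReal.ofReal_ne_top]
    rw [hT, ← ENNReal.ofReal_one, ← ENNReal.ofReal_sub _ (by positivity)]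
    refine ENNReal.ofReal_le_ofReal ?_
    -- The tail is 1 - e^(-u) (1 + u) ≤ 1 - (1 - u) (1 + u) = u².
    have := Real.one_sub_le_exp_neg u
    nlinarith
  rw [lintegral_poissonExp, ← ENNReal.summable.sum_add_tsum_nat_add' (k := 2)]
  refine add_le_add ?_ ?_
  · simp only [Finset.sum_range_succ, Finset.range_zero, Finset.sum_empty, zero_add,
      lintegral_pointPower_zero μ hg, hg0, mul_zero]
    rw [lintegral_pointPower_succ μ 0 hg, lintegral_pointPower_zero]
    · simp only [zero_add]
      refine mul_le_mul_left (ENNReal.ofReal_le_ofReal ?_) _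
      simp only [poissonWeight, pow_one, Nat.factorial, Nat.cast_one, mul_one, div_one]
      exact mul_le_of_le_one_left ht (Real.exp_le_one_iff.2 (neg_nonpos.2 hu0))
    · exact Measurable.lintegral_prod_right' (f := fun p : CountingMeasure X × X =>
        g (p.1 + single p.2)) (by fun_prop)
  · refine le_trans ?_ (mul_le_mul_right htail K)
    rw [← ENNReal.tsum_mul_left]
    refine ENNReal.tsum_le_tsum fun n => ?_
    rw [← poissonWeight_mul_pow μ ht, mul_left_comm, ← pointPower_univ]
    refine mul_le_mul_right ?_ _
    rw [← lintegral_const]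
    exact lintegral_mono hK

end Exponential

end CountingMeasure

/-! ### The modified Φ-Sobolev inequality for finite intensity -/

section EntropyMap

variable {Ω Ω' : Type*} [MeasurableSpace Ω] [MeasurableSpace Ω']

theorem powEntropy_map (a : ℝ) {P : Measure Ω} {φ : Ω → Ω'} (hφ : Measurable φ) {Z : Ω' → ℝ}
    (hZ : Measurable Z) : powEntropy a (P.map φ) Z = powEntropy a P fun ω => Z (φ ω) := by
  rw [powEntropy, powEntropy, integral_map hφ.aemeasurable hZ.aestronglyMeasurable,
    integral_map hφ.aemeasurable (hZ.pow_const a).aestronglyMeasurable]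

theorem measurable_powEntropy_prodMk {a : ℝ} {P : Measure Ω} [SFinite P] {Z : Ω' × Ω → ℝ}
    (hZ : Measurable Z) : Measurable fun ω' => powEntropy a P fun ω => Z (ω', ω) := by
  simp only [powEntropy]
  exact (hZ.pow_const a).stronglyMeasurable.integral_prod_right'.measurable.sub
    (hZ.stronglyMeasurable.integral_prod_right'.measurable.pow_const a)

theorem powEntropy_mem_Icc {a C : ℝ} (ha : 1 < a) {P : Measure Ω} [IsProbabilityMeasure P]
    {Z : Ω → ℝ} (hZ : Measurable Z) (hb : ∀ ω, Z ω ∈ Set.Icc 0 C) :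
    powEntropy a P Z ∈ Set.Icc 0 (C ^ a) := by
  refine ⟨powEntropy_nonneg ha hZ hb, (sub_le_self _ (Real.rpow_nonneg
    (integral_mem_Icc hZ hb).1 _)).trans ?_⟩
  exact (integral_mem_Icc (hZ.pow_const a) fun ω => rpow_mem_Icc (by linarith) (hb ω)).2

theorem ofReal_integral_powBregman {a C : ℝ} (ha : 1 < a) {P : Measure Ω}
    [IsProbabilityMeasure P] {W Z : Ω → ℝ} (hW : Measurable W) (hWb : ∀ ω, W ω ∈ Set.Icc 0 C)
    (hZ : Measurable Z) (hZb : ∀ ω, Z ω ∈ Set.Icc 0 C) :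
    ENNReal.ofReal (∫ ω, powBregman a (W ω) (Z ω) ∂P) =
      ∫⁻ ω, ENNReal.ofReal (powBregman a (W ω) (Z ω)) ∂P :=
  ofReal_integral_eq_lintegral_ofReal
    (integrable_of_mem_Icc (measurable_powBregman a hW hZ)
      fun ω => powBregman_mem_Icc ha (hWb ω) (hZb ω))
    (Eventually.of_forall fun ω => powBregman_nonneg ha (hWb ω).1 (hZb ω).1)

end EntropyMap

namespace CountingMeasure

variable {X : Type*} [MeasurableSpace X] (μ : Measure X) [IsFiniteMeasure μ]

/-- Subadditivity over k + 1 independent pieces of intensity s • μ. By symmetry every piece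
contributes the same: the mean entropy in one piece, given the sum ξ of the k others. -/
theorem powEntropy_poissonExp_le_sum {a C : ℝ} (ha : 1 < a) (ha2 : a ≤ 2) {s : ℝ} (hs : 0 ≤ s)
    (k : ℕ) {G : CountingMeasure X → ℝ} (hG : Measurable G) (hb : ∀ ξ, G ξ ∈ Set.Icc 0 C) :
    powEntropy a (poissonExp μ ((k + 1) * s)) G ≤
      (k + 1) * ∫ ξ, powEntropy a (poissonExp μ s) (fun ζ => G (ξ + ζ)) ∂(poissonExp μ (k * s)) := by
  have := isProbabilityMeasure_poissonExp μ hs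
  induction k generalizing G with
  | zero =>
    have hm : Measurable fun ξ => powEntropy a (poissonExp μ s) (fun ζ => G (ξ + ζ)) :=
      measurable_powEntropy_prodMk (hG.comp measurable_add)
    simp only [Nat.cast_zero, zero_add, one_mul, zero_mul, poissonExp_zero]
    rw [integral_dirac' _ _ hm.stronglyMeasurable]
    simp
  | succ k ih =>
    have hks : (0 : ℝ) ≤ k * s := by positivity
    have hks1 : (0 : ℝ) ≤ (k + 1) * s := by positivity
    have := isProbabilityMeasure_poissonExp μ hks
    have := isProbabilityMeasure_poissonExp μ hks1
    have hGa : Measurable fun p : CountingMeasure X × CountingMeasure X => G (p.1 + p.2) :=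
      hG.comp measurable_add
    set H : CountingMeasure X → ℝ := fun ξ => powEntropy a (poissonExp μ s) fun ζ => G (ξ + ζ)
      with hH
    have hHm : Measurable H := measurable_powEntropy_prodMk hGa
    have hHb : ∀ ξ, H ξ ∈ Set.Icc 0 (C ^ a) := fun ξ =>
      powEntropy_mem_Icc ha (hG.comp (measurable_const_add ξ)) fun ζ => hb _
    have e : poissonExp μ ((((k + 1 : ℕ) : ℝ) + 1) * s) =
        ((poissonExp μ ((k + 1) * s)).prod (poissonExp μ s)).map fun p => p.1 + p.2 := by
      change _ = (poissonExp μ ((k + 1) * s)) ∗ (poissonExp μ s)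
      rw [poissonExp_conv μ hks1 hs]
      congr 1
      push_cast
      ring
    have e' : poissonExp μ ((k + 1) * s) =
        ((poissonExp μ (k * s)).prod (poissonExp μ s)).map fun p => p.1 + p.2 := by
      change _ = (poissonExp μ (k * s)) ∗ (poissonExp μ s)
      rw [poissonExp_conv μ hks hs]
      congr 1
      ring
    -- The induction hypothesis is applied to the translate of G by the piece that has been split
    -- off, hence the generalization over G.
    have step : ∀ ζ, powEntropy a (poissonExp μ ((k + 1) * s)) (fun ξ => G (ξ + ζ)) ≤
        (k + 1) * ∫ ξ, H (ξ + ζ) ∂(poissonExp μ (k * s)) := by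
      intro ζ
      refine (ih (hG.comp (measurable_add_const ζ)) fun ξ => hb _).trans (le_of_eq ?_)
      simp only [hH, Function.comp_def, add_right_comm]
    have hHa : Measurable fun p : CountingMeasure X × CountingMeasure X => H (p.1 + p.2) :=
      hHm.comp measurable_add
    have second : ∫ ζ, powEntropy a (poissonExp μ ((k + 1) * s)) (fun ξ => G (ξ + ζ))
        ∂(poissonExp μ s) ≤ (k + 1) * ∫ ξ, H ξ ∂(poissonExp μ ((k + 1) * s)) := by
      have hint : Integrable (fun p : CountingMeasure X × CountingMeasure X => H (p.1 + p.2))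
          ((poissonExp μ (k * s)).prod (poissonExp μ s)) :=
        integrable_of_mem_Icc hHa fun p => hHb _
      conv_rhs => rw [e', integral_map (by fun_prop) hHm.aestronglyMeasurable,
        integral_prod_symm _ hint, ← integral_const_mul]
      refine integral_mono ?_ (hint.integral_prod_right.const_mul _) step
      refine integrable_of_mem_Icc (A := 0) (B := C ^ a) ?_ fun ζ =>
        powEntropy_mem_Icc ha (hG.comp (measurable_add_const ζ)) fun ξ => hb _
      exact measurable_powEntropy_prodMk (hGa.comp measurable_swap)
    have hprod := powEntropy_prod_le (poissonExp μ ((k + 1) * s)) (poissonExp μ s) ha ha2 hGa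
      fun p => hb _
    rw [e, powEntropy_map a measurable_add hG]
    refine hprod.trans ((add_le_add_right second _).trans (le_of_eq ?_))
    push_cast
    ring

theorem measurable_powBregman_single {a : ℝ} {G : CountingMeasure X → ℝ} (hG : Measurable G) :
    Measurable fun p : CountingMeasure X × X =>
      ENNReal.ofReal (powBregman a (G p.1) (G (p.1 + single p.2))) :=
  (measurable_powBregman a (hG.comp measurable_fst) (hG.comp (measurable_fst.add
    (measurable_single.comp measurable_snd)))).ennreal_ofReal

/-- Choosing the reference value c = G ξ makes the divergence vanish on the empty configuration, as
the short-time expansion requires. -/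
theorem ofReal_powEntropy_poissonExp_le_add {a C : ℝ} (ha : 1 < a) {s : ℝ}
    (hs : 0 ≤ s) {G : CountingMeasure X → ℝ} (hG : Measurable G) (hb : ∀ ξ, G ξ ∈ Set.Icc 0 C)
    (ξ : CountingMeasure X) :
    ENNReal.ofReal (powEntropy a (poissonExp μ s) fun ζ => G (ξ + ζ)) ≤
      ENNReal.ofReal s * ∫⁻ x, ENNReal.ofReal (powBregman a (G ξ) (G (ξ + single x))) ∂μ +
        ENNReal.ofReal (a * C ^ (a - 1) * C) *
          ENNReal.ofReal ((s * μ.real Set.univ) ^ 2) := by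
  have := isProbabilityMeasure_poissonExp μ hs
  have hG' : Measurable fun ζ => G (ξ + ζ) := hG.comp (measurable_const_add ξ)
  refine (ENNReal.ofReal_le_ofReal (powEntropy_le_integral_powBregman (c := G ξ) ha (hb ξ).1 hG'
    fun ζ => hb _)).trans ?_
  rw [ofReal_integral_powBregman ha measurable_const (fun _ => hb ξ) hG' fun ζ => hb _]
  refine lintegral_poissonExp_le μ hs
    (g := fun ζ => ENNReal.ofReal (powBregman a (G ξ) (G (ξ + ζ)))) ?_ ?_ ?_
  · exact (measurable_powBregman a measurable_const hG').ennreal_ofReal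
  · simp [powBregman_self]
  · exact fun ζ => ENNReal.ofReal_le_ofReal (powBregman_mem_Icc ha (hb _) (hb _)).2

theorem ofReal_powEntropy_poissonExp_le {a C : ℝ} (ha : 1 < a) (ha2 : a ≤ 2)
    {G : CountingMeasure X → ℝ} (hG : Measurable G) (hb : ∀ ξ, G ξ ∈ Set.Icc 0 C) :
    ENNReal.ofReal (powEntropy a (poissonExp μ 1) G) ≤
      ∫⁻ ξ, ∫⁻ x, ENNReal.ofReal (powBregman a (G ξ) (G (ξ + single x))) ∂μ ∂(poissonExp μ 1) := by
  set J : CountingMeasure X → ℝ≥0∞ := fun ξ =>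
    ∫⁻ x, ENNReal.ofReal (powBregman a (G ξ) (G (ξ + single x))) ∂μ with hJ
  have hJm : Measurable J := (measurable_powBregman_single hG).lintegral_prod_right'
  set m := μ.real Set.univ with hm
  set K := a * C ^ (a - 1) * C with hK
  have hbound : ∀ n : ℕ, ENNReal.ofReal (powEntropy a (poissonExp μ 1) G) ≤
      ENNReal.ofReal (Real.exp (1 / ((n : ℝ) + 1) * m)) * ∫⁻ ξ, J ξ ∂(poissonExp μ 1) +
        ENNReal.ofReal (1 / ((n : ℝ) + 1) * (K * m ^ 2)) := by
    intro n
    -- With n + 1 pieces the quadratic errors add up to (n + 1) K (s m)² = s K m². The remaining n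
    -- pieces have total time 1 - s, and passing to time 1 costs the factor e^(s m).
    set s : ℝ := 1 / ((n : ℝ) + 1) with hs
    have hn : (0 : ℝ) < (n : ℝ) + 1 := by positivity
    have hs0 : 0 ≤ s := by positivity
    have hs1 : ((n : ℝ) + 1) * s = 1 := mul_one_div_cancel hn.ne'
    have hns0 : (0 : ℝ) ≤ n * s := by positivity
    have hns1 : (n : ℝ) * s ≤ 1 := by nlinarith
    have hns : 1 - n * s = s := by linarith
    have := isProbabilityMeasure_poissonExp μ hs0
    have := isProbabilityMeasure_poissonExp μ hns0
    have h1 := powEntropy_poissonExp_le_sum μ ha ha2 hs0 n hG hb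
    rw [hs1] at h1
    refine (ENNReal.ofReal_le_ofReal h1).trans ?_
    have hGa : Measurable fun p : CountingMeasure X × CountingMeasure X => G (p.1 + p.2) :=
      hG.comp measurable_add
    have hHm : Measurable fun ξ => powEntropy a (poissonExp μ s) fun ζ => G (ξ + ζ) :=
      measurable_powEntropy_prodMk hGa
    have hHb : ∀ ξ, (powEntropy a (poissonExp μ s) fun ζ => G (ξ + ζ)) ∈ Set.Icc 0 (C ^ a) :=
      fun ξ => powEntropy_mem_Icc ha (hG.comp (measurable_const_add ξ)) fun ζ => hb _
    rw [ENNReal.ofReal_mul hn.le, ofReal_integral_eq_lintegral_ofReal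
      (integrable_of_mem_Icc hHm hHb) (Eventually.of_forall fun ξ => (hHb ξ).1)]
    have h2 : ∫⁻ ξ, ENNReal.ofReal (powEntropy a (poissonExp μ s) fun ζ => G (ξ + ζ))
        ∂(poissonExp μ (n * s)) ≤ ENNReal.ofReal s * ∫⁻ ξ, J ξ ∂(poissonExp μ (n * s)) +
          ENNReal.ofReal K * ENNReal.ofReal ((s * m) ^ 2) := by
      refine (lintegral_mono fun ξ =>
        ofReal_powEntropy_poissonExp_le_add μ ha hs0 hG hb ξ).trans (le_of_eq ?_)
      rw [lintegral_add_right _ measurable_const, lintegral_const_mul _ hJm, lintegral_const,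
        measure_univ, mul_one]
    refine (mul_le_mul_right h2 _).trans ?_
    rw [mul_add, ← mul_assoc, ← ENNReal.ofReal_mul hn.le, hs1, ENNReal.ofReal_one, one_mul]
    refine add_le_add ?_ (le_of_eq ?_)
    · refine (lintegral_mono' (poissonExp_le μ hns0 hns1) le_rfl).trans (le_of_eq ?_)
      rw [lintegral_smul_measure, hns, smul_eq_mul]
    · rw [← ENNReal.ofReal_mul' (by positivity), ← ENNReal.ofReal_mul hn.le]
      congr 1
      calc ((n : ℝ) + 1) * (K * (s * m) ^ 2) = (((n : ℝ) + 1) * s) * (s * (K * m ^ 2)) := by ring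
        _ = _ := by rw [hs1, one_mul]
  have hlim : Tendsto (fun n : ℕ =>
      ENNReal.ofReal (Real.exp (1 / ((n : ℝ) + 1) * m)) * ∫⁻ ξ, J ξ ∂(poissonExp μ 1) +
        ENNReal.ofReal (1 / ((n : ℝ) + 1) * (K * m ^ 2))) atTop
      (𝓝 (1 * ∫⁻ ξ, J ξ ∂(poissonExp μ 1) + 0)) := by
    have h0 := tendsto_one_div_add_atTop_nhds_zero_nat (𝕜 := ℝ)
    refine Tendsto.add (ENNReal.Tendsto.mul_const ?_ (Or.inl one_ne_zero)) ?_
    · have := ENNReal.tendsto_ofReal ((Real.continuous_exp.tendsto _).comp (h0.mul_const m))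
      simpa [Function.comp_def] using this
    · have := ENNReal.tendsto_ofReal (h0.mul_const (K * m ^ 2))
      simpa using this
  rw [one_mul, add_zero] at hlim
  exact ge_of_tendsto' hlim hbound

end CountingMeasure

namespace CountingMeasure

variable {X : Type*} [MeasurableSpace X]

/-! ### Finite-dimensional events generate the σ-field of configurations -/

section Evaluations

/-- All evaluations of a counting measure at measurable sets. -/
def evaluations (ξ : CountingMeasure X) : {B : Set X // MeasurableSet B} → ℝ≥0∞ := fun B => ξ.1 B

theorem measurable_evaluations : Measurable (evaluations (X := X)) :=
  measurable_pi_lambda _ fun B => measurable_apply B.2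

theorem comap_evaluations :
    (MeasurableSpace.pi).comap evaluations = (inferInstance : MeasurableSpace (CountingMeasure X)) := by
  refine le_antisymm measurable_evaluations.comap_le ?_
  have h : @Measurable _ _ ((MeasurableSpace.pi).comap evaluations) _
      (id : CountingMeasure X → CountingMeasure X) := by
    refine @measurable_of_apply X _ _ ((MeasurableSpace.pi).comap evaluations) id fun B hB => ?_
    exact (measurable_pi_apply (⟨B, hB⟩ : {B : Set X // MeasurableSet B})).comp
      (comap_measurable evaluations)
  exact fun s hs => h hs

/-- The events that depend on finitely many evaluations. -/
def finiteEvents (X : Type*) [MeasurableSpace X] : Set (Set (CountingMeasure X)) :=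
  {A | ∃ t ∈ measurableCylinders fun _ : {B : Set X // MeasurableSet B} => ℝ≥0∞,
    evaluations ⁻¹' t = A}

theorem isPiSystem_finiteEvents : IsPiSystem (finiteEvents X) :=
  isPiSystem_measurableCylinders.comap _

theorem generateFrom_finiteEvents :
    MeasurableSpace.generateFrom (finiteEvents X) =
      (inferInstance : MeasurableSpace (CountingMeasure X)) := by
  rw [← comap_evaluations, ← generateFrom_measurableCylinders, MeasurableSpace.comap_generateFrom]
  rfl

theorem univ_mem_finiteEvents : Set.univ ∈ finiteEvents X :=
  ⟨Set.univ, by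
    rw [mem_measurableCylinders]
    exact ⟨∅, Set.univ, MeasurableSet.univ, by simp⟩, rfl⟩

end Evaluations

/-! ### Sums over removed points and their measurability -/

section Removal

/-- The sum of `g (ξ - δ_x)` over the points `x` of `ξ` in `C`. -/
noncomputable def removeSum (C : Set X) (g : CountingMeasure X → ℝ≥0∞) (ξ : CountingMeasure X) :
    ℝ≥0∞ := ξ.integral fun x => Measure.dirac x C * g (ξ.removePoint x)

theorem removePoint_of_add_single {ξ θ : CountingMeasure X} {x : X} (h : θ + single x = ξ) :
    ξ.removePoint x = θ := by
  rw [← h, ← addPoint_eq, removePoint_addPoint]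

theorem removePoint_add_single (ξ : CountingMeasure X) (i : ξ.Index) :
    ξ.removePoint (ξ.point i) + single (ξ.point i) = ξ := by
  refine Subtype.ext ?_
  rw [val_add, val_single]
  exact removePoint_add_dirac ξ i

/-- The summand sees a point only through its Dirac measure, so any enumeration of the points gives
the same sum. This frees later computations from the chosen list. -/
theorem removeSum_eq_tsum {ι : Type} (C : Set X) (g : CountingMeasure X → ℝ≥0∞)
    (ξ : CountingMeasure X) (x : ι → X) (hx : ξ.1 = Measure.sum fun i => Measure.dirac (x i))
    (θ : ι → CountingMeasure X) (hθ : ∀ i, θ i + single (x i) = ξ) :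
    removeSum C g ξ = ∑' i, Measure.dirac (x i) C * g (θ i) := by
  classical
  have h := integral_eq_tsum ξ x hx fun ν =>
    ν C * g (if h : IsCountingMeasure (ξ.1 - ν) then ⟨ξ.1 - ν, h⟩ else ξ)
  refine Eq.trans h (tsum_congr fun i => ?_)
  rw [← removePoint_of_add_single (hθ i)]
  rfl

theorem removeSum_eq (C : Set X) (g : CountingMeasure X → ℝ≥0∞) (ξ : CountingMeasure X) :
    removeSum C g ξ = ∑' i : ξ.Index, Measure.dirac (ξ.point i) C * g (ξ.removePoint (ξ.point i)) :=
  rfl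

/-- A Leibniz rule: a point removed from the sum comes from one of the two summands. -/
theorem removeSum_add (C : Set X) (g : CountingMeasure X → ℝ≥0∞) (ξ ζ : CountingMeasure X) :
    removeSum C g (ξ + ζ) =
      removeSum C (fun θ => g (θ + ζ)) ξ + removeSum C (fun θ => g (ξ + θ)) ζ := by
  have hx : (ξ + ζ).1 = Measure.sum fun i : ξ.Index ⊕ ζ.Index =>
      Measure.dirac (Sum.elim ξ.point ζ.point i) := by
    rw [val_add, eq_sum_dirac ξ, eq_sum_dirac ζ]
    ext B hB
    rw [Measure.add_apply, Measure.sum_apply _ hB, Measure.sum_apply _ hB, Measure.sum_apply _ hB,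
      Summable.tsum_sum ENNReal.summable ENNReal.summable]
    simp
  rw [removeSum_eq_tsum C g (ξ + ζ) _ hx
    (Sum.elim (fun i => ξ.removePoint (ξ.point i) + ζ) fun j => ξ + ζ.removePoint (ζ.point j)),
    Summable.tsum_sum ENNReal.summable ENNReal.summable]
  · simp [removeSum_eq]
  · rintro (i | j)
    · simp only [Sum.elim_inl]
      rw [add_right_comm, removePoint_add_single]
    · simp only [Sum.elim_inr]
      rw [add_assoc, removePoint_add_single]

theorem removeSum_single (C : Set X) (g : CountingMeasure X → ℝ≥0∞) (x : X) :
    removeSum C g (single x) = Measure.dirac x C * g 0 := by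
  rw [removeSum_eq_tsum (ι := Unit) C g (single x) (fun _ => x) _ fun _ => 0]
  · simp
  · simp
  · ext B hB
    simp

theorem sum_dirac_apply (ξ : CountingMeasure X) {C : Set X} (hC : MeasurableSet C) :
    ∑' i : ξ.Index, Measure.dirac (ξ.point i) C = ξ.1 C := by
  conv_rhs => rw [eq_sum_dirac ξ, Measure.sum_apply _ hC]

theorem removeSum_eq_zero {C : Set X} (hC : MeasurableSet C) (g : CountingMeasure X → ℝ≥0∞)
    {ξ : CountingMeasure X} (h : ξ.1 C = 0) : removeSum C g ξ = 0 := by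
  rw [← sum_dirac_apply ξ hC, ENNReal.tsum_eq_zero] at h
  rw [removeSum_eq]
  simp [h]

theorem removeSum_zero (C : Set X) (g : CountingMeasure X → ℝ≥0∞) : removeSum C g 0 = 0 := by
  rw [removeSum_eq_tsum (ι := Empty) C g 0 Empty.elim _ Empty.elim]
  · simp
  · simp
  · simp

theorem removePoint_apply (ξ : CountingMeasure X) (i : ξ.Index) {B : Set X} :
    (ξ.removePoint (ξ.point i)).1 B = ξ.1 B - Measure.dirac (ξ.point i) B := by
  have h : ξ.1 B = (ξ.removePoint (ξ.point i)).1 B + Measure.dirac (ξ.point i) B := by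
    rw [← Measure.add_apply, removePoint_add_dirac]
  rw [h, ENNReal.add_sub_cancel_right (measure_ne_top _ _)]

open Classical in
/-- The measure `∑ δ_{(y, ξ - δ_x)}`, summed over the points `x` of `ξ` in `C`, if there are finitely
many of them, and `0` otherwise. -/
noncomputable def removalMeasure {Y : Type*} [MeasurableSpace Y] (C : Set X)
    (p : Y × CountingMeasure X) : Measure (Y × CountingMeasure X) :=
  if p.2.1 C < ∞ then Measure.sum fun i : p.2.Index => Measure.dirac (p.2.point i) C •
    Measure.dirac (p.1, p.2.removePoint (p.2.point i)) else 0

variable {Y : Type*} [MeasurableSpace Y]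

theorem lintegral_removalMeasure (C : Set X) {K : Y × CountingMeasure X → ℝ≥0∞}
    (hK : Measurable K) (p : Y × CountingMeasure X) :
    ∫⁻ q, K q ∂(removalMeasure C p) =
      {p | p.2.1 C < ∞}.indicator (fun p => removeSum C (fun θ => K (p.1, θ)) p.2) p := by
  classical
  by_cases h : p.2.1 C < ∞
  · have hp : p ∈ {p : Y × CountingMeasure X | p.2.1 C < ∞} := h
    rw [removalMeasure, if_pos h, Set.indicator_of_mem hp, lintegral_sum_measure, removeSum_eq]
    refine tsum_congr fun i => ?_
    rw [lintegral_smul_measure, lintegral_dirac' _ hK, smul_eq_mul]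
  · have hp : p ∉ {p : Y × CountingMeasure X | p.2.1 C < ∞} := h
    rw [removalMeasure, if_neg h, Set.indicator_of_notMem hp, lintegral_zero_measure]

theorem removalMeasure_univ {C : Set X} (hC : MeasurableSet C) (p : Y × CountingMeasure X) :
    removalMeasure C p Set.univ = {p : Y × CountingMeasure X | p.2.1 C < ∞}.indicator
      (fun p => p.2.1 C) p := by
  rw [← lintegral_one, lintegral_removalMeasure C measurable_const]
  congr 1
  ext q
  simp [removeSum_eq, sum_dirac_apply _ hC]

theorem measurableSet_apply_lt_top {C : Set X} (hC : MeasurableSet C) :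
    MeasurableSet {p : Y × CountingMeasure X | p.2.1 C < ∞} :=
  measurableSet_lt ((measurable_apply hC).comp measurable_snd) measurable_const

open Classical in
theorem measurableSet_membership (J : Finset {B : Set X // MeasurableSet B}) (σ : J → Bool) :
    MeasurableSet {x | (fun B : J => decide (x ∈ B.1.1)) = σ} := by
  have : {x | (fun B : J => decide (x ∈ B.1.1)) = σ} =
      ⋂ B : J, if σ B then B.1.1 else B.1.1ᶜ := by
    ext x
    simp only [Set.mem_ofPred_eq, funext_iff, Set.mem_iInter]
    refine forall_congr' fun B => ?_
    cases σ B <;> simp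
  rw [this]
  refine MeasurableSet.iInter fun B => ?_
  split_ifs
  exacts [B.1.2, B.1.2.compl]

-- Removing x lowers the counts of the sets in J by the membership pattern of x. Grouping the points
-- by pattern turns the sum over points into a finite expression in evaluations of ξ.
open Classical in
theorem removeSum_indicator {C : Set X} (hC : MeasurableSet C)
    (J : Finset {B : Set X // MeasurableSet B}) {S : Set (J → ℝ≥0∞)} (ξ : CountingMeasure X) :
    removeSum C (fun θ => if (fun B : J => θ.1 B.1.1) ∈ S then 1 else 0) ξ =
      ∑ σ : J → Bool, ξ.1 (C ∩ {x | (fun B : J => decide (x ∈ B.1.1)) = σ}) *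
        if (fun B : J => ξ.1 B.1.1 - if σ B then 1 else 0) ∈ S then 1 else 0 := by
  have hm := fun σ => hC.inter (measurableSet_membership J σ)
  rw [removeSum_eq]
  simp only [← sum_dirac_apply ξ (hm _), ← ENNReal.tsum_mul_right]
  rw [← Summable.tsum_finsetSum fun _ _ => ENNReal.summable]
  refine tsum_congr fun i => ?_
  rw [Finset.sum_eq_single fun B : J => decide (ξ.point i ∈ B.1.1)]
  · rw [Measure.dirac_apply' _ hC, Measure.dirac_apply' _ (hm _)]
    congr 1
    · by_cases h : ξ.point i ∈ C <;> simp [h]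
    · congr 2
      ext B
      rw [removePoint_apply, Measure.dirac_apply' _ B.1.2]
      simp [Set.indicator]
  · intro σ _ hσ
    rw [Measure.dirac_apply' _ (hm _), Set.indicator_of_notMem, zero_mul]
    exact fun h => hσ h.2.symm
  · simp

/-- The list of points comes from a choice and need not be measurable in ξ. The removal measure is
determined on a π-system of rectangles, where it is an explicit function of evaluations. The cutoff
at ξ(C) = ∞ keeps its mass finite, as the π-λ argument needs. -/
theorem measurable_removalMeasure {C : Set X} (hC : MeasurableSet C) :
    Measurable (removalMeasure C : Y × CountingMeasure X → Measure (Y × CountingMeasure X)) := by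
  classical
  have hfin : ∀ p : Y × CountingMeasure X, IsFiniteMeasure (removalMeasure C p) := by
    intro p
    refine ⟨?_⟩
    rw [removalMeasure_univ hC]
    by_cases h : p ∈ {p : Y × CountingMeasure X | p.2.1 C < ∞}
    · rw [Set.indicator_of_mem h]; exact h
    · rw [Set.indicator_of_notMem h]; exact ENNReal.zero_lt_top
  refine Measurable.measure_of_isPiSystem (generateFrom_eq_prod (C := {s | MeasurableSet s})
    (D := finiteEvents X) MeasurableSpace.generateFrom_measurableSet generateFrom_finiteEvents
    isCountablySpanning_measurableSet ⟨fun _ => Set.univ, fun _ => univ_mem_finiteEvents,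
      Set.iUnion_const _⟩).symm (MeasurableSpace.isPiSystem_measurableSet.prod
        isPiSystem_finiteEvents) ?_ ?_
  · rintro _ ⟨s, hs, t, ⟨t', ht', rfl⟩, rfl⟩
    obtain ⟨J, S, hS, rfl⟩ := (mem_measurableCylinders _).1 ht'
    have hs : MeasurableSet s := hs
    have hT : MeasurableSet (evaluations ⁻¹' cylinder J S : Set (CountingMeasure X)) :=
      measurable_evaluations (MeasurableSet.cylinder J hS)
    have e : ∀ p : Y × CountingMeasure X,
        removalMeasure C p (s ×ˢ (evaluations ⁻¹' cylinder J S)) =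
        {p : Y × CountingMeasure X | p.2.1 C < ∞}.indicator
          (fun p => (if p.1 ∈ s then 1 else 0) *
            ∑ σ : J → Bool, p.2.1 (C ∩ {x | (fun B : J => decide (x ∈ B.1.1)) = σ}) *
              if (fun B : J => p.2.1 B.1.1 - if σ B then 1 else 0) ∈ S then 1 else 0) p := by
      intro p
      rw [← lintegral_indicator_one (hs.prod hT),
        lintegral_removalMeasure C (measurable_one.indicator (hs.prod hT))]
      congr 1
      ext q
      rw [← removeSum_indicator hC, removeSum_eq, removeSum_eq, ← ENNReal.tsum_mul_left]
      refine tsum_congr fun i => ?_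
      rw [mul_left_comm]
      congr 1
      simp only [Set.indicator, Set.mem_prod, Pi.one_apply]
      by_cases h1 : q.1 ∈ s
      · simp only [h1, true_and, if_true, one_mul]
        rfl
      · simp [h1]
    simp only [e]
    refine Measurable.indicator ?_ (measurableSet_apply_lt_top hC)
    refine (Measurable.ite (measurable_fst hs) measurable_const measurable_const).mul
      (Finset.measurable_sum _ fun σ _ => ?_)
    refine ((measurable_apply (hC.inter (measurableSet_membership J σ))).comp
      measurable_snd).mul (Measurable.ite ?_ measurable_const measurable_const)
    refine (measurable_pi_lambda _ fun B => ?_ :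
        Measurable fun p : Y × CountingMeasure X => fun B : J =>
          p.2.1 B.1.1 - if σ B then 1 else 0) hS
    exact ((measurable_apply B.1.2).comp measurable_snd).sub measurable_const
  · simp only [removalMeasure_univ hC]
    exact ((measurable_apply hC).comp measurable_snd).indicator (measurableSet_apply_lt_top hC)

theorem measurable_removeSum {C : Set X} (hC : MeasurableSet C)
    {K : Y × CountingMeasure X → ℝ≥0∞} (hK : Measurable K) :
    Measurable ({p : Y × CountingMeasure X | p.2.1 C < ∞}.indicator
      fun p => removeSum C (fun θ => K (p.1, θ)) p.2) := by
  simp only [← funext (lintegral_removalMeasure C hK)]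
  exact (Measure.measurable_lintegral hK).comp (measurable_removalMeasure (Y := Y) hC)

/-- The parameter y is there to be set equal to ξ afterwards: measurability on the product then
yields measurability on the diagonal, for kernels depending on both ξ and ξ - δ_x. -/
theorem exists_measurable_eq_removeSum {C : Set X} (hC : MeasurableSet C)
    {K : Y × CountingMeasure X → ℝ≥0∞} (hK : Measurable K) :
    ∃ S : Y × CountingMeasure X → ℝ≥0∞, Measurable S ∧
      ∀ y ξ, ξ.1 C < ∞ → S (y, ξ) = removeSum C (fun θ => K (y, θ)) ξ :=
  ⟨_, measurable_removeSum hC hK, fun _ _ h =>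
    Set.indicator_of_mem (s := {p : Y × CountingMeasure X | p.2.1 C < ∞}) h _⟩

end Removal

/-! ### The Mecke formula for finite intensity -/

section Mecke

variable (μ : Measure X) [IsFiniteMeasure μ]

theorem ae_pointPower_univ (n : ℕ) : ∀ᵐ ξ ∂(pointPower μ n), ξ.1 Set.univ = (n : ℝ≥0∞) := by
  have hm : ∀ n : ℕ, MeasurableSet {ξ : CountingMeasure X | ξ.1 Set.univ = (n : ℝ≥0∞)}ᶜ := fun n =>
    (measurable_apply MeasurableSet.univ (measurableSet_singleton (n : ℝ≥0∞))).compl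
  induction n with
  | zero =>
    rw [pointPower, ae_dirac_iff (hm 0).of_compl]
    simp
  | succ n ih =>
    change pointPower μ (n + 1) {ξ : CountingMeasure X | ξ.1 Set.univ = ((n + 1 : ℕ) : ℝ≥0∞)}ᶜ = 0
    rw [← lintegral_indicator_one (hm (n + 1)), lintegral_pointPower_succ μ n
      (measurable_one.indicator (hm (n + 1))), lintegral_eq_zero_iff']
    · filter_upwards [ih] with ξ hξ
      simp [Set.indicator, hξ]
    · exact (Measurable.lintegral_prod_right' (f := fun p : CountingMeasure X × X =>
        {ξ : CountingMeasure X | ξ.1 Set.univ = ((n + 1 : ℕ) : ℝ≥0∞)}ᶜ.indicator 1 (p.1 + single p.2))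
        ((measurable_one.indicator (hm (n + 1))).comp (by fun_prop))).aemeasurable

theorem ae_pointPower_apply_lt_top (n : ℕ) (C : Set X) :
    ∀ᵐ ξ ∂(pointPower μ n), ξ.1 C < ∞ := by
  filter_upwards [ae_pointPower_univ μ n] with ξ hξ
  exact (measure_mono (Set.subset_univ C)).trans_lt (hξ ▸ ENNReal.natCast_lt_top n)

/-- By the Leibniz rule the removed point is either the last one, which gives the second term, or
one of the first n. -/
theorem lintegral_removeSum_pointPower_aux {C : Set X} (hC : MeasurableSet C)
    {K : CountingMeasure X × CountingMeasure X → ℝ≥0∞} (hK : Measurable K) (n : ℕ) :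
    ∫⁻ ξ, removeSum C (fun θ => K (ξ, θ)) ξ ∂(pointPower μ (n + 1)) =
      ∫⁻ x, ∫⁻ ξ, removeSum C (fun θ => K (ξ + single x, θ + single x)) ξ ∂(pointPower μ n) ∂μ +
      ∫⁻ ξ, ∫⁻ x, Measure.dirac x C * K (ξ + single x, ξ) ∂μ ∂(pointPower μ n) := by
  have hd : Measurable fun x : X => Measure.dirac x C :=
    (Measure.measurable_coe hC).comp Measure.measurable_dirac
  obtain ⟨R, hR, hRe⟩ := exists_measurable_eq_removeSum hC hK
  have hK2 : Measurable fun q : (X × CountingMeasure X) × CountingMeasure X =>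
      K (q.1.2 + single q.1.1, q.2 + single q.1.1) := by fun_prop
  obtain ⟨S, hS, hSe⟩ := exists_measurable_eq_removeSum hC hK2
  simp only at hSe
  have hB : Measurable fun p : CountingMeasure X × X =>
      Measure.dirac p.2 C * K (p.1 + single p.2, p.1) :=
    (hd.comp measurable_snd).mul (by fun_prop)
  have hSm : Measurable fun p : CountingMeasure X × X => S ((p.2, p.1), p.1) := by fun_prop
  have hRm : Measurable fun ξ => R (ξ, ξ) := by fun_prop
  have h1 : ∫⁻ ξ, removeSum C (fun θ => K (ξ, θ)) ξ ∂(pointPower μ (n + 1)) =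
      ∫⁻ ξ, R (ξ, ξ) ∂(pointPower μ (n + 1)) := by
    refine lintegral_congr_ae ?_
    filter_upwards [ae_pointPower_apply_lt_top μ (n + 1) C] with ξ hξ
    exact (hRe ξ ξ hξ).symm
  have h2 : ∫⁻ ξ, ∫⁻ x, R (ξ + single x, ξ + single x) ∂μ ∂(pointPower μ n) =
      ∫⁻ ξ, (∫⁻ x, S ((x, ξ), ξ) ∂μ + ∫⁻ x, Measure.dirac x C * K (ξ + single x, ξ) ∂μ)
        ∂(pointPower μ n) := by
    refine lintegral_congr_ae ?_
    filter_upwards [ae_pointPower_apply_lt_top μ n C] with ξ hξ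
    have hBξ : Measurable fun x => Measure.dirac x C * K (ξ + single x, ξ) :=
      hd.mul (by fun_prop)
    refine Eq.trans ?_ (lintegral_add_right (fun x => S ((x, ξ), ξ)) hBξ)
    refine lintegral_congr fun x => ?_
    have hx : (ξ + single x).1 C < ∞ := by
      rw [val_add, val_single, Measure.add_apply]
      exact ENNReal.add_lt_top.2 ⟨hξ, measure_lt_top _ _⟩
    rw [hRe _ _ hx, removeSum_add, removeSum_single, add_zero, hSe _ ξ hξ]
  rw [h1, lintegral_pointPower_succ μ n hRm, h2]
  refine (lintegral_add_right (fun ξ => ∫⁻ x, S ((x, ξ), ξ) ∂μ)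
    hB.lintegral_prod_right').trans ?_
  rw [lintegral_lintegral_swap (f := fun ξ x => S ((x, ξ), ξ)) hSm.aemeasurable]
  congr 1
  refine lintegral_congr fun x => lintegral_congr_ae ?_
  filter_upwards [ae_pointPower_apply_lt_top μ n C] with ξ hξ
  exact hSe (x, ξ) ξ hξ

theorem lintegral_removeSum_pointPower_zero (C : Set X)
    {K : CountingMeasure X × CountingMeasure X → ℝ≥0∞} :
    ∫⁻ ξ, removeSum C (fun θ => K (ξ, θ)) ξ ∂(pointPower μ 0) = 0 := by
  have h0 : ∀ᵐ ξ ∂(pointPower μ 0), ξ.1 Set.univ = 0 := by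
    simpa using ae_pointPower_univ μ 0
  rw [lintegral_congr_ae (g := fun _ => 0), lintegral_zero]
  filter_upwards [h0] with ξ hξ
  have : ξ = 0 := Subtype.ext (Measure.measure_univ_eq_zero.1 hξ)
  rw [this, removeSum_zero]

/-- All n + 1 points play the same role, so the removals contribute equally. In the induction the
kernel is translated by the last point, which is then exchanged with the removed one. -/
theorem lintegral_removeSum_pointPower {C : Set X} (hC : MeasurableSet C) (n : ℕ)
    {K : CountingMeasure X × CountingMeasure X → ℝ≥0∞} (hK : Measurable K) :
    ∫⁻ ξ, removeSum C (fun θ => K (ξ, θ)) ξ ∂(pointPower μ (n + 1)) =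
      (n + 1) * ∫⁻ ξ, ∫⁻ x, Measure.dirac x C * K (ξ + single x, ξ) ∂μ ∂(pointPower μ n) := by
  have hd : Measurable fun x : X => Measure.dirac x C :=
    (Measure.measurable_coe hC).comp Measure.measurable_dirac
  induction n generalizing K with
  | zero =>
    rw [lintegral_removeSum_pointPower_aux μ hC hK]
    have : ∀ x : X, ∫⁻ ξ, removeSum C (fun θ => K (ξ + single x, θ + single x)) ξ
        ∂(pointPower μ 0) = 0 := fun x =>
      lintegral_removeSum_pointPower_zero μ C
        (K := fun p => K (p.1 + single x, p.2 + single x))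
    simp [this]
  | succ n ih =>
    rw [lintegral_removeSum_pointPower_aux μ hC hK]
    have hx : ∀ x : X, ∫⁻ ξ, removeSum C (fun θ => K (ξ + single x, θ + single x)) ξ
        ∂(pointPower μ (n + 1)) = (n + 1) * ∫⁻ ξ, ∫⁻ y, Measure.dirac y C *
          K (ξ + single y + single x, ξ + single x) ∂μ ∂(pointPower μ n) := fun x =>
      ih (K := fun p => K (p.1 + single x, p.2 + single x)) (by fun_prop)
    have hh : Measurable fun p : CountingMeasure X × X =>
        Measure.dirac p.2 C * K (p.1 + single p.2, p.1) :=
      (hd.comp measurable_snd).mul (by fun_prop)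
    have hg : Measurable fun p : (CountingMeasure X × X) × X => Measure.dirac p.2 C *
        K (p.1.1 + single p.2 + single p.1.2, p.1.1 + single p.1.2) :=
      (hd.comp measurable_snd).mul (by fun_prop)
    simp only [hx]
    rw [lintegral_const_mul _ (hg.lintegral_prod_right'.lintegral_prod_left'),
      ← lintegral_lintegral_swap (f := fun ξ x => ∫⁻ y, Measure.dirac y C *
        K (ξ + single y + single x, ξ + single x) ∂μ) hg.lintegral_prod_right'.aemeasurable]
    simp only [add_right_comm _ (single _) (single _)]
    rw [← lintegral_pointPower_succ μ n
      (g := fun ζ => ∫⁻ y, Measure.dirac y C * K (ζ + single y, ζ) ∂μ) hh.lintegral_prod_right']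
    push_cast
    ring

/-- The factor n + 1 from the removals is absorbed by (n + 1)/(n + 1)! = 1/n!, which shifts the
exponential series by one. -/
theorem lintegral_removeSum_poissonExp {C : Set X} (hC : MeasurableSet C)
    {K : CountingMeasure X × CountingMeasure X → ℝ≥0∞} (hK : Measurable K) :
    ∫⁻ ξ, removeSum C (fun θ => K (ξ, θ)) ξ ∂(poissonExp μ 1) =
      ∫⁻ ξ, ∫⁻ x, Measure.dirac x C * K (ξ + single x, ξ) ∂μ ∂(poissonExp μ 1) := by
  rw [lintegral_poissonExp, lintegral_poissonExp, tsum_eq_zero_add' ENNReal.summable,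
    lintegral_removeSum_pointPower_zero, mul_zero, zero_add]
  refine tsum_congr fun n => ?_
  rw [lintegral_removeSum_pointPower μ hC n hK, ← mul_assoc]
  congr 1
  rw [show ((n : ℝ≥0∞) + 1) = ENNReal.ofReal ((n : ℝ) + 1) by
    rw [ENNReal.ofReal_add (by positivity) zero_le_one, ENNReal.ofReal_natCast, ENNReal.ofReal_one],
    ← ENNReal.ofReal_mul (poissonWeight_nonneg μ zero_le_one _)]
  congr 1
  simp only [poissonWeight, Nat.factorial_succ, one_pow]
  push_cast
  field_simp

end Mecke

end CountingMeasure

/-! ### Scalar Poisson laws and measures carried by countable sets -/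

section PoissonLaw

theorem isProbabilityMeasure_poissonLaw (m : ℝ≥0∞) : IsProbabilityMeasure (poissonLaw m) := by
  rw [poissonLaw]
  split_ifs
  · infer_instance
  · exact Measure.isProbabilityMeasure_map (Measurable.of_discrete).aemeasurable

theorem poissonLaw_singleton {m : ℝ≥0∞} (hm : m ≠ ∞) (k : ℕ) :
    poissonLaw m {(k : ℝ≥0∞)} =
      ENNReal.ofReal (Real.exp (-m.toReal) * m.toReal ^ k / k.factorial) := by
  rw [poissonLaw, if_neg hm, Measure.map_apply Measurable.of_discrete (measurableSet_singleton _)]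
  have : (fun n : ℕ => (n : ℝ≥0∞)) ⁻¹' {(k : ℝ≥0∞)} = {k} := by
    ext n; simp
  rw [this, poissonMeasure_singleton]
  rfl

theorem poissonLaw_singleton_succ {m : ℝ≥0∞} (hm : m ≠ ∞) (k : ℕ) :
    ((k + 1 : ℕ) : ℝ≥0∞) * poissonLaw m {((k + 1 : ℕ) : ℝ≥0∞)} = m * poissonLaw m {(k : ℝ≥0∞)} := by
  rw [poissonLaw_singleton hm, poissonLaw_singleton hm, ← ENNReal.ofReal_natCast,
    ← ENNReal.ofReal_mul (by positivity)]
  conv_rhs => rw [← ENNReal.ofReal_toReal hm, ← ENNReal.ofReal_mul (by positivity)]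
  congr 1
  rw [ENNReal.toReal_ofReal ENNReal.toReal_nonneg, Nat.factorial_succ]
  push_cast
  field_simp
  ring

theorem ae_poissonLaw_range {m : ℝ≥0∞} (hm : m ≠ ∞) :
    poissonLaw m (Set.range fun n : ℕ => (n : ℝ≥0∞))ᶜ = 0 := by
  rw [poissonLaw, if_neg hm, Measure.map_apply Measurable.of_discrete
    (Set.countable_range _).measurableSet.compl, Set.preimage_compl, Set.preimage_range]
  simp

end PoissonLaw

theorem MeasureTheory.Measure.ext_of_countable_singleton {α : Type*} [MeasurableSpace α]
    [MeasurableSingletonClass α] {ν₁ ν₂ : Measure α} [IsProbabilityMeasure ν₁]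
    [IsProbabilityMeasure ν₂] {D : Set α} (hD : D.Countable) (h : ∀ d ∈ D, ν₁ {d} = ν₂ {d})
    (h2 : ν₂ Dᶜ = 0) : ν₁ = ν₂ := by
  have hsum : ∀ B ⊆ D, ν₁ B = ν₂ B := by
    intro B hB
    have hBc := hD.mono hB
    have hm : ∀ b ∈ B, MeasurableSet {b} := fun b _ => measurableSet_singleton b
    have hd : B.PairwiseDisjoint fun b : α => ({b} : Set α) := fun a _ b _ hab =>
      Set.disjoint_singleton.2 hab
    rw [← Set.biUnion_of_singleton B, measure_biUnion hBc hd hm, measure_biUnion hBc hd hm]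
    exact tsum_congr fun b => h b (hB b.2)
  have h1 : ν₁ Dᶜ = 0 := by
    rw [prob_compl_eq_zero_iff hD.measurableSet] at h2 ⊢
    rw [hsum D le_rfl, h2]
  ext A hA
  rw [← measure_inter_add_sdiff A hD.measurableSet, ← measure_inter_add_sdiff A hD.measurableSet,
    hsum _ Set.inter_subset_right,
    measure_mono_null (Set.sdiff_subset_compl A D) h1, measure_mono_null (Set.sdiff_subset_compl A D) h2]

/-! ### Identification of Poisson laws by cell counts, and independent splitting -/

namespace CountingMeasure

variable {X : Type*} [MeasurableSpace X]

/-- The numbers of points of `ξ` in the cells of the partition of `X` into the fibers of `c`. -/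
def cellCounts {ι : Type*} (c : X → ι) (ξ : CountingMeasure X) : ι → ℝ≥0∞ := fun i => ξ.1 (c ⁻¹' {i})

theorem measurable_cellCounts {n : ℕ} {c : X → Fin n} (hc : Measurable c) :
    Measurable (cellCounts c) :=
  measurable_pi_lambda _ fun i => measurable_apply (hc (measurableSet_singleton i))

/-- The evaluations at finitely many sets are sums of the counts in the atoms of the algebra that
these sets generate. Finite-dimensional events are therefore events about one finite partition. -/
theorem ext_of_cellCounts {Q₁ Q₂ : Measure (CountingMeasure X)} [IsProbabilityMeasure Q₁]
    [IsProbabilityMeasure Q₂] (h : ∀ (n : ℕ) (c : X → Fin n), Measurable c →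
      Q₁.map (cellCounts c) = Q₂.map (cellCounts c)) : Q₁ = Q₂ := by
  classical
  refine ext_of_generate_finite (finiteEvents X) generateFrom_finiteEvents.symm
    isPiSystem_finiteEvents ?_ (by simp)
  rintro _ ⟨t, ht, rfl⟩
  obtain ⟨J, S, hS, rfl⟩ := (mem_measurableCylinders _).1 ht
  let e := Fintype.equivFin (J → Bool)
  let c : X → Fin (Fintype.card (J → Bool)) := fun x => e fun B : J => decide (x ∈ B.1.1)
  have hc : Measurable c := by
    refine measurable_to_countable' fun i => ?_
    have : c ⁻¹' {i} = {x | (fun B : J => decide (x ∈ B.1.1)) = e.symm i} := by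
      ext x; simp [c, Equiv.eq_symm_apply]
    rw [this]
    convert! measurableSet_membership J (e.symm i)
  let g : (Fin (Fintype.card (J → Bool)) → ℝ≥0∞) → J → ℝ≥0∞ := fun v B =>
    ∑ i with e.symm i B = true, v i
  have hg : Measurable g := measurable_pi_lambda _ fun B =>
    Finset.measurable_sum _ fun i _ => measurable_pi_apply i
  have key : (evaluations ⁻¹' cylinder J S : Set (CountingMeasure X)) =
      cellCounts c ⁻¹' (g ⁻¹' S) := by
    ext ξ
    have : J.restrict (evaluations ξ) = g (cellCounts c ξ) := by
      ext B
      simp only [Finset.restrict, evaluations, g, cellCounts]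
      rw [sum_measure_preimage_singleton _ fun i _ => hc (measurableSet_singleton i)]
      congr 1
      ext x
      simp [c]
    simp only [Set.mem_preimage, mem_cylinder, this]
  rw [key, ← Measure.map_apply (measurable_cellCounts hc) (hg hS), h _ c hc,
    Measure.map_apply (measurable_cellCounts hc) (hg hS)]

section PoissonExp

variable (μ : Measure X) [IsFiniteMeasure μ]

theorem poissonExp_univ_eq_zero :
    poissonExp μ 1 {ξ | ξ.1 Set.univ = 0} = ENNReal.ofReal (Real.exp (-μ.real Set.univ)) := by
  have hm : MeasurableSet {ξ : CountingMeasure X | ξ.1 Set.univ = 0} :=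
    measurable_apply MeasurableSet.univ (measurableSet_singleton 0)
  rw [← lintegral_indicator_one hm, lintegral_poissonExp, tsum_eq_single 0]
  · rw [lintegral_pointPower_zero _ (measurable_one.indicator hm)]
    simp [poissonWeight]
  · intro n hn
    rw [lintegral_indicator_one hm]
    have : pointPower μ n {ξ | ξ.1 Set.univ = 0} = 0 := by
      refine measure_mono_null ?_ (ae_pointPower_univ μ n)
      intro ξ hξ
      have hξ : ξ.1 Set.univ = 0 := hξ
      change ¬ (ξ.1 Set.univ = (n : ℝ≥0∞))
      rw [hξ]
      exact_mod_cast hn.symm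
    rw [this, mul_zero]

theorem cellCounts_add_single {n : ℕ} {c : X → Fin n} (hc : Measurable c) (ξ : CountingMeasure X)
    (x : X) : cellCounts c (ξ + single x) = cellCounts c ξ + Pi.single (c x) 1 := by
  ext i
  simp only [cellCounts, val_add, val_single, Measure.add_apply, Pi.add_apply]
  rw [Measure.dirac_apply' _ (hc (measurableSet_singleton i))]
  congr 1
  by_cases h : c x = i
  · subst h; simp
  · rw [Pi.single_eq_of_ne (Ne.symm h)]
    simp [h]

/-- Induction on the total number of points. The Mecke formula on the cell of an index s with k_s ≠
0 gives k_s P(N = k) = μ(cell) P(N = k - e_s), the recursion satisfied by the product of Poisson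
weights. -/
theorem poissonExp_cellCounts_singleton {n : ℕ} {c : X → Fin n} (hc : Measurable c)
    (k : Fin n → ℕ) :
    poissonExp μ 1 {ξ | cellCounts c ξ = fun i => (k i : ℝ≥0∞)} =
      ∏ i, poissonLaw (μ (c ⁻¹' {i})) {(k i : ℝ≥0∞)} := by
  have hms : ∀ k : Fin n → ℕ,
      MeasurableSet {ξ : CountingMeasure X | cellCounts c ξ = fun i => (k i : ℝ≥0∞)} := fun k =>
    measurable_cellCounts hc (measurableSet_singleton _)
  induction hN : ∑ i, k i generalizing k with
  | zero =>
    have hk : k = 0 := by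
      ext i
      exact (Finset.sum_eq_zero_iff.1 hN) i (Finset.mem_univ i)
    subst hk
    have h1 : {ξ : CountingMeasure X | cellCounts c ξ = fun i => (((0 : Fin n → ℕ) i : ℕ) : ℝ≥0∞)} =
        {ξ | ξ.1 Set.univ = 0} := by
      ext ξ
      have : ξ.1 Set.univ = ∑ i, cellCounts c ξ i := by
        simp only [cellCounts]
        rw [sum_measure_preimage_singleton _ fun i _ => hc (measurableSet_singleton i)]
        simp
      simp only [Set.mem_ofPred_eq, this, Finset.sum_eq_zero_iff, Finset.mem_univ, true_imp_iff,
        funext_iff, Pi.zero_apply, Nat.cast_zero]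
    rw [h1, poissonExp_univ_eq_zero]
    simp only [poissonLaw_singleton (measure_ne_top μ _), Pi.zero_apply, pow_zero, mul_one,
      Nat.factorial_zero, Nat.cast_one, div_one]
    rw [← ENNReal.ofReal_prod_of_nonneg fun i _ => (Real.exp_pos _).le, ← Real.exp_sum,
      Finset.sum_neg_distrib]
    congr 3
    have h2 : μ Set.univ = ∑ i, μ (c ⁻¹' {i}) := by
      rw [sum_measure_preimage_singleton _ fun i _ => hc (measurableSet_singleton i)]
      simp
    rw [measureReal_def, h2, ENNReal.toReal_sum fun i _ => measure_ne_top μ _]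
  | succ N ih =>
    obtain ⟨s, hs⟩ : ∃ s, k s ≠ 0 := by
      by_contra! hcon
      simp [hcon] at hN
    obtain ⟨j, hj⟩ := Nat.exists_eq_succ_of_ne_zero hs
    have hk : k = Function.update k s j + Pi.single s 1 := by
      ext i
      by_cases h : i = s
      · subst h; simp [hj]
      · simp [h]
    set k' := Function.update k s j with hk'
    have hk's : k' s = j := by simp [hk']
    have hsum : ∑ i, k' i = N := by
      have : ∑ i, k i = ∑ i, k' i + 1 := by
        conv_lhs => rw [hk]
        simp [Finset.sum_add_distrib]
      omega
    have ih' := ih k' hsum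
    set C := c ⁻¹' {s} with hC
    have hCm : MeasurableSet C := hc (measurableSet_singleton s)
    set A := {ξ : CountingMeasure X | cellCounts c ξ = fun i => (k i : ℝ≥0∞)} with hA
    set A' := {ξ : CountingMeasure X | cellCounts c ξ = fun i => (k' i : ℝ≥0∞)} with hA'
    have hmecke := lintegral_removeSum_poissonExp μ hCm
      (K := fun p => A.indicator 1 p.1) ((measurable_one.indicator (hms k)).comp measurable_fst)
    have hl : ∀ ξ : CountingMeasure X, removeSum C (fun _ => A.indicator 1 ξ) ξ =
        (k s : ℝ≥0∞) * A.indicator 1 ξ := by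
      intro ξ
      rw [removeSum_eq, ENNReal.tsum_mul_right, sum_dirac_apply ξ hCm]
      by_cases h : ξ ∈ A
      · have h' : cellCounts c ξ = fun i => (k i : ℝ≥0∞) := h
        have := congrFun h' s
        simp only [cellCounts] at this
        rw [← this]
      · simp [h]
    have hr : ∀ (ξ : CountingMeasure X) (x : X), Measure.dirac x C * A.indicator 1 (ξ + single x) =
        C.indicator 1 x * A'.indicator 1 ξ := by
      intro ξ x
      rw [Measure.dirac_apply' _ hCm]
      by_cases hx : x ∈ C
      · have hx' : c x = s := hx
        congr 1
        have : ξ + single x ∈ A ↔ ξ ∈ A' := by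
          change cellCounts c (ξ + single x) = _ ↔ cellCounts c ξ = _
          rw [cellCounts_add_single hc, hx', hk]
          have : (fun i => (((k' + Pi.single s 1 : Fin n → ℕ) i : ℕ) : ℝ≥0∞)) =
              (fun i => (k' i : ℝ≥0∞)) + Pi.single s 1 := by
            ext i
            by_cases h : i = s
            · subst h; simp
            · simp [h]
          rw [this]
          constructor
          · intro h
            ext i
            have hi := congrFun h i
            refine (ENNReal.add_left_inj (a := (Pi.single s (1 : ℝ≥0∞) : Fin n → ℝ≥0∞) i) ?_).1 hi
            by_cases h : i = s
            · subst h; simp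
            · simp [h]
          · intro h
            rw [h]
        by_cases h : ξ ∈ A'
        · simp [h, this.2 h]
        · simp [h, mt this.1 h]
      · simp [hx]
    simp only [hl, hr] at hmecke
    rw [lintegral_const_mul _ (measurable_one.indicator (hms k)), lintegral_indicator_one (hms k)]
      at hmecke
    simp only [lintegral_mul_const _ (measurable_one.indicator hCm),
      lintegral_indicator_one hCm] at hmecke
    rw [lintegral_const_mul _ (measurable_one.indicator (hms k')), lintegral_indicator_one (hms k'),
      ih'] at hmecke
    have hks : (k s : ℝ≥0∞) ≠ 0 := by exact_mod_cast hs
    refine (ENNReal.mul_right_inj hks (ENNReal.natCast_ne_top _)).1 (hmecke.trans ?_)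
    rw [← Finset.mul_prod_erase _ _ (Finset.mem_univ s), ← Finset.mul_prod_erase
      (a := s) _ _ (Finset.mem_univ s), ← mul_assoc, ← mul_assoc, hk's, hj,
      poissonLaw_singleton_succ (measure_ne_top μ _)]
    congr 1
    refine Finset.prod_congr rfl fun i hi => ?_
    rw [hk', Function.update_of_ne (Finset.ne_of_mem_erase hi)]

theorem map_cellCounts_poissonExp {n : ℕ} {c : X → Fin n} (hc : Measurable c) :
    (poissonExp μ 1).map (cellCounts c) = Measure.pi fun i => poissonLaw (μ (c ⁻¹' {i})) := by
  have := isProbabilityMeasure_poissonExp μ zero_le_one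
  have := fun i => isProbabilityMeasure_poissonLaw (μ (c ⁻¹' {i}))
  have := Measure.isProbabilityMeasure_map (μ := poissonExp μ 1)
    (measurable_cellCounts hc).aemeasurable
  refine Measure.ext_of_countable_singleton
    (D := Set.range fun (k : Fin n → ℕ) i => (k i : ℝ≥0∞)) (Set.countable_range _) ?_ ?_
  · rintro _ ⟨k, rfl⟩
    rw [Measure.map_apply (measurable_cellCounts hc) (measurableSet_singleton _),
      Measure.pi_singleton]
    exact poissonExp_cellCounts_singleton μ hc k
  · have h : ∀ i, ∀ᵐ v ∂(Measure.pi fun i => poissonLaw (μ (c ⁻¹' {i}))),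
        v i ∈ Set.range fun n : ℕ => (n : ℝ≥0∞) := fun i =>
      Measure.tendsto_eval_ae_ae.eventually (ae_poissonLaw_range (measure_ne_top μ _))
    refine measure_mono_null ?_ (ae_all_iff.2 h)
    intro v hv hv'
    choose k hk using hv'
    exact hv ⟨k, funext hk⟩

end PoissonExp

/-- `Q` is the law of a Poisson process with intensity `μ`: the numbers of points in disjoint sets
are independent and Poisson distributed. -/
def IsPoissonLaw (Q : Measure (CountingMeasure X)) (μ : Measure X) : Prop :=
  ∀ (ι : Type) (_ : Fintype ι) (A : ι → Set X), (∀ i, MeasurableSet (A i)) →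
    (∀ i j, i ≠ j → Disjoint (A i) (A j)) →
    Q.map (fun ξ i => ξ.1 (A i)) = Measure.pi fun i => poissonLaw (μ (A i))

theorem isPoissonLaw_map {Ω : Type*} [MeasurableSpace Ω] {P : Measure Ω} [IsProbabilityMeasure P]
    {μ : Measure X} {η : Ω → CountingMeasure X} (hη : IsPoissonProcess η μ P) :
    IsPoissonLaw (P.map η) μ := by
  intro ι _ A hA hd
  have hm : ∀ i, Measurable fun ω => (η ω).1 (A i) := fun i =>
    (measurable_apply (hA i)).comp hη.measurable
  let e := Fintype.equivFin ι
  have hind := (hη.indep _ (A ∘ e.symm) (fun i => hA _)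
    fun i j hij => hd _ _ fun h => hij (e.symm.injective h)).precomp e.injective
  have hind' : iIndepFun (fun i ω => (η ω).1 (A i)) P := by
    simpa [Function.comp_def] using hind
  rw [iIndepFun_iff_map_fun_eq_pi_map fun i => (hm i).aemeasurable] at hind'
  rw [Measure.map_map (measurable_pi_lambda _ fun i => measurable_apply (hA i)) hη.measurable]
  refine hind'.trans ?_
  congr
  ext i : 1
  exact hη.map_eq _ (hA i)

theorem IsPoissonLaw.ae_apply_lt_top {Q : Measure (CountingMeasure X)} {μ : Measure X}
    (hQ : IsPoissonLaw Q μ) {C : Set X} (hC : MeasurableSet C) (hμ : μ C ≠ ∞) :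
    ∀ᵐ ξ ∂Q, ξ.1 C < ∞ := by
  have h := hQ Unit inferInstance (fun _ => C) (fun _ => hC) (fun i j h => (h rfl).elim)
  have := isProbabilityMeasure_poissonLaw (μ C)
  have h1 : ∀ᵐ v ∂(Measure.pi fun _ : Unit => poissonLaw (μ C)),
      v () ∈ Set.range fun n : ℕ => (n : ℝ≥0∞) :=
    Measure.tendsto_eval_ae_ae.eventually (ae_poissonLaw_range hμ)
  rw [← h] at h1
  have h2 := ae_of_ae_map (measurable_pi_lambda _ fun _ => measurable_apply hC).aemeasurable h1
  filter_upwards [h2] with ξ hξ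
  obtain ⟨n, hn⟩ := hξ
  simp only at hn
  rw [← hn]
  exact ENNReal.natCast_lt_top n

/-- A Poisson process is the sum of its restriction to `B` and its restriction to the complement,
which are independent. -/
theorem IsPoissonLaw.eq_map_add_restrict {Q : Measure (CountingMeasure X)} [IsProbabilityMeasure Q]
    {μ : Measure X} (hQ : IsPoissonLaw Q μ) {B : Set X} (hB : MeasurableSet B)
    [IsFiniteMeasure (μ.restrict B)] :
    ((poissonExp (μ.restrict B) 1).prod Q).map (fun p => p.1 + p.2.restrict Bᶜ) = Q := by
  have hE := isProbabilityMeasure_poissonExp (μ.restrict B) zero_le_one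
  have hadd : Measurable fun p : CountingMeasure X × CountingMeasure X => p.1 + p.2.restrict Bᶜ :=
    measurable_fst.add ((measurable_restrict hB.compl).comp measurable_snd)
  have := Measure.isProbabilityMeasure_map (μ := (poissonExp (μ.restrict B) 1).prod Q)
    hadd.aemeasurable
  refine ext_of_cellCounts fun n c hc => ?_
  have hcell : ∀ i, MeasurableSet (c ⁻¹' {i}) := fun i => hc (measurableSet_singleton i)
  have hcd : ∀ i j, i ≠ j → Disjoint (c ⁻¹' {i}) (c ⁻¹' {j}) := fun i j hij =>
    Disjoint.preimage c (Set.disjoint_singleton.2 hij)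
  have := fun A => isProbabilityMeasure_poissonLaw (μ A)
  -- Each cell is cut along B. Both laws of cell counts are then images under addition of the same
  -- product of independent Poisson vectors.
  let A : Fin n ⊕ Fin n → Set X :=
    Sum.elim (fun i => c ⁻¹' {i} ∩ B) fun i => c ⁻¹' {i} ∩ Bᶜ
  have hA : ∀ i, MeasurableSet (A i) := by
    rintro (i | i)
    exacts [(hcell i).inter hB, (hcell i).inter hB.compl]
  have hAd : ∀ i j, i ≠ j → Disjoint (A i) (A j) := by
    have hBB : ∀ i j, Disjoint (c ⁻¹' {i} ∩ B) (c ⁻¹' {j} ∩ Bᶜ) := fun i j =>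
      disjoint_compl_right.mono Set.inter_subset_right Set.inter_subset_right
    rintro (i | i) (j | j) hij
    · exact (hcd i j fun h => hij (h ▸ rfl)).mono Set.inter_subset_left Set.inter_subset_left
    · exact hBB i j
    · exact (hBB j i).symm
    · exact (hcd i j fun h => hij (h ▸ rfl)).mono Set.inter_subset_left Set.inter_subset_left
  have hlaw := hQ _ inferInstance A hA hAd
  have hpres := measurePreserving_sumPiEquivProdPi (X := fun _ : Fin n ⊕ Fin n => ℝ≥0∞)
    fun i => poissonLaw (μ (A i))
  let v : CountingMeasure X → Fin n → ℝ≥0∞ := fun ξ i => ξ.1 (c ⁻¹' {i} ∩ Bᶜ)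
  have hv : Measurable v := measurable_pi_lambda _ fun i =>
    measurable_apply ((hcell i).inter hB.compl)
  have hv_law : Q.map v = Measure.pi fun i => poissonLaw (μ (c ⁻¹' {i} ∩ Bᶜ)) :=
    hQ _ inferInstance _ (fun i => (hcell i).inter hB.compl) fun i j hij =>
      (hcd i j hij).mono Set.inter_subset_left Set.inter_subset_left
  have hu_law := map_cellCounts_poissonExp (μ.restrict B) hc
  simp only [Measure.restrict_apply (hcell _)] at hu_law
  have hcc := measurable_cellCounts hc
  have hsum : Measurable fun p : (Fin n → ℝ≥0∞) × (Fin n → ℝ≥0∞) => p.1 + p.2 :=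
    measurable_fst.add measurable_snd
  have hL : (((poissonExp (μ.restrict B) 1).prod Q).map
      (fun p => p.1 + p.2.restrict Bᶜ)).map (cellCounts c) =
      ((Measure.pi fun i => poissonLaw (μ (c ⁻¹' {i} ∩ B))).prod
        (Measure.pi fun i => poissonLaw (μ (c ⁻¹' {i} ∩ Bᶜ)))).map fun p => p.1 + p.2 := by
    rw [← hu_law, ← hv_law, Measure.map_prod_map _ _ hcc hv, Measure.map_map hcc hadd,
      Measure.map_map hsum (hcc.prodMap hv)]
    congr 1
    ext p i
    simp only [Function.comp_apply, cellCounts, val_add, Measure.add_apply, Prod.map, Pi.add_apply,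
      restrict_apply _ hB.compl (hcell _), v]
  have hR : Q.map (cellCounts c) =
      ((Measure.pi fun i => poissonLaw (μ (c ⁻¹' {i} ∩ B))).prod
        (Measure.pi fun i => poissonLaw (μ (c ⁻¹' {i} ∩ Bᶜ)))).map fun p => p.1 + p.2 := by
    have h1 := hpres.map_eq
    simp only [A, Sum.elim_inl, Sum.elim_inr] at h1
    rw [← h1]
    have h2 : (Measure.pi fun i => poissonLaw (μ (Sum.elim (fun i => c ⁻¹' {i} ∩ B)
        (fun i => c ⁻¹' {i} ∩ Bᶜ) i))) = Q.map fun ξ i => ξ.1 (A i) := hlaw.symm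
    rw [h2, Measure.map_map hpres.measurable
      (measurable_pi_lambda _ fun i => measurable_apply (hA i)),
      Measure.map_map hsum (hpres.measurable.comp
        (measurable_pi_lambda _ fun i => measurable_apply (hA i)))]
    congr 1
    ext ξ i
    exact (measure_inter_add_sdiff (c ⁻¹' {i}) hB).symm
  rw [hL, hR]

end CountingMeasure

/-! ### The Mecke formula and the Φ-Sobolev inequality for σ-finite intensity -/

namespace CountingMeasure

variable {X : Type*} [MeasurableSpace X]

theorem ae_poissonExp_apply_lt_top (μ : Measure X) [IsFiniteMeasure μ] (t : ℝ) (C : Set X) :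
    ∀ᵐ ξ ∂(poissonExp μ t), ξ.1 C < ∞ := by
  rw [poissonExp, Measure.ae_sum_iff]
  exact fun n => Measure.ae_smul_measure (ae_pointPower_apply_lt_top μ n C) _

variable {Q : Measure (CountingMeasure X)} [IsProbabilityMeasure Q] {μ : Measure X}

section Decomposition

theorem measurable_add_restrict_compl {B : Set X} (hB : MeasurableSet B) :
    Measurable fun p : CountingMeasure X × CountingMeasure X => p.1 + p.2.restrict Bᶜ :=
  measurable_fst.add ((measurable_restrict hB.compl).comp measurable_snd)

theorem IsPoissonLaw.lintegral_eq (hQ : IsPoissonLaw Q μ) {B : Set X} (hB : MeasurableSet B)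
    [IsFiniteMeasure (μ.restrict B)] {h : CountingMeasure X → ℝ≥0∞} (hh : Measurable h) :
    ∫⁻ ξ, h ξ ∂Q = ∫⁻ ζ, ∫⁻ ξ, h (ξ + ζ.restrict Bᶜ) ∂(poissonExp (μ.restrict B) 1) ∂Q := by
  have := isProbabilityMeasure_poissonExp (μ.restrict B) zero_le_one
  have hm : Measurable fun p : CountingMeasure X × CountingMeasure X => h (p.1 + p.2.restrict Bᶜ) :=
    hh.comp (measurable_add_restrict_compl hB)
  conv_lhs => rw [← hQ.eq_map_add_restrict hB,
    lintegral_map hh (measurable_add_restrict_compl hB)]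
  exact lintegral_prod_symm' _ hm

theorem IsPoissonLaw.lintegral_eq' (hQ : IsPoissonLaw Q μ) {B : Set X} (hB : MeasurableSet B)
    [IsFiniteMeasure (μ.restrict B)] {h : CountingMeasure X → ℝ≥0∞} (hh : Measurable h) :
    ∫⁻ ξ, h ξ ∂Q = ∫⁻ ξ, ∫⁻ ζ, h (ξ + ζ.restrict Bᶜ) ∂Q ∂(poissonExp (μ.restrict B) 1) := by
  have := isProbabilityMeasure_poissonExp (μ.restrict B) zero_le_one
  have hm : Measurable fun p : CountingMeasure X × CountingMeasure X => h (p.1 + p.2.restrict Bᶜ) :=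
    hh.comp (measurable_add_restrict_compl hB)
  conv_lhs => rw [← hQ.eq_map_add_restrict hB,
    lintegral_map hh (measurable_add_restrict_compl hB)]
  exact lintegral_prod _ hm.aemeasurable

theorem setLIntegral_dirac_mul {C : Set X} (hC : MeasurableSet C) (F : X → ℝ≥0∞) :
    ∫⁻ x in C, Measure.dirac x C * F x ∂μ = ∫⁻ x in C, F x ∂μ := by
  refine setLIntegral_congr_fun hC fun x hx => ?_
  simp [Measure.dirac_apply' _ hC, hx]

/-- With the configuration outside C held fixed, the part inside C is a finite Poisson process. The
outer points contribute nothing to the removals in C, so the finite Mecke formula applies to the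
translated kernel. -/
theorem IsPoissonLaw.lintegral_removeSum (hQ : IsPoissonLaw Q μ) {C : Set X}
    (hC : MeasurableSet C) [IsFiniteMeasure (μ.restrict C)]
    {K : CountingMeasure X × CountingMeasure X → ℝ≥0∞} (hK : Measurable K) :
    ∫⁻ ξ, removeSum C (fun θ => K (ξ, θ)) ξ ∂Q =
      ∫⁻ ξ, ∫⁻ x in C, K (ξ + single x, ξ) ∂μ ∂Q := by
  have hμC : μ C ≠ ∞ := by
    rw [← Measure.restrict_apply_univ]; exact measure_ne_top _ _
  obtain ⟨S, hS, hSe⟩ := exists_measurable_eq_removeSum hC hK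
  have hSd : Measurable fun ξ => S (ξ, ξ) := by fun_prop
  have h1 : ∫⁻ ξ, removeSum C (fun θ => K (ξ, θ)) ξ ∂Q = ∫⁻ ξ, S (ξ, ξ) ∂Q := by
    refine lintegral_congr_ae ?_
    filter_upwards [hQ.ae_apply_lt_top hC hμC] with ξ hξ
    exact (hSe ξ ξ hξ).symm
  have hh : Measurable fun ξ : CountingMeasure X => ∫⁻ x in C, K (ξ + single x, ξ) ∂μ :=
    Measurable.lintegral_prod_right' (f := fun p : CountingMeasure X × X =>
      K (p.1 + single p.2, p.1)) (by fun_prop)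
  rw [h1, hQ.lintegral_eq hC hSd, hQ.lintegral_eq hC hh]
  refine lintegral_congr fun ζ => ?_
  have hζ : (ζ.restrict Cᶜ).1 C = 0 := by
    rw [restrict_apply _ hC.compl hC, Set.inter_compl_self, measure_empty]
  have h2 : ∫⁻ ξ, S (ξ + ζ.restrict Cᶜ, ξ + ζ.restrict Cᶜ) ∂(poissonExp (μ.restrict C) 1) =
      ∫⁻ ξ, removeSum C (fun θ => K (ξ + ζ.restrict Cᶜ, θ + ζ.restrict Cᶜ)) ξ
        ∂(poissonExp (μ.restrict C) 1) := by
    refine lintegral_congr_ae ?_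
    filter_upwards [ae_poissonExp_apply_lt_top (μ.restrict C) 1 C] with ξ hξ
    rw [hSe, removeSum_add, removeSum_eq_zero hC _ hζ, add_zero]
    rwa [val_add, Measure.add_apply, hζ, add_zero]
  rw [h2, lintegral_removeSum_poissonExp (μ.restrict C) hC
    (K := fun p => K (p.1 + ζ.restrict Cᶜ, p.2 + ζ.restrict Cᶜ)) (by fun_prop)]
  refine lintegral_congr fun ξ => ?_
  rw [setLIntegral_dirac_mul hC]
  simp only [add_right_comm _ (single _)]

end Decomposition

section Points

theorem integral_eq_tsum_removeSum (g : CountingMeasure X → ℝ≥0∞) (ξ : CountingMeasure X)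
    {C : ℕ → Set X} (hC : ∀ n, MeasurableSet (C n)) (hd : Pairwise (Function.onFun Disjoint C))
    (hU : ⋃ n, C n = Set.univ) :
    ξ.integral (fun x => g (ξ.removePoint x)) = ∑' n, removeSum (C n) g ξ := by
  simp only [removeSum_eq, integral]
  rw [ENNReal.tsum_comm]
  refine tsum_congr fun i => ?_
  rw [ENNReal.tsum_mul_right, ← measure_iUnion hd hC, hU, measure_univ, one_mul]

variable [SigmaFinite μ]

/-- A countable measurable partition into sets of finite measure. -/
def finitePartition (μ : Measure X) [SigmaFinite μ] : ℕ → Set X := disjointed (spanningSets μ)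

theorem measurableSet_finitePartition (n : ℕ) : MeasurableSet (finitePartition μ n) :=
  MeasurableSet.disjointed (measurableSet_spanningSets μ) n

theorem disjoint_finitePartition : Pairwise (Function.onFun Disjoint (finitePartition μ)) :=
  disjoint_disjointed _

theorem iUnion_finitePartition : ⋃ n, finitePartition μ n = Set.univ := by
  rw [finitePartition, iUnion_disjointed, iUnion_spanningSets]

theorem measure_finitePartition_lt_top (n : ℕ) : μ (finitePartition μ n) < ∞ :=
  (measure_mono (disjointed_subset _ n)).trans_lt (measure_spanningSets_lt_top μ n)

instance isFiniteMeasure_restrict_finitePartition (n : ℕ) :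
    IsFiniteMeasure (μ.restrict (finitePartition μ n)) :=
  ⟨by rw [Measure.restrict_apply_univ]; exact measure_finitePartition_lt_top n⟩

theorem IsPoissonLaw.aemeasurable_removeSum {Q : Measure (CountingMeasure X)}
    (hQ : IsPoissonLaw Q μ)
    {K : CountingMeasure X × CountingMeasure X → ℝ≥0∞} (hK : Measurable K) (n : ℕ) :
    AEMeasurable (fun ξ => removeSum (finitePartition μ n) (fun θ => K (ξ, θ)) ξ) Q := by
  obtain ⟨S, hS, hSe⟩ := exists_measurable_eq_removeSum
    (measurableSet_finitePartition (μ := μ) n) hK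
  refine ⟨fun ξ => S (ξ, ξ), by fun_prop, ?_⟩
  filter_upwards [hQ.ae_apply_lt_top (measurableSet_finitePartition n)
    (measure_finitePartition_lt_top n).ne] with ξ hξ
  exact (hSe ξ ξ hξ).symm

theorem IsPoissonLaw.aemeasurable_integral {Q : Measure (CountingMeasure X)}
    (hQ : IsPoissonLaw Q μ)
    {K : CountingMeasure X × CountingMeasure X → ℝ≥0∞} (hK : Measurable K) :
    AEMeasurable (fun ξ => ξ.integral fun x => K (ξ, ξ.removePoint x)) Q := by
  have e : ∀ ξ : CountingMeasure X, ξ.integral (fun x => K (ξ, ξ.removePoint x)) =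
      ∑' n, removeSum (finitePartition μ n) (fun θ => K (ξ, θ)) ξ := fun ξ =>
    integral_eq_tsum_removeSum (fun θ => K (ξ, θ)) ξ (measurableSet_finitePartition (μ := μ))
      disjoint_finitePartition iUnion_finitePartition
  simp only [e]
  exact AEMeasurable.tsum fun n => hQ.aemeasurable_removeSum hK n

/-- **Mecke formula** for the points of a Poisson process. -/
theorem IsPoissonLaw.lintegral_integral (hQ : IsPoissonLaw Q μ)
    {K : CountingMeasure X × CountingMeasure X → ℝ≥0∞} (hK : Measurable K) :
    ∫⁻ ξ, ξ.integral (fun x => K (ξ, ξ.removePoint x)) ∂Q =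
      ∫⁻ ξ, ∫⁻ x, K (ξ + single x, ξ) ∂μ ∂Q := by
  have e : ∀ ξ : CountingMeasure X, ξ.integral (fun x => K (ξ, ξ.removePoint x)) =
      ∑' n, removeSum (finitePartition μ n) (fun θ => K (ξ, θ)) ξ := fun ξ =>
    integral_eq_tsum_removeSum (fun θ => K (ξ, θ)) ξ (measurableSet_finitePartition (μ := μ))
      disjoint_finitePartition iUnion_finitePartition
  simp only [e]
  have hm : ∀ n, Measurable fun ξ : CountingMeasure X =>
      ∫⁻ x in finitePartition μ n, K (ξ + single x, ξ) ∂μ := fun n =>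
    Measurable.lintegral_prod_right' (f := fun p : CountingMeasure X × X =>
      K (p.1 + single p.2, p.1)) (by fun_prop)
  rw [lintegral_tsum fun n => hQ.aemeasurable_removeSum hK n]
  simp only [hQ.lintegral_removeSum (measurableSet_finitePartition _) hK]
  rw [← lintegral_tsum fun n => (hm n).aemeasurable]
  refine lintegral_congr fun ξ => ?_
  rw [← lintegral_iUnion measurableSet_finitePartition disjoint_finitePartition,
    iUnion_finitePartition, Measure.restrict_univ]

end Points

section Entropy

/-- Subadditivity over the independent parts inside and outside B. The inner entropy obeys the
finite-intensity inequality. The outer one is compared with the reference value g(ξ restricted to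
B), constant in the outer part, and D_a is bounded by a multiple of the distance. -/
theorem IsPoissonLaw.ofReal_powEntropy_le_add (hQ : IsPoissonLaw Q μ) {a C : ℝ} (ha : 1 < a)
    (ha2 : a ≤ 2) {G : CountingMeasure X → ℝ} (hG : Measurable G) (hb : ∀ ξ, G ξ ∈ Set.Icc 0 C)
    {B : Set X} (hB : MeasurableSet B) [IsFiniteMeasure (μ.restrict B)]
    {g : CountingMeasure X → ℝ} (hg : Measurable g) (hgb : ∀ ξ, g ξ ∈ Set.Icc 0 C) :
    ENNReal.ofReal (powEntropy a Q G) ≤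
      ∫⁻ ξ, ∫⁻ x, ENNReal.ofReal (powBregman a (G ξ) (G (ξ + single x))) ∂μ ∂Q +
      ENNReal.ofReal (a * C ^ (a - 1)) * ∫⁻ ξ, ‖G ξ - g (ξ.restrict B)‖ₑ ∂Q := by
  have hE := isProbabilityMeasure_poissonExp (μ.restrict B) zero_le_one
  set E := poissonExp (μ.restrict B) 1 with hEdef
  have hadd := measurable_add_restrict_compl hB
  set Z : CountingMeasure X × CountingMeasure X → ℝ := fun p => G (p.1 + p.2.restrict Bᶜ) with hZ
  have hZm : Measurable Z := hG.comp hadd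
  have hC : 0 ≤ C := (hb 0).1.trans (hb 0).2
  have hK : 0 ≤ a * C ^ (a - 1) := mul_nonneg (by linarith) (Real.rpow_nonneg hC _)
  have e0 : powEntropy a Q G = powEntropy a (E.prod Q) Z := by
    conv_lhs => rw [← hQ.eq_map_add_restrict hB, powEntropy_map a hadd hG]
  have h0 := powEntropy_prod_le E Q ha ha2 hZm fun p => hb _
  have hm1 : Measurable fun ξ => powEntropy a Q fun ζ => Z (ξ, ζ) :=
    measurable_powEntropy_prodMk hZm
  have hm2 : Measurable fun ζ => powEntropy a E fun ξ => Z (ξ, ζ) :=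
    measurable_powEntropy_prodMk (hZm.comp measurable_swap)
  have hb1 : ∀ ξ, (powEntropy a Q fun ζ => Z (ξ, ζ)) ∈ Set.Icc 0 (C ^ a) := fun ξ =>
    powEntropy_mem_Icc ha (hZm.comp measurable_prodMk_left) fun ζ => hb _
  have hb2 : ∀ ζ, (powEntropy a E fun ξ => Z (ξ, ζ)) ∈ Set.Icc 0 (C ^ a) := fun ζ =>
    powEntropy_mem_Icc ha (hZm.comp measurable_prodMk_right) fun ξ => hb _
  have hdiff : Measurable fun ξ : CountingMeasure X => ‖G ξ - g (ξ.restrict B)‖ₑ :=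
    (hG.sub (hg.comp (measurable_restrict hB))).enorm
  have first : ENNReal.ofReal (∫ ξ, powEntropy a Q (fun ζ => Z (ξ, ζ)) ∂E) ≤
      ENNReal.ofReal (a * C ^ (a - 1)) * ∫⁻ ξ, ‖G ξ - g (ξ.restrict B)‖ₑ ∂Q := by
    rw [ofReal_integral_eq_lintegral_ofReal (integrable_of_mem_Icc hm1 hb1)
      (Eventually.of_forall fun ξ => (hb1 ξ).1), hQ.lintegral_eq' hB hdiff,
      ← lintegral_const_mul' _ _ ENNReal.ofReal_ne_top]
    refine lintegral_mono fun ξ => ?_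
    have hres : ∀ ζ : CountingMeasure X, (ξ + ζ.restrict Bᶜ).restrict B = ξ.restrict B := fun ζ => by
      refine Subtype.ext ?_
      rw [val_restrict _ hB, val_restrict _ hB, val_add, val_restrict _ hB.compl,
        Measure.restrict_add, Measure.restrict_restrict hB, Set.inter_compl_self,
        Measure.restrict_empty, add_zero]
    simp only [hres]
    set c := g (ξ.restrict B) with hc
    have hcb : c ∈ Set.Icc 0 C := hgb _
    have hZξ : Measurable fun ζ : CountingMeasure X => Z (ξ, ζ) := hZm.comp measurable_prodMk_left
    have hZb : ∀ ζ : CountingMeasure X, Z (ξ, ζ) ∈ Set.Icc 0 C := fun ζ => hb _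
    have hBm : Measurable fun ζ : CountingMeasure X => powBregman a c (Z (ξ, ζ)) :=
      measurable_powBregman a measurable_const hZξ
    refine (ENNReal.ofReal_le_ofReal
      (powEntropy_le_integral_powBregman (P := Q) ha hcb.1 hZξ hZb)).trans ?_
    rw [ofReal_integral_eq_lintegral_ofReal
      (integrable_of_mem_Icc hBm fun ζ => powBregman_mem_Icc ha hcb (hZb ζ))
      (Eventually.of_forall fun ζ => powBregman_nonneg ha hcb.1 (hZb ζ).1),
      ← lintegral_const_mul' _ _ ENNReal.ofReal_ne_top]
    refine lintegral_mono fun ζ => ?_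
    rw [Real.enorm_eq_ofReal_abs, ← ENNReal.ofReal_mul hK]
    exact ENNReal.ofReal_le_ofReal (powBregman_le_abs ha hcb (hZb ζ))
  have second : ENNReal.ofReal (∫ ζ, powEntropy a E (fun ξ => Z (ξ, ζ)) ∂Q) ≤
      ∫⁻ ξ, ∫⁻ x, ENNReal.ofReal (powBregman a (G ξ) (G (ξ + single x))) ∂μ ∂Q := by
    rw [ofReal_integral_eq_lintegral_ofReal (integrable_of_mem_Icc hm2 hb2)
      (Eventually.of_forall fun ζ => (hb2 ζ).1)]
    have hJ : Measurable fun ξ : CountingMeasure X =>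
        ∫⁻ x in B, ENNReal.ofReal (powBregman a (G ξ) (G (ξ + single x))) ∂μ :=
      (measurable_powBregman_single hG).lintegral_prod_right'
    calc ∫⁻ ζ, ENNReal.ofReal (powEntropy a E fun ξ => Z (ξ, ζ)) ∂Q ≤
        ∫⁻ ζ, ∫⁻ ξ, ∫⁻ x in B, ENNReal.ofReal (powBregman a (G (ξ + ζ.restrict Bᶜ))
          (G (ξ + ζ.restrict Bᶜ + single x))) ∂μ ∂E ∂Q := by
          refine lintegral_mono fun ζ => ?_
          have := ofReal_powEntropy_poissonExp_le (μ.restrict B) ha ha2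
            (G := fun ξ => Z (ξ, ζ)) (hZm.comp measurable_prodMk_right) fun ξ => hb _
          simpa only [hZ, add_right_comm _ (single _)] using this
      _ = ∫⁻ ξ, ∫⁻ x in B, ENNReal.ofReal (powBregman a (G ξ) (G (ξ + single x))) ∂μ ∂Q :=
          (hQ.lintegral_eq hB hJ).symm
      _ ≤ _ := lintegral_mono fun ξ => setLIntegral_le_lintegral _ _
  rw [e0]
  refine (ENNReal.ofReal_le_ofReal h0).trans ?_
  rw [add_comm (∫ ξ, _ ∂E)]
  exact ENNReal.ofReal_add_le.trans (add_le_add second first)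

variable [SigmaFinite μ]

instance isFiniteMeasure_restrict_spanningSets (n : ℕ) :
    IsFiniteMeasure (μ.restrict (spanningSets μ n)) :=
  ⟨by rw [Measure.restrict_apply_univ]; exact measure_spanningSets_lt_top μ n⟩

/-- The filtration generated by the restrictions to an increasing sequence of sets. -/
noncomputable def restrictFiltration (μ : Measure X) [SigmaFinite μ] :
    Filtration ℕ (inferInstance : MeasurableSpace (CountingMeasure X)) where
  seq n := MeasurableSpace.comap (fun ξ => ξ.restrict (spanningSets μ n)) inferInstance
  mono' := by
    intro m n hmn
    have h : (fun ξ : CountingMeasure X => ξ.restrict (spanningSets μ m)) =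
        (fun ξ => ξ.restrict (spanningSets μ m)) ∘ fun ξ => ξ.restrict (spanningSets μ n) := by
      ext ξ : 2
      simp only [Function.comp_apply]
      rw [val_restrict _ (measurableSet_spanningSets μ m),
        val_restrict _ (measurableSet_spanningSets μ m),
        val_restrict _ (measurableSet_spanningSets μ n),
        Measure.restrict_restrict_of_subset (monotone_spanningSets μ hmn)]
    change MeasurableSpace.comap _ _ ≤ MeasurableSpace.comap _ _
    rw [h, ← MeasurableSpace.comap_comp]
    exact MeasurableSpace.comap_mono
      (measurable_restrict (measurableSet_spanningSets μ m)).comap_le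
  le' n := (measurable_restrict (measurableSet_spanningSets μ n)).comap_le

theorem measurable_of_restrict {α : Type*} [MeasurableSpace α] {g : α → CountingMeasure X}
    (h : ∀ n, Measurable fun a => (g a).restrict (spanningSets μ n)) : Measurable g := by
  refine measurable_of_apply fun B hB => ?_
  have e : (fun a => (g a).1 B) = fun a => ⨆ n, ((g a).restrict (spanningSets μ n)).1 B := by
    ext a
    simp only [restrict_apply _ (measurableSet_spanningSets μ _) hB]
    rw [← Monotone.measure_iUnion fun m n hmn =>
      Set.inter_subset_inter_right _ (monotone_spanningSets μ hmn), ← Set.inter_iUnion,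
      iUnion_spanningSets, Set.inter_univ]
  rw [e]
  exact Measurable.iSup fun n => (measurable_apply hB).comp (h n)

theorem iSup_restrictFiltration :
    ⨆ n, restrictFiltration μ n = (inferInstance : MeasurableSpace (CountingMeasure X)) := by
  refine le_antisymm (iSup_le fun n => (restrictFiltration μ).le n) ?_
  have h : @Measurable _ _ (⨆ n, (restrictFiltration μ) n) _
      (id : CountingMeasure X → CountingMeasure X) := by
    refine @measurable_of_restrict X _ μ _ _ (⨆ n, (restrictFiltration μ) n) id fun n => ?_
    refine Measurable.mono (comap_measurable _) ?_ le_rfl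
    exact le_iSup (fun n => (restrictFiltration μ) n) n
  exact fun s hs => h hs

/-- A bounded functional is approximated by functionals of the points in bounded regions. -/
theorem exists_restrict_approx {C : ℝ} {G : CountingMeasure X → ℝ} (hG : Measurable G)
    (hb : ∀ ξ, G ξ ∈ Set.Icc 0 C) (Q : Measure (CountingMeasure X)) [IsProbabilityMeasure Q] :
    ∃ g : ℕ → CountingMeasure X → ℝ, (∀ n, Measurable (g n)) ∧ (∀ n ξ, g n ξ ∈ Set.Icc 0 C) ∧
      Tendsto (fun n => ∫⁻ ξ, ‖G ξ - g n (ξ.restrict (spanningSets μ n))‖ₑ ∂Q) atTop (𝓝 0) := by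
  have hC : 0 ≤ C := (hb 0).1.trans (hb 0).2
  have hlevy := tendsto_eLpNorm_condExp (ℱ := restrictFiltration μ) (μ := Q) G
  have hfac : ∀ n, ∃ g : CountingMeasure X → ℝ, Measurable g ∧
      Q[G | restrictFiltration μ n] = g ∘ fun ξ => ξ.restrict (spanningSets μ n) := by
    intro n
    have hsm : StronglyMeasurable[restrictFiltration μ n] (Q[G | restrictFiltration μ n]) :=
      stronglyMeasurable_condExp
    exact hsm.measurable.exists_eq_measurable_comp
  choose g hgm hge using hfac
  -- The factors of the conditional expectations carry no pointwise bounds. Clamping to [0, C]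
  -- supplies them and cannot increase the distance to G, which already lies there.
  refine ⟨fun n ξ => min C (max 0 (g n ξ)), fun n => by fun_prop, fun n ξ =>
    ⟨le_min hC (le_max_left _ _), min_le_left _ _⟩, ?_⟩
  have hG' : Q[G | ⨆ n, restrictFiltration μ n] = G := by
    have hint : Integrable G Q := integrable_of_mem_Icc hG hb
    rw [iSup_restrictFiltration]
    exact condExp_of_stronglyMeasurable le_rfl hG.stronglyMeasurable hint
  rw [hG'] at hlevy
  refine tendsto_of_tendsto_of_tendsto_of_le_of_le tendsto_const_nhds hlevy (fun n => zero_le)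
    fun n => ?_
  rw [eLpNorm_one_eq_lintegral_enorm]
  refine lintegral_mono fun ξ => ?_
  rw [hge, Pi.sub_apply, Function.comp_apply, Real.enorm_eq_ofReal_abs, Real.enorm_eq_ofReal_abs]
  refine ENNReal.ofReal_le_ofReal ?_
  have h1 := (hb ξ).1
  have h2 := (hb ξ).2
  set y := g n (ξ.restrict (spanningSets μ n))
  have h3 : min C (max 0 (G ξ)) = G ξ := by rw [max_eq_right h1, min_eq_right h2]
  rw [abs_sub_comm y]
  conv_lhs => rw [← h3]
  refine (abs_min_sub_min_le_max _ _ _ _).trans ?_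
  rw [sub_self, abs_zero, max_eq_right (abs_nonneg _)]
  refine (abs_max_sub_max_le_max _ _ _ _).trans ?_
  rw [sub_self, abs_zero, max_eq_right (abs_nonneg _)]

/-- The modified `Φ`-Sobolev inequality for `Φ x = x ^ a` and Poisson processes. -/
theorem IsPoissonLaw.ofReal_powEntropy_le (hQ : IsPoissonLaw Q μ) {a C : ℝ} (ha : 1 < a)
    (ha2 : a ≤ 2) {G : CountingMeasure X → ℝ} (hG : Measurable G)
    (hb : ∀ ξ, G ξ ∈ Set.Icc 0 C) :
    ENNReal.ofReal (powEntropy a Q G) ≤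
      ∫⁻ ξ, ∫⁻ x, ENNReal.ofReal (powBregman a (G ξ) (G (ξ + single x))) ∂μ ∂Q := by
  obtain ⟨g, hgm, hgb, hlim⟩ := exists_restrict_approx (μ := μ) hG hb Q
  have h := fun n => hQ.ofReal_powEntropy_le_add ha ha2 hG hb (measurableSet_spanningSets μ n)
    (hgm n) (hgb n)
  have ht := (ENNReal.Tendsto.const_mul (a := ENNReal.ofReal (a * C ^ (a - 1))) hlim
    (Or.inr ENNReal.ofReal_ne_top)).const_add
    (∫⁻ ξ, ∫⁻ x, ENNReal.ofReal (powBregman a (G ξ) (G (ξ + single x))) ∂μ ∂Q)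
  rw [mul_zero, add_zero] at ht
  exact ge_of_tendsto' ht h

end Entropy

end CountingMeasure

/-! ### The role of κ -/

section Constant

theorem kappa_eq : kappa = Real.exp (1 / 2) / (2 * (Real.exp (1 / 2) - 1)) := by
  have : Real.sqrt (Real.exp 1) = Real.exp (1 / 2) := by
    rw [Real.sqrt_eq_iff_mul_self_eq (Real.exp_pos _).le (Real.exp_pos _).le, ← Real.exp_add]
    norm_num
  rw [kappa, this]

theorem one_le_kappa : 1 ≤ kappa := by
  have h1 : 1 < Real.exp (1 / 2) := by rw [Real.one_lt_exp_iff]; norm_num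
  have h2 : Real.exp (1 / 2) * Real.exp (1 / 2) = Real.exp 1 := by rw [← Real.exp_add]; norm_num
  have h3 := Real.exp_one_lt_d9
  rw [kappa_eq, le_div_iff₀ (by linarith)]
  nlinarith

theorem inv_two_mul_kappa : (2 * kappa)⁻¹ = 1 - Real.exp (-(1 / 2)) := by
  have h1 : 1 < Real.exp (1 / 2) := by rw [Real.one_lt_exp_iff]; norm_num
  have h2 : Real.exp (1 / 2) - 1 ≠ 0 := by linarith
  rw [kappa_eq, Real.exp_neg]
  field_simp

theorem one_sub_inv_rpow_le {q : ℝ} (hq : 1 ≤ q) :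
    (1 - 1 / q) ^ (q / 2) ≤ Real.exp (-(1 / 2)) := by
  have hq0 : 0 < q := by linarith
  have h1 : 1 / q ≤ 1 := by rw [div_le_one hq0]; exact hq
  calc (1 - 1 / q) ^ (q / 2) ≤ Real.exp (-(1 / q)) ^ (q / 2) :=
        Real.rpow_le_rpow (by linarith) (Real.one_sub_le_exp_neg _) (by linarith)
    _ = Real.exp (-(1 / 2)) := by
        rw [← Real.exp_mul]; congr 1; field_simp

/-- If A exceeded T^(q/2), then T A^((q-2)/q) < A, and the right side of `h` would be less than
e^(-1/2) A + (1 - e^(-1/2)) A = A. -/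
theorem le_rpow_of_le_add {q A T : ℝ} (hq : 2 ≤ q) (hT : 0 ≤ T)
    (h : A ≤ (1 - 1 / q) ^ (q / 2) * T ^ (q / 2) + T / (2 * kappa) * A ^ ((q - 2) / q)) :
    A ≤ T ^ (q / 2) := by
  by_contra! hlt
  have hq0 : 0 < q := by linarith
  have hTq := Real.rpow_nonneg hT (q / 2)
  have hA0 : 0 < A := hTq.trans_lt hlt
  have h1 : T < A ^ (2 / q) := by
    have := Real.rpow_lt_rpow hTq hlt (z := 2 / q) (by positivity)
    rwa [← Real.rpow_mul hT, show q / 2 * (2 / q) = 1 by field_simp, Real.rpow_one] at this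
  have h2 : T * A ^ ((q - 2) / q) < A := by
    calc T * A ^ ((q - 2) / q) < A ^ (2 / q) * A ^ ((q - 2) / q) :=
          mul_lt_mul_of_pos_right h1 (Real.rpow_pos_of_pos hA0 _)
      _ = A := by
          rw [← Real.rpow_add hA0, show 2 / q + (q - 2) / q = 1 by field_simp; ring, Real.rpow_one]
  have h3 := one_sub_inv_rpow_le (q := q) (by linarith)
  have h4 : Real.exp (-(1 / 2)) < 1 := by rw [Real.exp_lt_one_iff]; norm_num
  have h5 := Real.exp_pos (-(1 / 2))
  rw [div_eq_mul_inv T, inv_two_mul_kappa] at h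
  have h6 : (1 - 1 / q) ^ (q / 2) * T ^ (q / 2) ≤ Real.exp (-(1 / 2)) * A := by
    refine (mul_le_mul_of_nonneg_right h3 hTq).trans ?_
    gcongr
  nlinarith

end Constant

/-! ### From entropy bounds to moment bounds -/

section Recursion

variable {Ω : Type*} [MeasurableSpace Ω] {P : Measure Ω} [IsProbabilityMeasure P]

theorem integral_rpow_le_rpow_integral {C q r : ℝ} (hq : 0 < q) (hqr : q ≤ r) {Z : Ω → ℝ}
    (hZ : Measurable Z) (hb : ∀ ω, Z ω ∈ Set.Icc 0 C) :
    ∫ ω, Z ω ^ q ∂P ≤ (∫ ω, Z ω ^ r ∂P) ^ (q / r) := by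
  have hr : 0 < r := hq.trans_le hqr
  have h := (convexOn_rpow (p := r / q) (by rw [le_div_iff₀ hq]; linarith)).map_integral_le
    (μ := P) (f := fun ω => Z ω ^ q)
    (Real.continuous_rpow_const (by positivity)).continuousOn isClosed_Ici
    (Eventually.of_forall fun ω => Real.rpow_nonneg (hb ω).1 _)
    (integrable_of_mem_Icc (hZ.pow_const q) fun ω => rpow_mem_Icc hq.le (hb ω))
    (integrable_of_mem_Icc ((hZ.pow_const q).pow_const _) fun ω =>
      rpow_mem_Icc (div_pos hr hq).le (rpow_mem_Icc hq.le (hb ω)))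
  have e : ∀ ω, (Z ω ^ q) ^ (r / q) = Z ω ^ r := fun ω => by
    rw [← Real.rpow_mul (hb ω).1, mul_div_cancel₀ _ hq.ne']
  simp only [e] at h
  have h0 : 0 ≤ ∫ ω, Z ω ^ q ∂P := integral_nonneg fun ω => Real.rpow_nonneg (hb ω).1 _
  have := Real.rpow_le_rpow (Real.rpow_nonneg h0 _) h (z := q / r) (by positivity)
  rwa [← Real.rpow_mul h0, show r / q * (q / r) = 1 by field_simp, Real.rpow_one] at this

/-- Hölder's inequality with exponents q/2 and q/(q-2). At q = 2 the second exponent degenerates,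
but then the weight is 1. -/
theorem lintegral_mul_rpow_le {C q v : ℝ} (hq : 2 ≤ q) {Z : Ω → ℝ} {W : Ω → ℝ≥0∞}
    (hZ : Measurable Z) (hb : ∀ ω, Z ω ∈ Set.Icc 0 C) (hW : AEMeasurable W P) (hv : 0 ≤ v)
    (hWv : eLpNorm W (ENNReal.ofReal (q / 2)) P ≤ ENNReal.ofReal v) :
    ∫⁻ ω, W ω * ENNReal.ofReal (Z ω ^ (q - 2)) ∂P ≤
      ENNReal.ofReal (v * (∫ ω, Z ω ^ q ∂P) ^ ((q - 2) / q)) := by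
  have hq0 : 0 < q := by linarith
  have hWv' : (∫⁻ ω, W ω ^ (q / 2) ∂P) ^ (1 / (q / 2)) ≤ ENNReal.ofReal v := by
    rw [eLpNorm_eq_lintegral_rpow_enorm_toReal (by simp; linarith) ENNReal.ofReal_ne_top,
      ENNReal.toReal_ofReal (by linarith)] at hWv
    simpa using hWv
  rcases hq.eq_or_lt with rfl | hq2
  · simpa using hWv'
  have hconj : (q / 2).HolderConjugate (q / (q - 2)) := by
    rw [Real.holderConjugate_iff]
    refine ⟨by linarith, ?_⟩
    rw [inv_div, inv_div]
    field_simp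
    ring
  have h := ENNReal.lintegral_mul_le_Lp_mul_Lq P hconj hW
    (hZ.pow_const (q - 2)).ennreal_ofReal.aemeasurable
  refine h.trans ?_
  rw [ENNReal.ofReal_mul hv]
  refine mul_le_mul' hWv' (le_of_eq ?_)
  have e : ∀ ω, ENNReal.ofReal (Z ω ^ (q - 2)) ^ (q / (q - 2)) = ENNReal.ofReal (Z ω ^ q) :=
    fun ω => by
      rw [ENNReal.ofReal_rpow_of_nonneg (Real.rpow_nonneg (hb ω).1 _)
        (div_nonneg hq0.le (by linarith)), ← Real.rpow_mul (hb ω).1,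
        mul_div_cancel₀ _ (by linarith : q - 2 ≠ 0)]
  have hi := integrable_of_mem_Icc (P := P) (hZ.pow_const q) fun ω => rpow_mem_Icc hq0.le (hb ω)
  have h0 : ∀ ω, 0 ≤ Z ω ^ q := fun ω => Real.rpow_nonneg (hb ω).1 _
  simp only [e]
  rw [← ofReal_integral_eq_lintegral_ofReal hi (Eventually.of_forall h0), one_div_div,
    ENNReal.ofReal_rpow_of_nonneg (integral_nonneg h0) (div_nonneg (by linarith) hq0.le)]

/-- Moment bounds follow from entropy bounds by induction over the exponent. -/
theorem integral_rpow_le_of_powEntropy_le {C p v : ℝ} {Z : Ω → ℝ} {W : Ω → ℝ≥0∞}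
    (hZ : Measurable Z) (hb : ∀ ω, Z ω ∈ Set.Icc 0 C) (hW : AEMeasurable W P) (hv : 0 ≤ v)
    (hWv : eLpNorm W (ENNReal.ofReal (p / 2)) P ≤ ENNReal.ofReal v)
    (hsq : ENNReal.ofReal (∫ ω, Z ω ^ (2 : ℝ) ∂P) ≤ 2 * ∫⁻ ω, W ω ∂P)
    (hent : ∀ q : ℝ, 2 ≤ q → ENNReal.ofReal (powEntropy (q / (q - 1)) P fun ω => Z ω ^ (q - 1)) ≤
      ENNReal.ofReal q * ∫⁻ ω, W ω * ENNReal.ofReal (Z ω ^ (q - 2)) ∂P) (n : ℕ) :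
    ∀ q : ℝ, 1 ≤ q → q ≤ p → 2 ≤ p → q ≤ n + 2 → ∫ ω, Z ω ^ q ∂P ≤ (2 * kappa * q * v) ^ (q / 2) := by
  have hκ := one_le_kappa
  have hWq : ∀ q : ℝ, q ≤ p → eLpNorm W (ENNReal.ofReal (q / 2)) P ≤ ENNReal.ofReal v := fun q hq =>
    (eLpNorm_le_eLpNorm_of_exponent_le (ENNReal.ofReal_le_ofReal (by linarith))
      hW.aestronglyMeasurable).trans hWv
  have h0 : ∀ (q : ℝ) ω, 0 ≤ Z ω ^ q := fun q ω => Real.rpow_nonneg (hb ω).1 _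
  have hI0 : ∀ q : ℝ, 0 ≤ ∫ ω, Z ω ^ q ∂P := fun q => integral_nonneg (h0 q)
  induction n with
  | zero =>
    -- The start covers all exponents in [1, 2], because the first step, for q in (2, 3], looks back
    -- to q - 1. Here E Z² ≤ 2v and Jensen suffice, as κ q ≥ 1.
    intro q hq1 hqp hp hq2
    rw [Nat.cast_zero, zero_add] at hq2
    have hW1 : ∫⁻ ω, W ω ∂P ≤ ENNReal.ofReal v := by
      have := hWq 2 hp
      rw [eLpNorm_eq_lintegral_rpow_enorm_toReal (by simp) ENNReal.ofReal_ne_top] at this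
      simpa using this
    have h2 : ∫ ω, Z ω ^ (2 : ℝ) ∂P ≤ 2 * v := by
      rw [← ENNReal.ofReal_le_ofReal_iff (by linarith), ENNReal.ofReal_mul zero_le_two,
        ENNReal.ofReal_ofNat]
      exact hsq.trans (mul_le_mul_right hW1 _)
    calc ∫ ω, Z ω ^ q ∂P ≤ (∫ ω, Z ω ^ (2 : ℝ) ∂P) ^ (q / 2) :=
          integral_rpow_le_rpow_integral (by linarith) hq2 hZ hb
      _ ≤ (2 * kappa * q * v) ^ (q / 2) := by
          refine Real.rpow_le_rpow (hI0 2) (h2.trans ?_) (by linarith)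
          refine mul_le_mul_of_nonneg_right ?_ hv
          nlinarith
  | succ n ih =>
    intro q hq1 hqp hp hqn
    rcases le_or_gt q (n + 2) with hle | hlt
    · exact ih q hq1 hqp hp hle
    have hn : (0 : ℝ) ≤ n := Nat.cast_nonneg n
    have hq2 : 2 ≤ q := by linarith
    have hq0 : 0 < q := by linarith
    push_cast at hqn
    have hih := ih (q - 1) (by linarith) (by linarith) hp (by linarith)
    have hT : 0 ≤ 2 * kappa * q * v := by positivity
    refine le_rpow_of_le_add hq2 hT ?_
    have hm := (hent q hq2).trans (mul_le_mul_right (lintegral_mul_rpow_le hq2 hZ hb hW hv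
      (hWq q hqp)) _)
    have hR : 0 ≤ v * (∫ ω, Z ω ^ q ∂P) ^ ((q - 2) / q) :=
      mul_nonneg hv (Real.rpow_nonneg (hI0 q) _)
    rw [← ENNReal.ofReal_mul hq0.le, ENNReal.ofReal_le_ofReal_iff (mul_nonneg hq0.le hR),
      powEntropy] at hm
    have e : ∀ ω, (Z ω ^ (q - 1)) ^ (q / (q - 1)) = Z ω ^ q := fun ω => by
      rw [← Real.rpow_mul (hb ω).1, mul_div_cancel₀ _ (by linarith : q - 1 ≠ 0)]
    simp only [e] at hm
    -- The hypothesis at q - 1, raised to q/(q-1), has exponent q/2 again and base 2κ(q - 1)v = (1 -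
    -- 1/q) · 2κqv.
    have h3 : (∫ ω, Z ω ^ (q - 1) ∂P) ^ (q / (q - 1)) ≤
        (1 - 1 / q) ^ (q / 2) * (2 * kappa * q * v) ^ (q / 2) := by
      have hq1' : 0 < q - 1 := by linarith
      have hinv : 1 / q ≤ 1 := by rw [div_le_one hq0]; exact hq1
      refine (Real.rpow_le_rpow (hI0 _) hih (by positivity)).trans (le_of_eq ?_)
      rw [← Real.rpow_mul (by positivity), ← Real.mul_rpow (by linarith) hT]
      congr 1
      · field_simp
      · field_simp
    have h4 : 2 * kappa * q * v / (2 * kappa) = q * v := by field_simp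
    rw [h4]
    linarith

end Recursion

/-! ### Moment bounds for Poisson functionals -/

namespace CountingMeasure

variable {X : Type*} [MeasurableSpace X]

/-- For a = q/(q-1) one has (q - 1)(a - 1) = 1, so the symmetrized divergence is a (v - u)(v^(q-1) -
u^(q-1)). Convexity of the power q - 1 bounds the second difference by (q - 1) times |v - u| and the
(q-2)-th power of the larger value. The two positive parts record which value is larger. -/
theorem powBregman_rpow_le {q u v : ℝ} (hq : 2 ≤ q) (hu : 0 ≤ u) (hv : 0 ≤ v) :
    powBregman (q / (q - 1)) (u ^ (q - 1)) (v ^ (q - 1)) ≤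
      q * ((max 0 (u - v)) ^ 2 * u ^ (q - 2) + (max 0 (v - u)) ^ 2 * v ^ (q - 2)) := by
  have hq1 : 0 < q - 1 := by linarith
  have ha : 1 < q / (q - 1) := by rw [lt_div_iff₀ hq1]; linarith
  have hexp : (q - 1) * (q / (q - 1) - 1) = 1 := by field_simp; ring
  have hq' : q / (q - 1) * (q - 1) = q := by field_simp
  have key : ∀ x y : ℝ, 0 ≤ x → x ≤ y → y ^ (q - 1) - x ^ (q - 1) ≤ (q - 1) * y ^ (q - 2) * (y - x) := by
    intro x y hx hxy
    rcases hq.eq_or_lt with rfl | hq2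
    · norm_num
    have := powBregman_nonneg (a := q - 1) (x := y) (y := x) (by linarith) (hx.trans hxy) hx
    rw [powBregman, show q - 1 - 1 = q - 2 by ring] at this
    linarith
  refine (powBregman_le ha (Real.rpow_nonneg hu _) (Real.rpow_nonneg hv _)).trans ?_
  rw [← Real.rpow_mul hu, ← Real.rpow_mul hv, hexp, Real.rpow_one, Real.rpow_one]
  have ha0 : 0 ≤ q / (q - 1) := by linarith
  rcases le_total u v with h | h
  · rw [max_eq_left (by linarith : u - v ≤ 0), max_eq_right (by linarith : 0 ≤ v - u)]
    have := mul_le_mul_of_nonneg_left (mul_le_mul_of_nonneg_left (key u v hu h)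
      (sub_nonneg.2 h)) ha0
    calc _ ≤ q / (q - 1) * (q - 1) * ((v - u) ^ 2 * v ^ (q - 2)) := by linarith
      _ = _ := by rw [hq']; ring
  · rw [max_eq_left (by linarith : v - u ≤ 0), max_eq_right (by linarith : 0 ≤ u - v)]
    have := mul_le_mul_of_nonneg_left (mul_le_mul_of_nonneg_left (key v u hv h)
      (sub_nonneg.2 h)) ha0
    calc _ ≤ q / (q - 1) * (q - 1) * ((u - v) ^ 2 * u ^ (q - 2)) := by linarith
      _ = _ := by rw [hq']; ring

theorem VPlus_eq (μ : Measure X) (f : CountingMeasure X → ℝ) (ξ : CountingMeasure X) :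
    VPlus μ f ξ = (∫⁻ x, ENNReal.ofReal ((max 0 (f ξ - f (ξ + single x))) ^ 2) ∂μ) +
      ξ.integral fun x => ENNReal.ofReal ((max 0 (f ξ - f (ξ.removePoint x))) ^ 2) := by
  have h : ∀ a b : ℝ, (min 0 (a - b)) ^ 2 = (max 0 (b - a)) ^ 2 := fun a b => by
    rw [← neg_sub b a, ← neg_zero, min_neg_neg, neg_zero, neg_sq]
  simp only [VPlus, addDiff, removeDiff, addPoint_eq, h]

variable {Q : Measure (CountingMeasure X)} {μ : Measure X} [SigmaFinite μ]

theorem measurable_lintegral_add_single {f : CountingMeasure X → ℝ} (hf : Measurable f)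
    (w : ℝ → ℝ≥0∞) (hw : Measurable w) :
    Measurable fun ξ : CountingMeasure X => ∫⁻ x, w (f ξ - f (ξ + single x)) ∂μ :=
  Measurable.lintegral_prod_right' (f := fun p : CountingMeasure X × X =>
    w (f p.1 - f (p.1 + single p.2))) (by fun_prop)

theorem IsPoissonLaw.aemeasurable_VPlus (hQ : IsPoissonLaw Q μ) {f : CountingMeasure X → ℝ}
    (hf : Measurable f) : AEMeasurable (VPlus μ f) Q := by
  have e : VPlus μ f = fun ξ => (∫⁻ x, ENNReal.ofReal ((max 0 (f ξ - f (ξ + single x))) ^ 2) ∂μ) +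
      ξ.integral fun x => ENNReal.ofReal ((max 0 (f ξ - f (ξ.removePoint x))) ^ 2) :=
    funext fun ξ => VPlus_eq μ f ξ
  rw [e]
  exact (measurable_lintegral_add_single hf (fun t => ENNReal.ofReal ((max 0 t) ^ 2))
    (by fun_prop)).aemeasurable.add (hQ.aemeasurable_integral
      (K := fun p => ENNReal.ofReal ((max 0 (f p.1 - f p.2)) ^ 2)) (by fun_prop))

variable [IsProbabilityMeasure Q]

/-- Where adding x lowers f, the weight sits at ξ and gives the μ-integral of V⁺. Where it raises f,
the weight sits at ξ + δ_x, and the Mecke formula makes it the sum over points of ξ. The shift m is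
arbitrary. -/
theorem IsPoissonLaw.ofReal_powEntropy_rpow_le (hQ : IsPoissonLaw Q μ) {f : CountingMeasure X → ℝ}
    (hf : Measurable f) {m C q : ℝ} (hq : 2 ≤ q) (hC : ∀ ξ, max 0 (f ξ - m) ≤ C) :
    ENNReal.ofReal (powEntropy (q / (q - 1)) Q fun ξ => (max 0 (f ξ - m)) ^ (q - 1)) ≤
      ENNReal.ofReal q * ∫⁻ ξ, VPlus μ f ξ * ENNReal.ofReal ((max 0 (f ξ - m)) ^ (q - 2)) ∂Q := by
  have hq1 : 0 < q - 1 := by linarith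
  have ha : 1 < q / (q - 1) := by rw [lt_div_iff₀ hq1]; linarith
  have ha2 : q / (q - 1) ≤ 2 := by rw [div_le_iff₀ hq1]; linarith
  set w : CountingMeasure X → ℝ≥0∞ := fun ξ => ENNReal.ofReal ((max 0 (f ξ - m)) ^ (q - 2)) with hw
  have hwm : Measurable w := by fun_prop
  set d : CountingMeasure X → CountingMeasure X → ℝ≥0∞ := fun ξ θ =>
    ENNReal.ofReal ((max 0 (f ξ - f θ)) ^ 2) with hd
  have hdm : Measurable fun p : CountingMeasure X × CountingMeasure X => d p.1 p.2 := by fun_prop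
  have hGb : ∀ ξ, (max 0 (f ξ - m)) ^ (q - 1) ∈ Set.Icc 0 (C ^ (q - 1)) := fun ξ =>
    rpow_mem_Icc hq1.le ⟨le_max_left _ _, hC ξ⟩
  refine (hQ.ofReal_powEntropy_le ha ha2 (by fun_prop) hGb).trans ?_
  have hpt : ∀ ξ θ : CountingMeasure X, ENNReal.ofReal (powBregman (q / (q - 1))
      ((max 0 (f ξ - m)) ^ (q - 1)) ((max 0 (f θ - m)) ^ (q - 1))) ≤
      ENNReal.ofReal q * (d ξ θ * w ξ + d θ ξ * w θ) := by
    intro ξ θ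
    have hpos : ∀ s t : ℝ, max 0 (max 0 (s - m) - max 0 (t - m)) ≤ max 0 (s - t) := by
      intro s t
      refine max_le (le_max_left _ _) ?_
      rcases le_total (s - m) 0 with h | h
      · rw [max_eq_left h]
        exact (sub_nonpos.2 (le_max_left _ _)).trans (le_max_left _ _)
      · rw [max_eq_right h]
        have := le_max_right 0 (t - m)
        exact le_trans (by linarith) (le_max_right _ _)
    have hsq : ∀ s t : ℝ, (max 0 (max 0 (s - m) - max 0 (t - m))) ^ 2 ≤ (max 0 (s - t)) ^ 2 :=
      fun s t => pow_le_pow_left₀ (le_max_left _ _) (hpos s t) 2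
    have hr : ∀ s : ℝ, 0 ≤ (max 0 (s - m)) ^ (q - 2) := fun s =>
      Real.rpow_nonneg (le_max_left _ _) _
    refine (ENNReal.ofReal_le_ofReal (powBregman_rpow_le hq (le_max_left _ _)
      (le_max_left _ _))).trans ?_
    rw [ENNReal.ofReal_mul (by linarith), ENNReal.ofReal_add (mul_nonneg (sq_nonneg _) (hr _))
      (mul_nonneg (sq_nonneg _) (hr _)), ENNReal.ofReal_mul (sq_nonneg _),
      ENNReal.ofReal_mul (sq_nonneg _)]
    simp only [hd, hw]
    gcongr ENNReal.ofReal q * (ENNReal.ofReal ?_ * _ + ENNReal.ofReal ?_ * _)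
    · exact hsq _ _
    · exact hsq _ _
  have hM := hQ.lintegral_integral (K := fun p => d p.1 p.2 * w p.1) (by fun_prop)
  have hA : Measurable fun p : CountingMeasure X × X => d p.1 (p.1 + single p.2) * w p.1 := by
    fun_prop
  have hB : Measurable fun p : CountingMeasure X × X =>
      d (p.1 + single p.2) p.1 * w (p.1 + single p.2) := by fun_prop
  have hAξ : ∀ ξ, Measurable fun x => d ξ (ξ + single x) * w ξ := fun ξ => by fun_prop
  have hAi : Measurable fun ξ => ∫⁻ x, d ξ (ξ + single x) * w ξ ∂μ := hA.lintegral_prod_right'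
  calc _ ≤ ∫⁻ ξ, ∫⁻ x, ENNReal.ofReal q * (d ξ (ξ + single x) * w ξ +
        d (ξ + single x) ξ * w (ξ + single x)) ∂μ ∂Q :=
        lintegral_mono fun ξ => lintegral_mono fun x => hpt _ _
    _ = ∫⁻ ξ, ENNReal.ofReal q * ((∫⁻ x, d ξ (ξ + single x) * w ξ ∂μ) +
        ∫⁻ x, d (ξ + single x) ξ * w (ξ + single x) ∂μ) ∂Q := by
        refine lintegral_congr fun ξ => ?_
        rw [lintegral_const_mul' _ _ ENNReal.ofReal_ne_top,
          lintegral_add_left (hAξ ξ)]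
    _ = ENNReal.ofReal q * ((∫⁻ ξ, ∫⁻ x, d ξ (ξ + single x) * w ξ ∂μ ∂Q) +
        ∫⁻ ξ, ∫⁻ x, d (ξ + single x) ξ * w (ξ + single x) ∂μ ∂Q) := by
        rw [lintegral_const_mul' _ _ ENNReal.ofReal_ne_top,
          lintegral_add_left hAi]
    _ = ENNReal.ofReal q * ((∫⁻ ξ, ∫⁻ x, d ξ (ξ + single x) * w ξ ∂μ ∂Q) +
        ∫⁻ ξ, ξ.integral (fun x => d ξ (ξ.removePoint x) * w ξ) ∂Q) := by rw [← hM]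
    _ = ENNReal.ofReal q * ∫⁻ ξ, VPlus μ f ξ * w ξ ∂Q := by
        rw [← lintegral_add_left hAi]
        congr 1
        refine lintegral_congr fun ξ => ?_
        rw [VPlus_eq, add_mul, lintegral_mul_const' (w ξ) _ ENNReal.ofReal_ne_top, integral, integral,
          ENNReal.tsum_mul_right]

/-- The case q = 2 of the entropy bound with the shift -M: the positive part is inactive, the weight
is 1, and the entropy is the variance. -/
theorem IsPoissonLaw.ofReal_variance_le (hQ : IsPoissonLaw Q μ) {f : CountingMeasure X → ℝ}
    (hf : Measurable f) {M : ℝ} (hM : ∀ ξ, |f ξ| ≤ M) :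
    ENNReal.ofReal (∫ ξ, (f ξ - ∫ θ, f θ ∂Q) ^ 2 ∂Q) ≤ 2 * ∫⁻ ξ, VPlus μ f ξ ∂Q := by
  have hfb : ∀ ξ, f ξ ∈ Set.Icc (-M) M := fun ξ => abs_le.1 (hM ξ)
  have hpos : ∀ ξ, max 0 (f ξ - -M) = f ξ + M := fun ξ => by
    rw [max_eq_right (by linarith [(hfb ξ).1]), sub_neg_eq_add]
  have h := hQ.ofReal_powEntropy_rpow_le hf (m := -M) (C := M + M) (q := 2) le_rfl fun ξ => by
    rw [hpos]; linarith [(hfb ξ).2]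
  simp only [hpos] at h
  norm_num at h
  refine le_trans (le_of_eq ?_) h
  have hi : Integrable f Q := integrable_of_mem_Icc hf hfb
  have hi2 : Integrable (fun ξ => f ξ ^ 2) Q := by
    refine integrable_of_mem_Icc (A := 0) (B := M ^ 2) (hf.pow_const 2) fun ξ => ⟨sq_nonneg _, ?_⟩
    exact sq_le_sq' (hfb ξ).1 (hfb ξ).2
  congr 1
  set m := ∫ θ, f θ ∂Q with hm
  rw [powEntropy]
  simp only [Real.rpow_ofNat]
  have e1 : ∀ ξ, (f ξ - m) ^ 2 = f ξ ^ 2 + (-(2 * m) * f ξ + m ^ 2) := fun ξ => by ring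
  have e2 : ∀ ξ, (f ξ + M) ^ 2 = f ξ ^ 2 + (2 * M * f ξ + M ^ 2) := fun ξ => by ring
  have hl : ∀ c d, Integrable (fun ξ => c * f ξ + d) Q := fun c d =>
    (hi.const_mul c).add (integrable_const d)
  have hlv : ∀ c d, ∫ ξ, (c * f ξ + d) ∂Q = c * m + d := fun c d => by
    rw [integral_add (hi.const_mul c) (integrable_const d), integral_const_mul]
    simp [hm]
  have hqv : ∀ c d, ∫ ξ, (f ξ ^ 2 + (c * f ξ + d)) ∂Q = ∫ ξ, f ξ ^ 2 ∂Q + (c * m + d) :=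
    fun c d => by rw [integral_add hi2 (hl c d), hlv]
  have e3 : ∫ ξ, (f ξ + M) ∂Q = m + M := by simpa using hlv 1 M
  simp only [e1, e2, hqv, e3]
  ring

/-- The moment bound for bounded functionals. -/
theorem IsPoissonLaw.eLpNorm_le_of_bounded (hQ : IsPoissonLaw Q μ) {f : CountingMeasure X → ℝ}
    (hf : Measurable f) {M : ℝ} (hM : ∀ ξ, |f ξ| ≤ M) {p : ℝ} (hp : 2 ≤ p) :
    eLpNorm (fun ξ => max 0 (f ξ - ∫ θ, f θ ∂Q)) (ENNReal.ofReal p) Q ≤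
      (ENNReal.ofReal (2 * kappa * p) *
        eLpNorm (VPlus μ f) (ENNReal.ofReal (p / 2)) Q) ^ (1 / 2 : ℝ) := by
  have hκ := one_le_kappa
  have hp0 : 0 < p := by linarith
  set m := ∫ θ, f θ ∂Q with hm
  have hfb : ∀ ξ, f ξ ∈ Set.Icc (-M) M := fun ξ => abs_le.1 (hM ξ)
  have hmb : m ∈ Set.Icc (-M) M := integral_mem_Icc hf hfb
  have hM0 : 0 ≤ M := by linarith [hmb.1, hmb.2]
  have hb : ∀ ξ, max 0 (f ξ - m) ∈ Set.Icc 0 (M + M) := fun ξ =>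
    ⟨le_max_left _ _, max_le (by linarith) (by linarith [hmb.1, (hfb ξ).2])⟩
  by_cases htop : eLpNorm (VPlus μ f) (ENNReal.ofReal (p / 2)) Q = ∞
  · have hc : 0 < 2 * kappa * p := by positivity
    rw [htop, ENNReal.mul_top (ENNReal.ofReal_pos.2 hc).ne', ENNReal.top_rpow_of_pos (by norm_num)]
    exact le_top
  set v := (eLpNorm (VPlus μ f) (ENNReal.ofReal (p / 2)) Q).toReal with hv
  have hve : ENNReal.ofReal v = eLpNorm (VPlus μ f) (ENNReal.ofReal (p / 2)) Q :=
    ENNReal.ofReal_toReal htop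
  have hv0 : 0 ≤ v := ENNReal.toReal_nonneg
  -- Centering at the mean matters here: it makes the second moment of the positive part at most the
  -- variance.
  have hsq : ENNReal.ofReal (∫ ξ, (max 0 (f ξ - m)) ^ (2 : ℝ) ∂Q) ≤ 2 * ∫⁻ ξ, VPlus μ f ξ ∂Q := by
    refine (ENNReal.ofReal_le_ofReal ?_).trans (hQ.ofReal_variance_le hf hM)
    simp only [Real.rpow_ofNat]
    refine integral_mono
      (integrable_of_mem_Icc (A := 0) (B := (M + M) ^ 2) (by fun_prop) fun ξ =>
        ⟨sq_nonneg _, pow_le_pow_left₀ (hb ξ).1 (hb ξ).2 2⟩)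
      (integrable_of_mem_Icc (A := 0) (B := (M + M) ^ 2) (by fun_prop) fun ξ =>
        ⟨sq_nonneg _, sq_le_sq' (by linarith [hmb.2, (hfb ξ).1]) (by linarith [hmb.1, (hfb ξ).2])⟩)
      fun ξ => ?_
    change (max 0 (f ξ - m)) ^ 2 ≤ (f ξ - m) ^ 2
    rcases le_total (f ξ - m) 0 with h | h
    · rw [max_eq_left h, zero_pow two_ne_zero]; exact sq_nonneg _
    · rw [max_eq_right h]
  obtain ⟨n, hn⟩ := exists_nat_ge p
  have hmain := integral_rpow_le_of_powEntropy_le (P := Q) (by fun_prop) hb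
    (hQ.aemeasurable_VPlus hf) hv0 hve.ge hsq
    (fun q hq => hQ.ofReal_powEntropy_rpow_le hf hq fun ξ => (hb ξ).2) n p (by linarith) le_rfl hp
    (by linarith)
  rw [← hve, ← ENNReal.ofReal_mul (by positivity), eLpNorm_eq_lintegral_rpow_enorm_toReal
    (by simp; linarith) ENNReal.ofReal_ne_top, ENNReal.toReal_ofReal hp0.le]
  have e : ∀ ξ, ‖max 0 (f ξ - m)‖ₑ ^ p = ENNReal.ofReal ((max 0 (f ξ - m)) ^ p) := fun ξ => by
    rw [Real.enorm_eq_ofReal (hb ξ).1, ENNReal.ofReal_rpow_of_nonneg (hb ξ).1 hp0.le]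
  simp only [e]
  rw [← ofReal_integral_eq_lintegral_ofReal
    (integrable_of_mem_Icc (by fun_prop) fun ξ => rpow_mem_Icc hp0.le (hb ξ))
    (Eventually.of_forall fun ξ => Real.rpow_nonneg (hb ξ).1 _)]
  refine (ENNReal.rpow_le_rpow (ENNReal.ofReal_le_ofReal hmain) (by positivity)).trans
    (le_of_eq ?_)
  have hT : 0 ≤ 2 * kappa * p * v := by positivity
  rw [ENNReal.ofReal_rpow_of_nonneg (Real.rpow_nonneg hT _) (by positivity),
    ENNReal.ofReal_rpow_of_nonneg hT (by norm_num), ← Real.rpow_mul hT]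
  congr 2
  field_simp

theorem VPlus_mono {f g : CountingMeasure X → ℝ} (μ : Measure X)
    (h : ∀ ξ θ, max 0 (g ξ - g θ) ≤ max 0 (f ξ - f θ)) (ξ : CountingMeasure X) :
    VPlus μ g ξ ≤ VPlus μ f ξ := by
  have h2 : ∀ ξ θ, ENNReal.ofReal ((max 0 (g ξ - g θ)) ^ 2) ≤
      ENNReal.ofReal ((max 0 (f ξ - f θ)) ^ 2) := fun ξ θ =>
    ENNReal.ofReal_le_ofReal (pow_le_pow_left₀ (le_max_left _ _) (h ξ θ) 2)
  rw [VPlus_eq, VPlus_eq]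
  exact add_le_add (lintegral_mono fun x => h2 _ _) (ENNReal.tsum_le_tsum fun i => h2 _ _)

theorem VMinus_eq_VPlus_neg (μ : Measure X) (f : CountingMeasure X → ℝ) (ξ : CountingMeasure X) :
    VMinus μ f ξ = VPlus μ (fun ξ => -f ξ) ξ := by
  have h1 : ∀ a b : ℝ, (min 0 (-a - -b)) ^ 2 = (max 0 (a - b)) ^ 2 := fun a b => by
    rw [show -a - -b = -(a - b) by ring, ← neg_zero, min_neg_neg, neg_zero, neg_sq]
  have h2 : ∀ a b : ℝ, (max 0 (-a - -b)) ^ 2 = (min 0 (a - b)) ^ 2 := fun a b => by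
    rw [show -a - -b = -(a - b) by ring, ← neg_zero, max_neg_neg, neg_zero, neg_sq]
  simp only [VPlus, VMinus, addDiff, removeDiff, h1, h2]

theorem max_zero_sq_le (t : ℝ) : (max 0 t) ^ 2 ≤ t ^ 2 := by
  rcases le_total t 0 with h | h
  · rw [max_eq_left h, zero_pow two_ne_zero]; exact sq_nonneg _
  · rw [max_eq_right h]

theorem min_zero_sq_le (t : ℝ) : (min 0 t) ^ 2 ≤ t ^ 2 := by
  rcases le_total t 0 with h | h
  · rw [min_eq_right h]
  · rw [min_eq_left h, zero_pow two_ne_zero]; exact sq_nonneg _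

theorem VPlus_le_VTotal (μ : Measure X) (f : CountingMeasure X → ℝ) (ξ : CountingMeasure X) :
    VPlus μ f ξ ≤ VTotal μ f ξ :=
  add_le_add (lintegral_mono fun _ => ENNReal.ofReal_le_ofReal (min_zero_sq_le _))
    (ENNReal.tsum_le_tsum fun _ => ENNReal.ofReal_le_ofReal (max_zero_sq_le _))

theorem VMinus_le_VTotal (μ : Measure X) (f : CountingMeasure X → ℝ) (ξ : CountingMeasure X) :
    VMinus μ f ξ ≤ VTotal μ f ξ :=
  add_le_add (lintegral_mono fun _ => ENNReal.ofReal_le_ofReal (max_zero_sq_le _))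
    (ENNReal.tsum_le_tsum fun _ => ENNReal.ofReal_le_ofReal (min_zero_sq_le _))

/-- Clamping is monotone and 1-Lipschitz. Hence truncating a functional does not increase its V⁺. -/
theorem max_zero_clamp_sub_le {M : ℝ} (s t : ℝ) :
    max 0 (max (-M) (min M s) - max (-M) (min M t)) ≤ max 0 (s - t) := by
  refine max_le (le_max_left _ _) ?_
  rcases le_total s t with h | h
  · exact (sub_nonpos.2 (by gcongr)).trans (le_max_left _ _)
  · have h1 := abs_max_sub_max_le_max (-M) (min M s) (-M) (min M t)
    have h2 := abs_min_sub_min_le_max M s M t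
    rw [sub_self, abs_zero, max_eq_right (a := 0) (abs_nonneg _)] at h1 h2
    exact ((le_abs_self _).trans (h1.trans h2)).trans
      (by rw [abs_of_nonneg (sub_nonneg.2 h)]; exact le_max_right _ _)

/-- The moment bound for the positive part of an integrable functional. -/
theorem IsPoissonLaw.eLpNorm_posPart_le (hQ : IsPoissonLaw Q μ) {f : CountingMeasure X → ℝ}
    (hf : Measurable f) (hfi : Integrable f Q) {p : ℝ} (hp : 2 ≤ p) :
    eLpNorm (fun ξ => max 0 (f ξ - ∫ θ, f θ ∂Q)) (ENNReal.ofReal p) Q ≤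
      (ENNReal.ofReal (2 * kappa * p) *
        eLpNorm (VPlus μ f) (ENNReal.ofReal (p / 2)) Q) ^ (1 / 2 : ℝ) := by
  set g : ℕ → CountingMeasure X → ℝ := fun n ξ => max (-(n : ℝ)) (min n (f ξ)) with hg
  have hgm : ∀ n, Measurable (g n) := fun n => by fun_prop
  have hev : ∀ ξ, ∀ᶠ n in atTop, g n ξ = f ξ := by
    intro ξ
    obtain ⟨N, hN⟩ := exists_nat_ge |f ξ|
    filter_upwards [eventually_ge_atTop N] with n hn
    have hn' : |f ξ| ≤ n := hN.trans (Nat.cast_le.2 hn)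
    rw [hg]
    simp only
    rw [min_eq_right (abs_le.1 hn').2, max_eq_right (abs_le.1 hn').1]
  have habs : ∀ n ξ, |g n ξ| ≤ n := fun n ξ =>
    abs_le.2 ⟨le_max_left _ _, max_le (by simp) (min_le_left _ _)⟩
  have hdom : ∀ n ξ, |g n ξ| ≤ |f ξ| := by
    intro n ξ
    have hn : (0 : ℝ) ≤ n := Nat.cast_nonneg n
    refine abs_le.2 ⟨?_, max_le (by linarith [abs_nonneg (f ξ)])
      ((min_le_right _ _).trans (le_abs_self _))⟩
    refine le_trans (le_min ?_ (neg_abs_le _)) (le_max_right _ _)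
    linarith [abs_nonneg (f ξ)]
  have hlim : ∀ ξ, Tendsto (fun n => g n ξ) atTop (𝓝 (f ξ)) := fun ξ =>
    tendsto_const_nhds.congr' ((hev ξ).mono fun n h => h.symm)
  have hint : Tendsto (fun n => ∫ ξ, g n ξ ∂Q) atTop (𝓝 (∫ ξ, f ξ ∂Q)) :=
    tendsto_integral_of_dominated_convergence (fun ξ => |f ξ|)
      (fun n => (hgm n).aestronglyMeasurable) hfi.abs
      (fun n => Eventually.of_forall fun ξ => hdom n ξ) (Eventually.of_forall hlim)
  have hmain : ∀ n, eLpNorm (fun ξ => max 0 (g n ξ - ∫ θ, g n θ ∂Q)) (ENNReal.ofReal p) Q ≤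
      (ENNReal.ofReal (2 * kappa * p) *
        eLpNorm (VPlus μ f) (ENNReal.ofReal (p / 2)) Q) ^ (1 / 2 : ℝ) := fun n => by
    refine (hQ.eLpNorm_le_of_bounded (hgm n) (habs n) hp).trans ?_
    gcongr
    refine eLpNorm_mono_enorm fun ξ => ?_
    exact VPlus_mono μ (fun _ _ => max_zero_clamp_sub_le _ _) ξ
  -- Fatou's lemma: the truncations and, by dominated convergence, their means converge, while the
  -- bound is uniform in n.
  refine (Lp.eLpNorm_lim_le_liminf_eLpNorm (f := fun n ξ => max 0 (g n ξ - ∫ θ, g n θ ∂Q))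
    (fun n => (by fun_prop : Measurable fun ξ => max 0 (g n ξ - ∫ θ, g n θ ∂Q)).aestronglyMeasurable)
    _ (Eventually.of_forall fun ξ => ?_)).trans (liminf_le_of_le (by isBoundedDefault)
      fun b hb => ?_)
  · exact tendsto_const_nhds.max ((hlim ξ).sub hint)
  · obtain ⟨n, hn⟩ := hb.exists
    exact hn.trans (hmain n)

end CountingMeasure

/-! ### Transfer to the underlying probability space and conclusion -/

theorem rpow_half_mul_eLpNorm {Ω : Type*} [MeasurableSpace Ω] (P : Measure Ω) (W : Ω → ℝ≥0∞)
    {c p : ℝ} (hc : 0 ≤ c) (hp : 0 < p) :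
    (ENNReal.ofReal c * eLpNorm W (ENNReal.ofReal (p / 2)) P) ^ (1 / 2 : ℝ) =
      ENNReal.ofReal (Real.sqrt c) *
        eLpNorm (fun ω => W ω ^ (1 / 2 : ℝ)) (ENNReal.ofReal p) P := by
  rw [eLpNorm_eq_lintegral_rpow_enorm_toReal (by simpa using hp) ENNReal.ofReal_ne_top,
    eLpNorm_eq_lintegral_rpow_enorm_toReal (by simpa using hp) ENNReal.ofReal_ne_top,
    ENNReal.mul_rpow_of_nonneg _ _ (by norm_num), ENNReal.ofReal_rpow_of_nonneg hc (by norm_num),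
    ← Real.sqrt_eq_rpow, ENNReal.toReal_ofReal hp.le, ENNReal.toReal_ofReal (by linarith),
    ← ENNReal.rpow_mul]
  simp only [enorm_eq_self, ← ENNReal.rpow_mul]
  congr 2
  · refine lintegral_congr fun ω => ?_
    congr 1
    ring
  · field_simp

theorem eLpNorm_max_zero_le_of_isPoissonProcess {Ω X : Type*} [MeasurableSpace Ω]
    [MeasurableSpace X] {P : Measure Ω} [IsProbabilityMeasure P] {μ : Measure X} [SigmaFinite μ]
    {η : Ω → CountingMeasure X} (hη : IsPoissonProcess η μ P)
    {F : Ω → ℝ} {f : CountingMeasure X → ℝ} (hf : Measurable f)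
    (hFf : ∀ᵐ ω ∂P, F ω = f (η ω)) (hF : Integrable F P) {p : ℝ} (hp : 2 ≤ p) :
    eLpNorm (fun ω => max 0 (F ω - ∫ ω', F ω' ∂P)) (ENNReal.ofReal p) P
      ≤ (ENNReal.ofReal (2 * kappa * p) *
          eLpNorm (fun ω => VPlus μ f (η ω)) (ENNReal.ofReal (p / 2)) P) ^ (1 / 2 : ℝ) := by
  have hηm := hη.measurable.aemeasurable (μ := P)
  have := Measure.isProbabilityMeasure_map hηm
  have hQ := CountingMeasure.isPoissonLaw_map hη
  have hi : Integrable f (P.map η) :=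
    (integrable_map_measure hf.aestronglyMeasurable hηm).2 (hF.congr hFf)
  have hm : ∫ ω, F ω ∂P = ∫ θ, f θ ∂(P.map η) := by
    rw [integral_map hηm hf.aestronglyMeasurable]
    exact integral_congr_ae hFf
  have hfm : Measurable fun ξ => max 0 (f ξ - ∫ θ, f θ ∂(P.map η)) := by fun_prop
  have h := hQ.eLpNorm_posPart_le hf hi hp
  rw [eLpNorm_map_measure hfm.aestronglyMeasurable hηm,
    eLpNorm_map_measure (hQ.aemeasurable_VPlus hf).aestronglyMeasurable hηm] at h
  refine le_trans (le_of_eq (eLpNorm_congr_ae ?_)) h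
  filter_upwards [hFf] with ω hω
  rw [hω, hm]
  rfl

theorem eLpNorm_min_zero_le_of_isPoissonProcess {Ω X : Type*} [MeasurableSpace Ω]
    [MeasurableSpace X] {P : Measure Ω} [IsProbabilityMeasure P] {μ : Measure X} [SigmaFinite μ]
    {η : Ω → CountingMeasure X} (hη : IsPoissonProcess η μ P)
    {F : Ω → ℝ} {f : CountingMeasure X → ℝ} (hf : Measurable f)
    (hFf : ∀ᵐ ω ∂P, F ω = f (η ω)) (hF : Integrable F P) {p : ℝ} (hp : 2 ≤ p) :
    eLpNorm (fun ω => min 0 (F ω - ∫ ω', F ω' ∂P)) (ENNReal.ofReal p) P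
      ≤ (ENNReal.ofReal (2 * kappa * p) *
          eLpNorm (fun ω => VMinus μ f (η ω)) (ENNReal.ofReal (p / 2)) P) ^ (1 / 2 : ℝ) := by
  have h := eLpNorm_max_zero_le_of_isPoissonProcess hη hf.neg
    (F := fun ω => -F ω) (hFf.mono fun ω hω => by simp [hω]) hF.neg hp
  have e : ∀ ω, max 0 (-F ω - ∫ ω', -F ω' ∂P) = -min 0 (F ω - ∫ ω', F ω' ∂P) := fun ω => by
    rw [integral_neg, ← max_neg_neg, neg_zero]
    congr 1
    ring
  simp only [e] at h
  simp only [CountingMeasure.VMinus_eq_VPlus_neg]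
  refine le_trans (le_of_eq ?_) h
  exact (eLpNorm_neg (fun ω => min 0 (F ω - ∫ ω', F ω' ∂P)) _ P).symm

theorem theorem4p1 {Ω X : Type*} [MeasurableSpace Ω] [MeasurableSpace X]
    (P : Measure Ω) [IsProbabilityMeasure P] (μ : Measure X) [SigmaFinite μ]
    (η : Ω → CountingMeasure X) (hη : IsPoissonProcess η μ P)
    (F : Ω → ℝ) (f : CountingMeasure X → ℝ) (hf : Measurable f)
    (hFf : ∀ᵐ ω ∂P, F ω = f (η ω)) (hF : Integrable F P)
    (p : ℝ) (hp : 2 ≤ p) :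
    (eLpNorm (fun ω => max 0 (F ω - ∫ ω', F ω' ∂P)) (ENNReal.ofReal p) P
        ≤ (ENNReal.ofReal (2 * kappa * p) *
            eLpNorm (fun ω => VPlus μ f (η ω)) (ENNReal.ofReal (p / 2)) P) ^ (1 / 2 : ℝ) ∧
      (ENNReal.ofReal (2 * kappa * p) *
            eLpNorm (fun ω => VPlus μ f (η ω)) (ENNReal.ofReal (p / 2)) P) ^ (1 / 2 : ℝ)
        = ENNReal.ofReal (Real.sqrt (2 * kappa * p)) *
            eLpNorm (fun ω => VPlus μ f (η ω) ^ (1 / 2 : ℝ)) (ENNReal.ofReal p) P) ∧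
    (eLpNorm (fun ω => min 0 (F ω - ∫ ω', F ω' ∂P)) (ENNReal.ofReal p) P
        ≤ (ENNReal.ofReal (2 * kappa * p) *
            eLpNorm (fun ω => VMinus μ f (η ω)) (ENNReal.ofReal (p / 2)) P) ^ (1 / 2 : ℝ) ∧
      (ENNReal.ofReal (2 * kappa * p) *
            eLpNorm (fun ω => VMinus μ f (η ω)) (ENNReal.ofReal (p / 2)) P) ^ (1 / 2 : ℝ)
        = ENNReal.ofReal (Real.sqrt (2 * kappa * p)) *
            eLpNorm (fun ω => VMinus μ f (η ω) ^ (1 / 2 : ℝ)) (ENNReal.ofReal p) P) ∧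
    (eLpNorm (fun ω => F ω - ∫ ω', F ω' ∂P) (ENNReal.ofReal p) P
        ≤ (ENNReal.ofReal (8 * kappa * p) *
            eLpNorm (fun ω => VTotal μ f (η ω)) (ENNReal.ofReal (p / 2)) P) ^ (1 / 2 : ℝ) ∧
      (ENNReal.ofReal (8 * kappa * p) *
            eLpNorm (fun ω => VTotal μ f (η ω)) (ENNReal.ofReal (p / 2)) P) ^ (1 / 2 : ℝ)
        = ENNReal.ofReal (Real.sqrt (8 * kappa * p)) *
            eLpNorm (fun ω => VTotal μ f (η ω) ^ (1 / 2 : ℝ)) (ENNReal.ofReal p) P) := by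
  have hp0 : 0 < p := by linarith
  have hκ := one_le_kappa
  have hpos := eLpNorm_max_zero_le_of_isPoissonProcess hη hf hFf hF hp
  have hneg := eLpNorm_min_zero_le_of_isPoissonProcess hη hf hFf hF hp
  refine ⟨⟨hpos, rpow_half_mul_eLpNorm P _ (by positivity) hp0⟩,
    ⟨hneg, rpow_half_mul_eLpNorm P _ (by positivity) hp0⟩,
    ⟨?_, rpow_half_mul_eLpNorm P _ (by positivity) hp0⟩⟩
  set m := ∫ ω, F ω ∂P
  set v := eLpNorm (fun ω => VTotal μ f (η ω)) (ENNReal.ofReal (p / 2)) P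
  have h1 : eLpNorm (fun ω => max 0 (F ω - m)) (ENNReal.ofReal p) P ≤
      (ENNReal.ofReal (2 * kappa * p) * v) ^ (1 / 2 : ℝ) := by
    refine hpos.trans ?_
    gcongr
    exact eLpNorm_mono_enorm fun ω => CountingMeasure.VPlus_le_VTotal μ f (η ω)
  have h2 : eLpNorm (fun ω => min 0 (F ω - m)) (ENNReal.ofReal p) P ≤
      (ENNReal.ofReal (2 * kappa * p) * v) ^ (1 / 2 : ℝ) := by
    refine hneg.trans ?_
    gcongr
    exact eLpNorm_mono_enorm fun ω => CountingMeasure.VMinus_le_VTotal μ f (η ω)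
  have hsub : AEStronglyMeasurable (fun ω => F ω - m) P :=
    hF.aestronglyMeasurable.sub aestronglyMeasurable_const
  have hsum : (fun ω => F ω - m) = (fun ω => max 0 (F ω - m)) + fun ω => min 0 (F ω - m) := by
    ext ω
    rw [Pi.add_apply, max_add_min, zero_add]
  calc eLpNorm (fun ω => F ω - m) (ENNReal.ofReal p) P
      ≤ eLpNorm (fun ω => max 0 (F ω - m)) (ENNReal.ofReal p) P +
        eLpNorm (fun ω => min 0 (F ω - m)) (ENNReal.ofReal p) P := by
        rw [hsum]
        exact eLpNorm_add_le (aestronglyMeasurable_const.sup hsub)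
          (aestronglyMeasurable_const.inf hsub) (by
            rw [← ENNReal.ofReal_one]; exact ENNReal.ofReal_le_ofReal (by linarith))
    _ ≤ 2 * (ENNReal.ofReal (2 * kappa * p) * v) ^ (1 / 2 : ℝ) := by
        rw [two_mul]; exact add_le_add h1 h2
    -- The factor 2 from the triangle inequality enters the square root as 4, which turns 2κp into
    -- 8κp.
    _ = (ENNReal.ofReal (8 * kappa * p) * v) ^ (1 / 2 : ℝ) := by
        have h4 : (2 : ℝ≥0∞) = 4 ^ (1 / 2 : ℝ) := by
          rw [show (4 : ℝ≥0∞) = 2 ^ (2 : ℝ) by norm_num, ← ENNReal.rpow_mul]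
          norm_num
        rw [h4, ← ENNReal.mul_rpow_of_nonneg _ _ (by norm_num), ← mul_assoc,
          show 8 * kappa * p = 4 * (2 * kappa * p) by ring,
          ENNReal.ofReal_mul (p := 4) (by norm_num),
          ENNReal.ofReal_ofNat]
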